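/- Let $(W,S)$ be a finite Coxeter system of type $A_n$ ($n\ge 1$), $B_n$ ($n\ge 2$) or $I_2(m)$ ($m\ge 3$), realized as a real reflection group on a Euclidean space $V$ in which only the origin is fixed by $W$, with $S$ acting as the reflections in the walls of a chamber; let $\alpha_s$ ($s\in S$) be the corresponding unit simple roots, so $\langle\alpha_s,\alpha_t\rangle=-\cos(\pi/m(s,t))$. Let $S=S_+\sqcup S_-$ be any bipartition of the Coxeter diagram, $c_\pm=\prod_{s\in S_\pm}s$, let $c=c_-c_+$ be the bipartite Coxeter element, and let $h$ be its order. The Coxeter plane $P$ is the span of $\sum_{s\in S_+}z_s\alpha_s$ and $\sum_{s\in S_-}z_s\alpha_s$, where $z$ is an eigenvector with positive entries of the matrix $(\langle\alpha_s,\alpha_t\rangle)_{s,t\in S}$ (unique up to scaling); in rank one, $P=V$ is a line. Let $T$ be the set of conjugates in $W$ of elements of $S$. A reduced $T$-word for $w\in W$ is a word in $T$ with product $w$ of minimal length, and $u\le v$ in the absolute order if some reduced $T$-word for $u$ is a prefix of some reduced $T$-word for $v$. A parabolic subgroup is a conjugate of a subgroup generated by a subset of $S$; it is noncrossing if it equals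 $\langle t_1,\dots,t_i\rangle$ for some reduced $T$-word $t_1\cdots t_i$ of some $x$ in the interval $[1,c]$ of the absolute order. Let $o\subset V$ be a $W$-orbit of the smallest size among the orbits of nonzero vectors. Then: (1) $o$ has exactly $h$ elements; it is a single $c$-orbit; and orthogonal projection to $P$ maps $o$ bijectively onto the vertices of a regular $h$-gon centred at the origin (for $h=2$, a pair of opposite nonzero points), whose cyclic order is given by $c$: for some $x\in o$, some $r>0$ and suitable orthonormal coordinates on $P$, the projection of $c^kx$ is $r e^{2\pi i k/h}$ for every integer $k\ge 0$. (2) A parabolic subgroup $W'$ of $W$ is noncrossing if and only if the convex hulls in $P$ of the projections of distinct $W'$-orbits contained in $o$ are pairwise disjoint. -/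

import Mathlib

namespace CoxeterPlane

open scoped InnerProductSpace

/-- `M` is, up to relabelling of the diagram, of type `A_n` with `n ≥ 1`, of type `B_n` with
`n ≥ 2`, or of type `I₂(m)` with `m ≥ 3` (`CoxeterMatrix.I k` is the matrix of `I₂(k + 2)`). -/
def IsTypeABI {B : Type*} (M : CoxeterMatrix B) : Prop :=
  (∃ n : ℕ, 1 ≤ n ∧ ∃ e : B ≃ Fin n, M.reindex e = CoxeterMatrix.A n) ∨
  (∃ n : ℕ, 2 ≤ n ∧ ∃ e : B ≃ Fin n, M.reindex e = CoxeterMatrix.B n) ∨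
  (∃ k : ℕ, 1 ≤ k ∧ ∃ e : B ≃ Fin 2, M.reindex e = CoxeterMatrix.I k)

/-! ### Bipartite Coxeter elements -/

/-- A bipartition `S₊ ⊔ S₋` of the Coxeter diagram of `M`: two distinct nodes in the same part
are not joined by an edge, i.e. the corresponding entry of `M` is `2`. -/
structure Bipartition {B : Type*} [Fintype B] [DecidableEq B] (M : CoxeterMatrix B) where
  pos : Finset B
  neg : Finset B
  disjoint : Disjoint pos neg
  union_eq : pos ∪ neg = Finset.univ
  pos_eq_two : ∀ i ∈ pos, ∀ j ∈ pos, i ≠ j → M i j = 2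
  neg_eq_two : ∀ i ∈ neg, ∀ j ∈ neg, i ≠ j → M i j = 2

theorem commute_simple {B W : Type*} [Group W] {M : CoxeterMatrix B} (cs : CoxeterSystem M W)
    {i j : B} (h : M i j = 2) : Commute (cs.simple i) (cs.simple j) := by
  have h1 := cs.simple_mul_simple_pow i j
  rw [h, pow_two] at h1
  have h2 : cs.simple i * cs.simple j = (cs.simple i * cs.simple j)⁻¹ :=
    eq_inv_of_mul_eq_one_left h1
  rw [mul_inv_rev, cs.inv_simple, cs.inv_simple] at h2
  exact h2

section CoxeterElement

variable {B W : Type*} [Fintype B] [DecidableEq B] [Group W] {M : CoxeterMatrix B}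

/-- The product `c₊` of the (pairwise commuting) simple reflections in `S₊`. -/
def cPos (cs : CoxeterSystem M W) (β : Bipartition M) : W :=
  β.pos.noncommProd cs.simple fun i hi j hj hij =>
    commute_simple cs (β.pos_eq_two i hi j hj hij)

/-- The product `c₋` of the (pairwise commuting) simple reflections in `S₋`. -/
def cNeg (cs : CoxeterSystem M W) (β : Bipartition M) : W :=
  β.neg.noncommProd cs.simple fun i hi j hj hij =>
    commute_simple cs (β.neg_eq_two i hi j hj hij)

/-- The bipartite Coxeter element `c = c₋ c₊`. -/
def bipartiteCoxeterElement (cs : CoxeterSystem M W) (β : Bipartition M) : W :=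
  cNeg cs β * cPos cs β

/-- The Coxeter number `h`, the order of the Coxeter element `c`. -/
noncomputable def coxeterNumber (cs : CoxeterSystem M W) (β : Bipartition M) : ℕ :=
  orderOf (bipartiteCoxeterElement cs β)

end CoxeterElement

/-! ### Parabolic subgroups, absolute order, noncrossing parabolic subgroups -/

section Noncrossing

variable {B W : Type*} [Group W] {M : CoxeterMatrix B} (cs : CoxeterSystem M W)

/-- A parabolic subgroup is a conjugate of a standard parabolic subgroup `⟨J⟩`, `J ⊆ S`. -/
def IsParabolic (W' : Subgroup W) : Prop :=
  ∃ (J : Set B) (w : W),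
    W' = (Subgroup.closure (cs.simple '' J)).map (MulAut.conj w).toMonoidHom

/-- `l` is a `T`-word for `w`: a word in the reflections of `W` whose product is `w`. -/
def IsTWord (l : List W) (w : W) : Prop :=
  (∀ t ∈ l, cs.IsReflection t) ∧ l.prod = w

/-- `l` is a reduced `T`-word for `w`: it has minimal length among all `T`-words for `w`. -/
def IsReducedTWord (l : List W) (w : W) : Prop :=
  IsTWord cs l w ∧ ∀ l' : List W, IsTWord cs l' w → l.length ≤ l'.length

/-- The absolute order: `u ≤ v` iff some reduced `T`-word for `u` is a prefix of some
reduced `T`-word for `v`. -/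
def AbsLE (u v : W) : Prop :=
  ∃ l l' : List W, IsReducedTWord cs l u ∧ IsReducedTWord cs l' v ∧ l <+: l'

/-- The interval `[1, c]` in the absolute order. -/
def absInterval (c : W) : Set W :=
  {x | AbsLE cs 1 x ∧ AbsLE cs x c}

/-- `W'` arises from the interval `[1, c]`: it is generated by the letters of a reduced
`T`-word for some element of `[1, c]`. -/
def IsNoncrossing (c : W) (W' : Subgroup W) : Prop :=
  ∃ x ∈ absInterval cs c, ∃ l : List W,
    IsReducedTWord cs l x ∧ W' = Subgroup.closure {t | t ∈ l}

end Noncrossing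

/-! ### Realization as a reflection group and the Coxeter plane -/

/-- The matrix `(-cos (π / m(i, j)))`, the Gram matrix of the unit simple roots. -/
noncomputable def gram {B : Type*} (M : CoxeterMatrix B) : Matrix B B ℝ :=
  Matrix.of fun i j => -Real.cos (Real.pi / (M i j : ℝ))

/-- A realization of `(W, S)` as a real reflection group on a Euclidean space `V` with only the
origin fixed: the simple generators act as the orthogonal reflections in the walls of a chamber,
so that the unit normals `root i` of these walls (the simple roots) have inner products
`-cos (π / m(i, j))`. -/
structure Realization {B W : Type*} [Group W] {M : CoxeterMatrix B} (cs : CoxeterSystem M W)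
    (V : Type*) [NormedAddCommGroup V] [InnerProductSpace ℝ V] where
  /-- the action of `W` on `V` -/
  act : W →* (V ≃ₗᵢ[ℝ] V)
  /-- the unit simple roots -/
  root : B → V
  act_injective : Function.Injective act
  inner_root : ∀ i j, ⟪root i, root j⟫_ℝ = gram M i j
  act_simple : ∀ i, act (cs.simple i) = (ℝ ∙ root i)ᗮ.reflection
  eq_zero_of_fixed : ∀ v : V, (∀ w : W, act w v = v) → v = 0

namespace Realization

variable {B W V : Type*} [Group W] {M : CoxeterMatrix B} {cs : CoxeterSystem M W}
  [NormedAddCommGroup V] [InnerProductSpace ℝ V] (ρ : Realization cs V)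

/-- The orbit of `x` under a subgroup `W'`. -/
def orbit (W' : Subgroup W) (x : V) : Set V :=
  {y | ∃ w ∈ W', ρ.act w x = y}

/-- `o` is a nontrivial orbit of `W`, i.e. the orbit of a nonzero vector. -/
def IsNontrivialOrbit (o : Set V) : Prop :=
  ∃ x : V, x ≠ 0 ∧ o = ρ.orbit ⊤ x

/-- `o` is a nontrivial orbit of `W` of the smallest possible size. -/
def IsSmallestOrbit (o : Set V) : Prop :=
  ρ.IsNontrivialOrbit o ∧ ∀ o' : Set V, ρ.IsNontrivialOrbit o' → o.ncard ≤ o'.ncard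

/-- The blocks of the partition of `o` induced by `W'`: the `W'`-orbits in `o`. -/
def blocks (W' : Subgroup W) (o : Set V) : Set (Set V) :=
  {b | ∃ x ∈ o, b = ρ.orbit W' x}

/-- The Coxeter plane: the span of `∑_{s ∈ S₊} z_s α_s` and `∑_{s ∈ S₋} z_s α_s`, where `z` is an
eigenvector with positive entries of the Gram matrix of the simple roots `α_s`. By Perron-Frobenius
such a `z` exists and is unique up to a positive scalar when the diagram is connected (it belongs
to the smallest eigenvalue), so it does not matter that the span is taken over all such `z`. -/
def plane [Fintype B] [DecidableEq B] (β : Bipartition M) : Submodule ℝ V :=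
  Submodule.span ℝ {v | ∃ z : B → ℝ, (∀ i, 0 < z i) ∧
    (∃ μ : ℝ, (gram M).mulVec z = μ • z) ∧
    (v = ∑ i ∈ β.pos, z i • ρ.root i ∨ v = ∑ i ∈ β.neg, z i • ρ.root i)}

/-- Orthogonal projection to the Coxeter plane. -/
noncomputable def proj [FiniteDimensional ℝ V] [Fintype B] [DecidableEq B] (β : Bipartition M) :
    V → ρ.plane β :=
  fun v => (ρ.plane β).orthogonalProjectionOnto v

/-- `o` projects bijectively onto the vertices of a regular `h`-gon, centred at the origin, in the
Coxeter plane, and the cyclic order of the vertices is given by `c`: for some `x ∈ o`, the orbit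
consists of `x, c x, c² x, …`, and in suitable orthonormal coordinates of the plane the
projection of `c ^ k x` is `r exp (2πik/h)` with `r > 0`. -/
def ProjectsToPolygon [FiniteDimensional ℝ V] [Fintype B] [DecidableEq B] (β : Bipartition M)
    (o : Set V) : Prop :=
  Set.InjOn (ρ.proj β) o ∧
  ∃ φ : ρ.plane β →ₗᵢ[ℝ] ℂ, ∃ r : ℝ, 0 < r ∧ ∃ x ∈ o,
    (o = {y | ∃ k : ℕ, ρ.act (bipartiteCoxeterElement cs β ^ k) x = y}) ∧
    ∀ k : ℕ, φ (ρ.proj β (ρ.act (bipartiteCoxeterElement cs β ^ k) x)) =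
      r * Complex.exp (2 * Real.pi * Complex.I * k / coxeterNumber cs β)

/-- The convex hulls of the blocks of the Coxeter-plane diagram of `W'` are pairwise disjoint. -/
def HullsDisjoint [FiniteDimensional ℝ V] [Fintype B] [DecidableEq B] (β : Bipartition M)
    (o : Set V) (W' : Subgroup W) : Prop :=
  (ρ.blocks W' o).PairwiseDisjoint fun b => convexHull ℝ (ρ.proj β '' b)

end Realization

end CoxeterPlane

/-! Everything is reduced to one combinatorial picture: `c` permutes the `h` points `x k` of a
spanning orbit cyclically (`IsCyclicOrbit`), and both sides of (2) are compared with the condition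
`NoncrossingOrbits` that the `W'`-orbits form a noncrossing partition of this cyclic sequence.

For (1): if the Gram matrix has a positive eigenvector of eigenvalue `1 - cos (π / h)`, then `c`
rotates the Coxeter plane by `2π / h` (`exists_planeCoordinate`). By irreducibility a nontrivial
orbit spans `V`, so one of its points has nonzero projection, and the `c`-translates of that point
already project to `h` distinct vertices of a regular polygon. An orbit with at most `h` points is
therefore a single `c`-orbit (`exists_cyclicOrbit`), and it remains to exhibit one orbit with at
most `h` points in each type.

For (2), the geometric half is planar (`hullsDisjoint_iff`): crossing chords meet, and complementary
arcs are separated by a line. The algebraic half rests on telescoping: `1 - c` is injective and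
sends the arc sum `x i + ... + x (j - 1)` to `x i - x j`. If `c = w y` with additive reflection
lengths, `1 - c` maps `Fix y` onto `(Fix w)ᗮ`. So if `x i` and `x j` are in one block, `y` fixes the
arc sum, hence preserves the arc (`ArcRigid`); intersecting two crossing arcs then merges their
blocks. Conversely, given a noncrossing partition and `U = Fix W'`, the isometry equal to `1` on `U`
and to `c` on the preimage of `Uᗮ` under `1 - c` sends each point to the next point of its block. By
Carter's lemma (`exists_word_of_isometry`) it is an element of `W`, and it lies below `c`; what is
left is that the letters of a reduced word for it generate `W'`.

The types enter through the shape of the orbit. In type A it is a simplex, in type B and rank one a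
cross-polytope; there a reflection moves few points (`FewMoved`), which yields arc rigidity, the
closedness of parabolic subgroups and the generation statement. Dihedral groups are handled directly
through their action on indices. -/

namespace CoxeterPlane
open scoped InnerProductSpace
open Module (finrank)
namespace Realization

variable {B W V : Type*} [Group W] {M : CoxeterMatrix B} {cs : CoxeterSystem M W}
  [NormedAddCommGroup V] [InnerProductSpace ℝ V] (ρ : Realization cs V)

/-! ### Reflections -/

theorem act_mul_apply (u w : W) (v : V) : ρ.act (u * w) v = ρ.act u (ρ.act w v) := by
  rw [map_mul]; rfl

theorem act_one_apply (v : V) : ρ.act 1 v = v := by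
  rw [map_one]; rfl

theorem act_inv_act (w : W) (v : V) : ρ.act w⁻¹ (ρ.act w v) = v := by
  rw [← act_mul_apply, inv_mul_cancel, act_one_apply]

theorem act_act_inv (w : W) (v : V) : ρ.act w (ρ.act w⁻¹ v) = v := by
  rw [← act_mul_apply, mul_inv_cancel, act_one_apply]

theorem act_inv_eq {w : W} {u v : V} (h : ρ.act w u = v) : ρ.act w⁻¹ v = u := by
  rw [← h, act_inv_act]

theorem inner_act_act (w : W) (u v : V) : ⟪ρ.act w u, ρ.act w v⟫_ℝ = ⟪u, v⟫_ℝ :=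
  (ρ.act w).inner_map_map u v

theorem inner_act_left (w : W) (u v : V) : ⟪ρ.act w u, v⟫_ℝ = ⟪u, ρ.act w⁻¹ v⟫_ℝ := by
  rw [← ρ.inner_act_act w u, act_act_inv]

theorem eq_of_act_eq {u w : W} (h : ∀ v, ρ.act u v = ρ.act w v) : u = w :=
  ρ.act_injective (LinearIsometryEquiv.ext h)

theorem inner_root_self (i : B) : ⟪ρ.root i, ρ.root i⟫_ℝ = 1 := by
  rw [ρ.inner_root]; simp [gram]

theorem act_simple_apply (i : B) (v : V) :
    ρ.act (cs.simple i) v = v - (2 * ⟪ρ.root i, v⟫_ℝ) • ρ.root i := by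
  have h1 : ‖ρ.root i‖ = 1 := by
    have := ρ.inner_root_self i
    rw [real_inner_self_eq_norm_sq] at this
    nlinarith [norm_nonneg (ρ.root i)]
  rw [ρ.act_simple, Submodule.reflection_orthogonal_apply, Submodule.reflection_singleton_apply, h1]
  simp only [RCLike.ofReal_real_eq_id, id_eq]
  rw [neg_sub, two_smul, ← two_smul ℝ, smul_smul]
  simp

theorem exists_unit_of_isReflection {t : W} (ht : cs.IsReflection t) :
    ∃ b : V, ⟪b, b⟫_ℝ = 1 ∧ ∀ v, ρ.act t v = v - (2 * ⟪b, v⟫_ℝ) • b := by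
  obtain ⟨w, i, rfl⟩ := ht
  refine ⟨ρ.act w (ρ.root i), ?_, fun v => ?_⟩
  · rw [inner_act_act, inner_root_self]
  · rw [act_mul_apply, act_mul_apply, act_simple_apply, map_sub, map_smul, act_act_inv,
      inner_act_left]

theorem act_act_of_isReflection {t : W} (ht : cs.IsReflection t) (v : V) :
    ρ.act t (ρ.act t v) = v := by
  rw [← act_mul_apply, ht.mul_self, act_one_apply]

/-- A reflection that moves `a` to `b ≠ a` is the reflection along `a - b`. -/
theorem act_eq_of_isReflection {t : W} (ht : cs.IsReflection t) {a b : V} (hab : ρ.act t a = b)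
    (hne : a ≠ b) (v : V) :
    ρ.act t v = v - (2 * ⟪a - b, v⟫_ℝ / ⟪a - b, a - b⟫_ℝ) • (a - b) := by
  obtain ⟨e, he, hv⟩ := ρ.exists_unit_of_isReflection ht
  have h1 : a - b = (2 * ⟪e, a⟫_ℝ) • e := by rw [← hab, hv]; abel
  have h2 : (2 * ⟪e, a⟫_ℝ) ≠ 0 := by
    intro h; rw [h, zero_smul, sub_eq_zero] at h1; exact hne h1
  rw [h1, hv]
  simp only [inner_smul_left, inner_smul_right, he, smul_smul, RCLike.conj_to_real]
  congr 2
  have h3 : ⟪e, a⟫_ℝ ≠ 0 := fun h => h2 (by rw [h, mul_zero])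
  field_simp

theorem act_eq_self_of_inner_eq_zero {t : W} (ht : cs.IsReflection t) {a b : V}
    (hab : ρ.act t a = b) (hne : a ≠ b) {v : V} (h : ⟪a - b, v⟫_ℝ = 0) : ρ.act t v = v := by
  rw [ρ.act_eq_of_isReflection ht hab hne, h]; simp

theorem inner_eq_zero_of_act_eq_self {t : W} {a b : V}
    (hab : ρ.act t a = b) {v : V} (h : ρ.act t v = v) : ⟪a - b, v⟫_ℝ = 0 := by
  rw [inner_sub_left, ← hab]
  nth_rewrite 2 [← h]
  rw [inner_act_act, sub_self]

/-- The pointwise stabilizer-fixed subspace of a subgroup. -/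
def fixed (W' : Subgroup W) : Submodule ℝ V where
  carrier := {v | ∀ w ∈ W', ρ.act w v = v}
  add_mem' := fun ha hb w hw => by rw [map_add, ha w hw, hb w hw]
  zero_mem' := fun w _ => map_zero _
  smul_mem' := fun r v hv w hw => by rw [map_smul, hv w hw]

/-- The subspace of vectors fixed by an isometry. -/
def _root_.CoxeterPlane.fixedSpace (g : V ≃ₗᵢ[ℝ] V) : Submodule ℝ V where
  carrier := {v | g v = v}
  add_mem' := fun {a b} ha hb => by
    simp only [Set.mem_ofPred_eq] at ha hb ⊢; rw [map_add, ha, hb]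
  zero_mem' := map_zero _
  smul_mem' := fun r v hv => by
    simp only [Set.mem_ofPred_eq] at hv ⊢; rw [map_smul, hv]

theorem _root_.CoxeterPlane.mem_fixedSpace {g : V ≃ₗᵢ[ℝ] V} {v : V} :
    v ∈ fixedSpace g ↔ g v = v := Iff.rfl

theorem fixed_closure (R : Set W) {v : V} :
    v ∈ ρ.fixed (Subgroup.closure R) ↔ ∀ t ∈ R, ρ.act t v = v := by
  refine ⟨fun h t ht => h t (Subgroup.subset_closure ht), fun h w hw => ?_⟩
  induction hw using Subgroup.closure_induction with
  | mem t ht => exact h t ht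
  | one => exact ρ.act_one_apply v
  | mul a b _ _ ha hb => rw [act_mul_apply, hb, ha]
  | inv a _ ha => exact ρ.act_inv_eq ha

/-! ### Lengths of words in reflections -/

section Length

/-- The common fixed space of the letters of a word. -/
def fixedWord (l : List W) : Submodule ℝ V := ρ.fixed (Subgroup.closure {t | t ∈ l})

theorem mem_fixedWord {l : List W} {v : V} : v ∈ ρ.fixedWord l ↔ ∀ t ∈ l, ρ.act t v = v :=
  ρ.fixed_closure _

theorem act_prod_eq_self {l : List W} {v : V} (h : ∀ t ∈ l, ρ.act t v = v) :
    ρ.act l.prod v = v := by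
  induction l with
  | nil => exact ρ.act_one_apply v
  | cons t l ih =>
    rw [List.prod_cons, act_mul_apply, ih fun s hs => h s (List.mem_cons_of_mem _ hs),
      h t List.mem_cons_self]

theorem fixedWord_le {l : List W} : ρ.fixedWord l ≤ fixedSpace (ρ.act l.prod) := fun _ hv =>
  ρ.act_prod_eq_self (ρ.mem_fixedWord.1 hv)

variable [FiniteDimensional ℝ V]

/-- Each letter cuts the common fixed space by one hyperplane at most. -/
theorem finrank_le_finrank_fixedWord_add {l : List W} (hl : ∀ t ∈ l, cs.IsReflection t) :
    finrank ℝ V ≤ finrank ℝ (ρ.fixedWord l) + l.length := by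
  induction l with
  | nil =>
    have : ρ.fixedWord [] = ⊤ := by
      rw [eq_top_iff]; intro v _; rw [mem_fixedWord]; simp
    rw [this, finrank_top]; simp
  | cons t l ih =>
    have ih := ih fun s hs => hl s (List.mem_cons_of_mem _ hs)
    obtain ⟨b, hb, hv⟩ := ρ.exists_unit_of_isReflection (hl t List.mem_cons_self)
    have h1 : ρ.fixedWord l ⊓ (ℝ ∙ b)ᗮ ≤ ρ.fixedWord (t :: l) := by
      rintro v ⟨h1, h2⟩
      rw [SetLike.mem_coe, mem_fixedWord] at h1
      rw [SetLike.mem_coe, Submodule.mem_orthogonal_singleton_iff_inner_right] at h2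
      rw [mem_fixedWord]
      intro s hs
      rcases List.mem_cons.1 hs with rfl | hs
      · rw [hv, h2]; simp
      · exact h1 s hs
    have h2 := Submodule.finrank_mono h1
    have h3 := Submodule.finrank_sup_add_finrank_inf_eq (ρ.fixedWord l) (ℝ ∙ b)ᗮ
    have h4 := Submodule.finrank_le (ρ.fixedWord l ⊔ (ℝ ∙ b)ᗮ)
    have h5 := (ℝ ∙ b).finrank_add_finrank_orthogonal
    have h6 := finrank_span_le_card (R := ℝ) ({b} : Set V)
    simp only [Set.toFinset_singleton, Finset.card_singleton] at h6
    rw [List.length_cons]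
    omega

theorem finrank_le_finrank_fixedSpace_add {l : List W} {w : W} (h : IsTWord cs l w) :
    finrank ℝ V ≤ finrank ℝ (fixedSpace (ρ.act w)) + l.length := by
  have h1 := ρ.finrank_le_finrank_fixedWord_add h.1
  have h2 := Submodule.finrank_mono (ρ.fixedWord_le (l := l))
  rw [h.2] at h2
  omega

/-- Carter's lemma: if any two points of a spanning set `o` are exchanged by a reflection of `W`,
then an isometry preserving `o` is a product of `dim V - dim Fix g` reflections of `W`. -/
theorem exists_word_of_isometry {o : Set V} (hspan : Submodule.span ℝ o = ⊤)
    (hT : ∀ a ∈ o, ∀ b ∈ o, a ≠ b → ∃ t, cs.IsReflection t ∧ ρ.act t a = b)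
    (hW : ∀ w, ∀ a ∈ o, ρ.act w a ∈ o) (d : ℕ) (g : V ≃ₗᵢ[ℝ] V) (hg : ∀ a ∈ o, g a ∈ o)
    (hd : finrank ℝ V ≤ finrank ℝ (fixedSpace g) + d) :
    ∃ l : List W, (∀ t ∈ l, cs.IsReflection t ∧ fixedSpace g ≤ fixedSpace (ρ.act t)) ∧
      ρ.act l.prod = g ∧ l.length ≤ d := by
  induction d generalizing g with
  | zero =>
    refine ⟨[], by simp, ?_, le_rfl⟩
    have : fixedSpace g = ⊤ :=
      Submodule.eq_top_of_finrank_eq (le_antisymm (Submodule.finrank_le _) hd)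
    ext v
    have hv : v ∈ fixedSpace g := this ▸ Submodule.mem_top
    rw [mem_fixedSpace.1 hv, List.prod_nil, act_one_apply]
  | succ d ih =>
    by_cases hfix : ∀ a ∈ o, g a = a
    · refine ⟨[], by simp, ?_, by simp⟩
      ext v
      have : Submodule.span ℝ o ≤ fixedSpace g := Submodule.span_le.2 hfix
      have hv : v ∈ fixedSpace g := this (hspan ▸ Submodule.mem_top)
      rw [mem_fixedSpace.1 hv, List.prod_nil, act_one_apply]
    · push Not at hfix
      obtain ⟨a, ha, hne⟩ := hfix
      -- The root of `t` is along `a - g a`, which is orthogonal to `Fix g`. So `t g` keeps all of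
      -- `Fix g` and also fixes `a`: the fixed space grows.
      obtain ⟨t, ht, hta⟩ := hT a ha (g a) (hg a ha) hne.symm
      have htg : fixedSpace g ≤ fixedSpace (ρ.act t) := by
        intro v hv
        refine ρ.act_eq_self_of_inner_eq_zero ht hta hne.symm ?_
        rw [inner_sub_left]
        nth_rewrite 2 [← mem_fixedSpace.1 hv]
        rw [g.inner_map_map, sub_self]
      have hle : fixedSpace g ≤ fixedSpace (ρ.act t * g) := by
        intro v hv
        rw [mem_fixedSpace, LinearIsometryEquiv.coe_mul, Function.comp_apply, mem_fixedSpace.1 hv,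
          mem_fixedSpace.1 (htg hv)]
      have hlt : fixedSpace g < fixedSpace (ρ.act t * g) := by
        refine lt_of_le_of_ne hle fun h => hne ?_
        have : a ∈ fixedSpace (ρ.act t * g) := by
          rw [mem_fixedSpace, LinearIsometryEquiv.coe_mul, Function.comp_apply, ← hta,
            act_act_of_isReflection _ ht]
        rw [← h] at this
        exact this
      have := Submodule.finrank_lt_finrank_of_lt hlt
      obtain ⟨l, hl, hprod, hlen⟩ := ih (ρ.act t * g)
        (fun b hb => hW t _ (hg b hb)) (by omega)
      refine ⟨t :: l, ?_, ?_, by simp [hlen]⟩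
      · intro s hs
        rcases List.mem_cons.1 hs with rfl | hs
        · exact ⟨ht, htg⟩
        · exact ⟨(hl s hs).1, hle.trans (hl s hs).2⟩
      · rw [List.prod_cons, map_mul, hprod, ← mul_assoc, ← map_mul, ht.mul_self, map_one, one_mul]

end Length

end Realization
end CoxeterPlane

namespace CoxeterPlane
open scoped InnerProductSpace
open Module (finrank)
namespace Realization

variable {B W V : Type*} [Group W] {M : CoxeterMatrix B} {cs : CoxeterSystem M W}
  [NormedAddCommGroup V] [InnerProductSpace ℝ V] (ρ : Realization cs V)

/-! ### Orbits that are cyclic under an element of `W` -/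

/-- The points `x k`, `k ∈ ℤ`, form a `W`-orbit of `h` elements which spans `V` and on which
`c` acts by `x k ↦ x (k + 1)`. -/
structure IsCyclicOrbit (c : W) (h : ℕ) (x : ℤ → V) : Prop where
  pos : 0 < h
  act_succ : ∀ k, ρ.act c (x k) = x (k + 1)
  eq_iff : ∀ k l, x k = x l ↔ (h : ℤ) ∣ l - k
  exists_act : ∀ w k, ∃ l, ρ.act w (x k) = x l
  span_eq : Submodule.span ℝ (Set.range x) = ⊤

/-- The sum of the points on the arc `[i, j)`. -/
noncomputable def arcSum {V : Type*} [AddCommMonoid V] (x : ℤ → V) (i j : ℤ) : V :=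
  ∑ m ∈ Finset.Ico i j, x m

theorem arcSum_add_arcSum {V : Type*} [AddCommMonoid V] (x : ℤ → V) {i j k : ℤ} (hij : i ≤ j)
    (hjk : j ≤ k) : arcSum x i j + arcSum x j k = arcSum x i k := by
  rw [arcSum, arcSum, arcSum, ← Finset.Ico_union_Ico_eq_Ico hij hjk, Finset.sum_union]
  exact Finset.Ico_disjoint_Ico_consecutive i j k

theorem arcSum_succ {V : Type*} [AddCommMonoid V] (x : ℤ → V) (i : ℤ) :
    arcSum x i (i + 1) = x i := by
  have : Finset.Ico i (i + 1) = {i} := by ext m; simp; omega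
  rw [arcSum, this, Finset.sum_singleton]

/-- `x i` and `x j` lie in the same `W'`-orbit. -/
def Linked (W' : Subgroup W) (x : ℤ → V) (i j : ℤ) : Prop := ∃ w ∈ W', ρ.act w (x i) = x j

/-- The partition of the cyclically ordered points `x k` into `W'`-orbits is noncrossing. -/
def NoncrossingOrbits (W' : Subgroup W) (x : ℤ → V) (h : ℕ) : Prop :=
  ∀ i k j l : ℤ, i < k → k < j → j < l → l < i + h → ρ.Linked W' x i j → ρ.Linked W' x k l →
    ρ.Linked W' x i k

/-- An element of `W` that fixes the sum over an arc preserves the arc. -/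
def ArcRigid (x : ℤ → V) (h : ℕ) : Prop :=
  ∀ i j : ℤ, i < j → j < i + h → ∀ w, ρ.act w (arcSum x i j) = arcSum x i j →
    ∀ m, i ≤ m → m < j → ∃ m', i ≤ m' ∧ m' < j ∧ ρ.act w (x m) = x m'

/-- Any two distinct points are exchanged by a reflection. -/
def ReflectionTransitive (x : ℤ → V) : Prop :=
  ∀ k l, x k ≠ x l → ∃ t, cs.IsReflection t ∧ ρ.act t (x k) = x l

/-- `W'` contains the reflections which fix the fixed space of `W'`. -/
def ReflectionClosed (W' : Subgroup W) : Prop :=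
  ∀ t, cs.IsReflection t → (∀ v ∈ ρ.fixed W', ρ.act t v = v) → t ∈ W'

variable {ρ}

theorem Linked.refl (W' : Subgroup W) (x : ℤ → V) (i : ℤ) : ρ.Linked W' x i i :=
  ⟨1, W'.one_mem, ρ.act_one_apply _⟩

theorem Linked.symm {W' : Subgroup W} {x : ℤ → V} {i j : ℤ} (h : ρ.Linked W' x i j) :
    ρ.Linked W' x j i := by
  obtain ⟨w, hw, e⟩ := h
  exact ⟨w⁻¹, W'.inv_mem hw, ρ.act_inv_eq e⟩

theorem Linked.trans {W' : Subgroup W} {x : ℤ → V} {i j k : ℤ} (h : ρ.Linked W' x i j)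
    (h' : ρ.Linked W' x j k) : ρ.Linked W' x i k := by
  obtain ⟨w, hw, e⟩ := h
  obtain ⟨w', hw', e'⟩ := h'
  exact ⟨w' * w, W'.mul_mem hw' hw, by rw [act_mul_apply, e, e']⟩

theorem Linked.of_eq {W' : Subgroup W} {x : ℤ → V} {i j : ℤ} (h : x i = x j) :
    ρ.Linked W' x i j := ⟨1, W'.one_mem, by rw [act_one_apply, h]⟩

theorem Linked.sub_mem {W' : Subgroup W} {x : ℤ → V} {i j : ℤ} (h : ρ.Linked W' x i j) :
    x i - x j ∈ (ρ.fixed W')ᗮ := by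
  obtain ⟨w, hw, e⟩ := h
  rw [Submodule.mem_orthogonal]
  intro u hu
  rw [inner_sub_right, ← e]
  nth_rewrite 2 [← hu w hw]
  rw [inner_act_act, sub_self]

/-- The reflection exchanging the two points has its root along their difference, so it fixes `Fix
W'` and lies in `W'` by closedness. This is the converse of `Linked.sub_mem`. -/
theorem linked_of_sub_mem {W' : Subgroup W} {x : ℤ → V} (hT : ρ.ReflectionTransitive x)
    (hW' : ρ.ReflectionClosed W') {i j : ℤ} (h : x i - x j ∈ (ρ.fixed W')ᗮ) :
    ρ.Linked W' x i j := by
  by_cases hne : x i = x j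
  · exact .of_eq hne
  obtain ⟨t, ht, e⟩ := hT i j hne
  refine ⟨t, hW' t ht fun v hv => ρ.act_eq_self_of_inner_eq_zero ht e hne ?_, e⟩
  exact Submodule.inner_left_of_mem_orthogonal hv h

theorem isReducedTWord_of_length [FiniteDimensional ℝ V] {l : List W} {w : W} (hl : IsTWord cs l w)
    (h : finrank ℝ (fixedSpace (ρ.act w)) + l.length ≤ finrank ℝ V) : IsReducedTWord cs l w :=
  ⟨hl, fun l' hl' => by have := ρ.finrank_le_finrank_fixedSpace_add hl'; omega⟩

namespace IsCyclicOrbit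

variable {c : W} {h : ℕ} {x : ℤ → V} (hx : ρ.IsCyclicOrbit c h x)
include hx

theorem apply_add (k : ℤ) : x (k + h) = x k := ((hx.eq_iff _ _).2 (by simp)).symm

theorem exists_mem_window (i k : ℤ) : ∃ l, i ≤ l ∧ l < i + h ∧ x l = x k := by
  have hpos : (0 : ℤ) < h := by exact_mod_cast hx.pos
  refine ⟨i + (k - i) % h, ?_, ?_, (hx.eq_iff _ _).2 ?_⟩
  · have := Int.emod_nonneg (k - i) hpos.ne'; omega
  · have := Int.emod_lt_of_pos (k - i) hpos; omega
  · have := Int.dvd_self_sub_emod (x := k - i) (m := h)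
    rwa [sub_sub] at this

theorem eq_of_mem_window {i k l : ℤ} (hk : i ≤ k) (hk' : k < i + h) (hl : i ≤ l)
    (hl' : l < i + h) (e : x k = x l) : k = l := by
  have := Int.eq_zero_of_abs_lt_dvd ((hx.eq_iff _ _).1 e) (by rw [abs_lt]; constructor <;> omega)
  omega

theorem act_arcSum_self (i j : ℤ) : ρ.act c (arcSum x i j) = arcSum x (i + 1) (j + 1) := by
  rw [arcSum, map_sum, arcSum, ← Finset.map_add_right_Ico, Finset.sum_map]
  exact Finset.sum_congr rfl fun k _ => hx.act_succ k

/-- Telescoping. As `1 - c` is injective, the arc sum is the only vector with this property. -/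
theorem arcSum_sub_act {i j : ℤ} (hij : i ≤ j) :
    arcSum x i j - ρ.act c (arcSum x i j) = x i - x j := by
  have h1 := arcSum_add_arcSum x (by omega : i ≤ i + 1) (by omega : i + 1 ≤ j + 1)
  have h2 := arcSum_add_arcSum x hij (by omega : j ≤ j + 1)
  rw [arcSum_succ] at h1 h2
  rw [hx.act_arcSum_self, sub_eq_sub_iff_add_eq_add, h2, h1]

/-- An arc of at most one period consists of distinct points, so an injective map of it into itself
permutes the summands. -/
theorem act_arcSum_of_mapsTo {i j : ℤ} (hij : j ≤ i + h) {w : W}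
    (hw : ∀ m, i ≤ m → m < j → ∃ m', i ≤ m' ∧ m' < j ∧ ρ.act w (x m) = x m') :
    ρ.act w (arcSum x i j) = arcSum x i j := by
  classical
  have hinj : Set.InjOn x (Finset.Ico i j) := by
    intro k hk l hl e
    simp only [Finset.coe_Ico, Set.mem_Ico] at hk hl
    exact hx.eq_of_mem_window (i := i) hk.1 (by omega) hl.1 (by omega) e
  have h1 : arcSum x i j = ∑ v ∈ (Finset.Ico i j).image x, v := by
    rw [Finset.sum_image hinj]; rfl
  have h2 : ((Finset.Ico i j).image x).image (ρ.act w) = (Finset.Ico i j).image x := by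
    refine Finset.eq_of_subset_of_card_le ?_ ?_
    · intro v hv
      simp only [Finset.mem_image, Finset.mem_Ico] at hv ⊢
      obtain ⟨_, ⟨m, hm, rfl⟩, rfl⟩ := hv
      obtain ⟨m', h1, h2, e⟩ := hw m hm.1 hm.2
      exact ⟨m', ⟨h1, h2⟩, e.symm⟩
    · rw [Finset.card_image_of_injective _ (ρ.act w).injective]
  rw [h1, map_sum]
  nth_rewrite 2 [← h2]
  rw [Finset.sum_image (ρ.act w).injective.injOn]

/-- The sum of the whole orbit is `W`-invariant, and `W` fixes only the origin. -/
theorem arcSum_full : arcSum x 0 h = 0 := by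
  refine ρ.eq_zero_of_fixed _ fun w => hx.act_arcSum_of_mapsTo (by omega) fun m _ _ => ?_
  obtain ⟨l, e⟩ := hx.exists_act w m
  obtain ⟨l', h1, h2, e'⟩ := hx.exists_mem_window 0 l
  exact ⟨l', h1, by omega, by rw [e, e']⟩

theorem eq_zero_of_inner_eq_zero {v : V} (hv : ∀ k, ⟪v, x k⟫_ℝ = 0) : v = 0 := by
  have : Submodule.span ℝ (Set.range x) ≤ (ℝ ∙ v)ᗮ := by
    rw [Submodule.span_le]
    rintro _ ⟨k, rfl⟩
    exact Submodule.mem_orthogonal_singleton_iff_inner_right.2 (hv k)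
  have hv' : v ∈ (ℝ ∙ v)ᗮ := this (hx.span_eq ▸ Submodule.mem_top)
  exact inner_self_eq_zero.1 (Submodule.mem_orthogonal_singleton_iff_inner_right.1 hv')

/-- A vector fixed by `c` has the same inner product with every `x k`; since the `x k` add up to
zero over a period, that inner product is zero, and the `x k` span. -/
theorem fixedSpace_eq_bot : fixedSpace (ρ.act c) = ⊥ := by
  rw [eq_bot_iff]
  intro v hv
  have hv : ρ.act c v = v := hv
  have h1 : ∀ k, ⟪v, x (k + 1)⟫_ℝ = ⟪v, x k⟫_ℝ := fun k => by
    rw [← hx.act_succ]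
    nth_rewrite 1 [← hv]
    rw [inner_act_act]
  have h2 : ∀ k, ⟪v, x k⟫_ℝ = ⟪v, x 0⟫_ℝ := by
    intro k
    induction k using Int.induction_on with
    | zero => rfl
    | succ k ih => rw [h1, ih]
    | pred k ih => rw [← ih, ← h1, sub_add_cancel]
  have h3 : (h : ℝ) * ⟪v, x 0⟫_ℝ = 0 := by
    have := congrArg (fun u => ⟪v, u⟫_ℝ) hx.arcSum_full
    simp only [arcSum, inner_sum, inner_zero_right] at this
    rw [Finset.sum_congr rfl fun k _ => h2 k] at this
    simpa using this
  have h4 : ⟪v, x 0⟫_ℝ = 0 := by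
    have : (h : ℝ) ≠ 0 := by exact_mod_cast hx.pos.ne'
    simpa [this] using h3
  exact hx.eq_zero_of_inner_eq_zero fun k => (h2 k).trans h4

theorem eq_of_sub_act_eq {u v : V} (e : u - ρ.act c u = v - ρ.act c v) : u = v := by
  have : u - v ∈ fixedSpace (ρ.act c) := by
    rw [mem_fixedSpace, map_sub, ← sub_eq_zero]
    calc _ = (v - ρ.act c v) - (u - ρ.act c u) := by abel
      _ = 0 := by rw [e, sub_self]
  rwa [hx.fixedSpace_eq_bot, Submodule.mem_bot, sub_eq_zero] at this

section FiniteDimensional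
variable [FiniteDimensional ℝ V]

/-- A product of `d` reflections, where `d` is the codimension of the fixed space. -/
theorem exists_word (hT : ρ.ReflectionTransitive x) (g : V ≃ₗᵢ[ℝ] V)
    (hg : ∀ k, ∃ l, g (x k) = x l) {d : ℕ} (hd : finrank ℝ V ≤ finrank ℝ (fixedSpace g) + d) :
    ∃ l : List W, (∀ t ∈ l, cs.IsReflection t ∧ fixedSpace g ≤ fixedSpace (ρ.act t)) ∧
      ρ.act l.prod = g ∧ l.length ≤ d := by
  refine ρ.exists_word_of_isometry hx.span_eq ?_ ?_ d g ?_ hd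
  · rintro _ ⟨k, rfl⟩ _ ⟨l, rfl⟩ hne
    exact hT k l hne
  · rintro w _ ⟨k, rfl⟩
    obtain ⟨l, e⟩ := hx.exists_act w k
    exact ⟨l, e.symm⟩
  · rintro _ ⟨k, rfl⟩
    obtain ⟨l, e⟩ := hg k
    exact ⟨l, e.symm⟩

theorem finrank_eq_of_isReducedTWord (hT : ρ.ReflectionTransitive x) {l : List W} {w : W}
    (hl : IsReducedTWord cs l w) :
    finrank ℝ (fixedSpace (ρ.act w)) + l.length = finrank ℝ V := by
  obtain ⟨l', h1, h2, h3⟩ := hx.exists_word hT (ρ.act w) (hx.exists_act w)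
    (d := finrank ℝ V - finrank ℝ (fixedSpace (ρ.act w))) (by omega)
  have h4 := hl.2 l' ⟨fun t ht => (h1 t ht).1, ρ.act_injective h2⟩
  have h5 := ρ.finrank_le_finrank_fixedSpace_add hl.1
  have h6 := Submodule.finrank_le (fixedSpace (ρ.act w))
  omega

/-- The common fixed space of the letters lies in `Fix w` and has codimension at most the length,
which is exactly the codimension of `Fix w`. -/
theorem fixed_eq_of_isReducedTWord (hT : ρ.ReflectionTransitive x) {l : List W} {w : W}
    (hl : IsReducedTWord cs l w) :
    ρ.fixed (Subgroup.closure {t | t ∈ l}) = fixedSpace (ρ.act w) := by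
  have h1 := hx.finrank_eq_of_isReducedTWord hT hl
  have h2 := ρ.finrank_le_finrank_fixedWord_add hl.1.1
  have h3 := ρ.fixedWord_le (l := l)
  rw [hl.1.2] at h3
  exact Submodule.eq_of_le_of_finrank_le h3 (by rw [fixedWord] at h2; omega)

/-- The orbits of a noncrossing subgroup are noncrossing. -/
theorem noncrossingOrbits_of_isNoncrossing (hT : ρ.ReflectionTransitive x)
    (harc : ρ.ArcRigid x h) {W' : Subgroup W} (hW' : ρ.ReflectionClosed W')
    (hnc : IsNoncrossing cs c W') : ρ.NoncrossingOrbits W' x h := by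
  -- The remaining letters `l3` of a reduced word for `c` multiply to the complement `y`, with `c =
  -- w y` and additive lengths.
  obtain ⟨w, ⟨-, l1, l2, hl1, hl2, l3, hl3⟩, l, hl, hlW⟩ := hnc
  set y : W := l3.prod with hy
  have hc : c = w * y := by rw [hy, ← hl1.1.2, ← hl2.1.2, ← hl3, List.prod_append]
  have hU : ρ.fixed W' = fixedSpace (ρ.act w) := by rw [hlW, hx.fixed_eq_of_isReducedTWord hT hl]
  have hlen1 := hx.finrank_eq_of_isReducedTWord hT hl1
  have hlen2 := hx.finrank_eq_of_isReducedTWord hT hl2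
  rw [hx.fixedSpace_eq_bot, finrank_bot] at hlen2
  have hlen3 : finrank ℝ V ≤ finrank ℝ (fixedSpace (ρ.act y)) + l3.length :=
    ρ.finrank_le_finrank_fixedSpace_add ⟨fun t ht => hl2.1.1 t (by rw [← hl3]; simp [ht]), hy.symm⟩
  have hlen : l1.length + l3.length = l2.length := by rw [← hl3, List.length_append]
  have hsub : ∀ v ∈ fixedSpace (ρ.act y), v - ρ.act c v ∈ (ρ.fixed W')ᗮ := by
    intro v hv
    have hv : ρ.act y v = v := hv
    rw [Submodule.mem_orthogonal]
    intro u hu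
    rw [hU] at hu
    rw [hc, act_mul_apply, hv, inner_sub_right]
    nth_rewrite 2 [← mem_fixedSpace.1 hu]
    rw [inner_act_act, sub_self]
  -- the map `v ↦ v - c v` sends the fixed space of `y` onto the orthogonal complement
  have hsurj : ∀ v, v - ρ.act c v ∈ (ρ.fixed W')ᗮ → ρ.act y v = v := by
    intro v hv
    let f : V →ₗ[ℝ] V := LinearMap.id - (ρ.act c).toLinearEquiv.toLinearMap
    have hf : ∀ u, f u = u - ρ.act c u := fun u => rfl
    have hinj : Function.Injective f := fun u v e => hx.eq_of_sub_act_eq e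
    have hmap : (fixedSpace (ρ.act y)).map f = (ρ.fixed W')ᗮ := by
      refine Submodule.eq_of_le_of_finrank_le ?_ ?_
      · rintro _ ⟨u, hu, rfl⟩
        exact hsub u hu
      · rw [← (Submodule.equivMapOfInjective f hinj _).finrank_eq]
        have := (ρ.fixed W').finrank_add_finrank_orthogonal
        rw [hU] at this ⊢
        omega
    rw [← hf, ← hmap] at hv
    obtain ⟨u, hu, e⟩ := hv
    rw [← hinj e]
    exact hu
  have harc' : ∀ i j : ℤ, i < j → j < i + h → ρ.Linked W' x i j → ∀ m, i ≤ m → m < j →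
      ∃ m', i ≤ m' ∧ m' < j ∧ ρ.act y (x m) = x m' := by
    intro i j hij hij' hl
    refine harc i j hij hij' y (hsurj _ ?_)
    rw [hx.arcSum_sub_act hij.le]
    exact hl.sub_mem
  intro i k j l hik hkj hjl hli hlij hlkl
  -- `[k, j)` is the intersection of `[i, j)` and `[k, l)`, both preserved by `y`; the two image
  -- indices agree because they lie in one period.
  have hkj' : ρ.act y (arcSum x k j) = arcSum x k j := by
    refine hx.act_arcSum_of_mapsTo (by omega) fun m hm1 hm2 => ?_
    obtain ⟨m1, h1, h2, e1⟩ := harc' i j (by omega) (by omega) hlij m (by omega) (by omega)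
    obtain ⟨m2, h3, h4, e2⟩ := harc' k l (by omega) (by omega) hlkl m (by omega) (by omega)
    have := hx.eq_of_mem_window (i := i) (k := m1) (l := m2) (by omega) (by omega) (by omega)
      (by omega) (by rw [← e1, e2])
    exact ⟨m2, by omega, by omega, e2⟩
  have := hsub _ (mem_fixedSpace.2 hkj')
  rw [hx.arcSum_sub_act hkj.le] at this
  exact hlij.trans (linked_of_sub_mem hT hW' this).symm

end FiniteDimensional
end IsCyclicOrbit
end Realization
end CoxeterPlane

/-! ### From noncrossing partitions to elements below `c` -/

namespace CoxeterPlane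
open scoped InnerProductSpace
open Module (finrank)
namespace Realization

variable {B W V : Type*} [Group W] {M : CoxeterMatrix B} {cs : CoxeterSystem M W}
  [NormedAddCommGroup V] [InnerProductSpace ℝ V] {ρ : Realization cs V}

namespace IsCyclicOrbit

variable {c : W} {h : ℕ} {x : ℤ → V} (hx : ρ.IsCyclicOrbit c h x)
include hx
variable [FiniteDimensional ℝ V]

/-- For a subspace `U` there is an isometry with fixed space `U` which agrees with `c` on the
vectors `v` such that `v - c v` is orthogonal to `U`. -/
theorem exists_isometry (U : Submodule ℝ V) : ∃ g : V ≃ₗᵢ[ℝ] V, fixedSpace g = U ∧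
    (∀ v, v - ρ.act c v ∈ Uᗮ → g v = ρ.act c v) ∧
    ∃ D : Submodule ℝ V, finrank ℝ D + finrank ℝ U = finrank ℝ V ∧
      ∀ v ∈ D, v - ρ.act c v ∈ Uᗮ := by
  let f : V →ₗ[ℝ] V := LinearMap.id - (ρ.act c).toLinearEquiv.toLinearMap
  have hinj : Function.Injective f := fun u v e => hx.eq_of_sub_act_eq e
  let e := LinearEquiv.ofInjectiveEndo f hinj
  let D : Submodule ℝ V := Uᗮ.map (e.symm : V →ₗ[ℝ] V)
  have hD : ∀ v, v ∈ D ↔ v - ρ.act c v ∈ Uᗮ := by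
    intro v
    rw [show v - ρ.act c v = e v from rfl]
    constructor
    · rintro ⟨u, hu, rfl⟩
      simpa using hu
    · exact fun hv => ⟨e v, hv, by simp⟩
  have hfin : finrank ℝ D + finrank ℝ U = finrank ℝ V := by
    rw [show finrank ℝ D = finrank ℝ Uᗮ from LinearEquiv.finrank_map_eq e.symm _, add_comm]
    exact U.finrank_add_finrank_orthogonal
  -- If `v ∈ U` and `v - c v` is orthogonal to `U`, then `‖v - c v‖² = 2 ⟪v, v - c v⟫ = 0`, so `c`
  -- fixes `v`.
  have hdisj : Disjoint U D := by
    rw [Submodule.disjoint_def]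
    intro v hu hd
    have h1 : ⟪v, v - ρ.act c v⟫_ℝ = 0 := ((hD v).1 hd) v hu
    rw [inner_sub_right] at h1
    have h2 : ⟪v - ρ.act c v, v - ρ.act c v⟫_ℝ = 0 := by
      rw [inner_sub_left, inner_sub_right, inner_sub_right, inner_act_act,
        real_inner_comm v (ρ.act c v)]
      linarith
    have h3 : v ∈ fixedSpace (ρ.act c) := (sub_eq_zero.1 (inner_self_eq_zero.1 h2)).symm
    rwa [hx.fixedSpace_eq_bot, Submodule.mem_bot] at h3
  have hcompl : IsCompl U D := (Submodule.isCompl_iff_disjoint U D (by omega)).2 hdisj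
  let g0 : V →ₗ[ℝ] V := LinearMap.ofIsCompl hcompl U.subtype
    ((ρ.act c).toLinearEquiv.toLinearMap ∘ₗ D.subtype)
  have hg1 : ∀ u ∈ U, g0 u = u := fun u hu =>
    LinearMap.ofIsCompl_apply_left (h := hcompl) ⟨u, hu⟩
  have hg2 : ∀ v ∈ D, g0 v = ρ.act c v := fun v hv =>
    LinearMap.ofIsCompl_apply_right (h := hcompl) ⟨v, hv⟩
  have hdec : ∀ v, ∃ u ∈ U, ∃ d ∈ D, v = u + d := by
    intro v
    have : v ∈ U ⊔ D := hcompl.sup_eq_top ▸ Submodule.mem_top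
    obtain ⟨u, hu, d, hd, e⟩ := Submodule.mem_sup.1 this
    exact ⟨u, hu, d, hd, e.symm⟩
  -- `U` and `D` need not be orthogonal; the cross terms agree because `⟪u, d⟫ = ⟪u, c d⟫` for `u ∈
  -- U`, `d ∈ D`.
  have hnorm : ∀ v, ‖g0 v‖ = ‖v‖ := by
    intro v
    obtain ⟨u, hu, d, hd, rfl⟩ := hdec v
    rw [map_add, hg1 u hu, hg2 d hd]
    have h1 : ⟪u, d - ρ.act c d⟫_ℝ = 0 := ((hD d).1 hd) u hu
    rw [inner_sub_right] at h1
    have h2 := norm_add_sq_real u (ρ.act c d)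
    have h3 := norm_add_sq_real u d
    rw [(ρ.act c).norm_map] at h2
    rw [← sq_eq_sq₀ (norm_nonneg _) (norm_nonneg _)]
    linarith
  let g : V ≃ₗᵢ[ℝ] V := LinearIsometry.toLinearIsometryEquiv ⟨g0, hnorm⟩ rfl
  have hg : ∀ v, g v = g0 v := fun v => rfl
  refine ⟨g, le_antisymm ?_ ?_, fun v hv => hg2 v ((hD v).2 hv), D, hfin, fun v hv => (hD v).1 hv⟩
  · intro v hv
    have hv : g0 v = v := hv
    obtain ⟨u, hu, d, hd, rfl⟩ := hdec v
    rw [map_add, hg1 u hu, hg2 d hd] at hv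
    have h3 : d ∈ fixedSpace (ρ.act c) := add_left_cancel hv
    rw [hx.fixedSpace_eq_bot, Submodule.mem_bot] at h3
    rw [h3, add_zero]
    exact hu
  · exact fun u hu => hg1 u hu

/-- The noncrossing element attached to a noncrossing orbit partition: it sends each point to the
next point of its block. -/
theorem exists_element_of_noncrossingOrbits (hT : ρ.ReflectionTransitive x) {W' : Subgroup W}
    (hnc : ρ.NoncrossingOrbits W' x h) :
    ∃ w : W, fixedSpace (ρ.act w) = ρ.fixed W' ∧
      (∀ v, v - ρ.act c v ∈ (ρ.fixed W')ᗮ → ρ.act w v = ρ.act c v) ∧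
      (∀ m, ∃ j, m < j ∧ ρ.Linked W' x m j ∧ (∀ p, m < p → p < j → ¬ ρ.Linked W' x m p) ∧
        ρ.act w (x m) = x j) ∧
      ∀ l, IsReducedTWord cs l w → w ∈ absInterval cs c := by
  obtain ⟨g, hgU, hgD, D, hfin, hD⟩ := hx.exists_isometry (ρ.fixed W')
  have hpos := hx.pos
  have hnext : ∀ m, ∃ j, m < j ∧ ρ.Linked W' x m j ∧
      (∀ p, m < p → p < j → ¬ ρ.Linked W' x m p) ∧ g (x m) = x j := by
    intro m
    -- The search starts strictly after `m` and ends at `m + h` at the latest, where the point `x m`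
    -- itself recurs; a singleton block is thus its own successor.
    have hex : ∃ d : ℕ, ρ.Linked W' x m (m + 1 + d) :=
      ⟨h - 1, .of_eq (by rw [show m + 1 + ((h - 1 : ℕ) : ℤ) = m + h by omega, hx.apply_add])⟩
    classical
    set d := Nat.find hex with hd
    have hd1 : ρ.Linked W' x m (m + 1 + d) := Nat.find_spec hex
    have hd2 : d ≤ h - 1 := Nat.find_min' hex
      (.of_eq (by rw [show m + 1 + ((h - 1 : ℕ) : ℤ) = m + h by omega, hx.apply_add]))
    have hd3 : ∀ p, m < p → p < m + 1 + d → ¬ ρ.Linked W' x m p := by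
      intro p h1 h2 h3
      refine Nat.find_min hex (m := (p - m - 1).toNat) (by omega) ?_
      rwa [show m + 1 + ((p - m - 1).toNat : ℤ) = p by omega]
    refine ⟨m + 1 + d, by omega, hd1, hd3, ?_⟩
    set j := m + 1 + (d : ℤ) with hj
    have hsum := arcSum_add_arcSum x (by omega : m ≤ m + 1) (by omega : m + 1 ≤ j)
    rw [arcSum_succ] at hsum
    -- By noncrossingness the points strictly between `m` and its successor `j` are a union of
    -- blocks, so their sum is fixed by `W'`.
    have h1 : g (arcSum x (m + 1) j) = arcSum x (m + 1) j := by
      rw [← mem_fixedSpace, hgU]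
      intro w hw
      refine hx.act_arcSum_of_mapsTo (by omega) fun p hp1 hp2 => ?_
      obtain ⟨q0, e0⟩ := hx.exists_act w p
      obtain ⟨q, hq1, hq2, e⟩ := hx.exists_mem_window m q0
      have hpq : ρ.Linked W' x p q := ⟨w, hw, by rw [e0, e]⟩
      refine ⟨q, ?_, ?_, by rw [e0, e]⟩
      · rcases hq1.lt_or_eq with h | h
        · omega
        · rw [← h] at hpq
          exact absurd hpq.symm (hd3 p (by omega) hp2)
      · by_contra hqj
        rcases (not_lt.1 hqj).lt_or_eq with h | h
        · exact hd3 p (by omega) hp2 (hnc m p j q (by omega) hp2 h hq2 hd1 hpq)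
        · rw [← h] at hpq
          exact hd3 p (by omega) hp2 (hd1.trans hpq.symm)
    -- On the full arc `g` acts as `c`, since `x m - x j` is orthogonal to `Fix W'`. Cancelling the
    -- fixed inner arc leaves `g (x m) = x j`.
    have h2 : g (arcSum x m j) = arcSum x (m + 1) (j + 1) := by
      rw [hgD, hx.act_arcSum_self]
      rw [hx.arcSum_sub_act (by omega)]
      exact hd1.sub_mem
    have h3 := arcSum_add_arcSum x (by omega : m + 1 ≤ j) (by omega : j ≤ j + 1)
    rw [arcSum_succ] at h3
    rw [← hsum, map_add, h1, ← h3, add_comm] at h2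
    exact add_left_cancel h2
  obtain ⟨l0, -, hl0, -⟩ := hx.exists_word hT g
    (fun k => let ⟨j, _, _, _, e⟩ := hnext k; ⟨j, e⟩) (d := finrank ℝ V) (by omega)
  set w := l0.prod with hw
  rw [← hl0] at hgU hgD hnext
  refine ⟨w, hgU, hgD, hnext, fun l hl => ?_⟩
  have hlen := hx.finrank_eq_of_isReducedTWord hT hl
  have hy : D ≤ fixedSpace (ρ.act (w⁻¹ * c)) := by
    intro v hv
    rw [mem_fixedSpace, act_mul_apply, ← hgD v (hD v hv), act_inv_act]
  have hyfin := Submodule.finrank_mono hy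
  -- `w⁻¹ c` fixes `D`, of codimension `dim Fix W'`, so it needs at most that many letters. Appended
  -- to a reduced word of `w` they give a word for `c` of length at most `dim V`, which is minimal
  -- because `c` has no fixed vectors.
  obtain ⟨l3, hl3, hprod, hlen3⟩ := hx.exists_word hT (ρ.act (w⁻¹ * c)) (hx.exists_act _)
    (d := finrank ℝ (ρ.fixed W')) (by omega)
  have hprod : l3.prod = w⁻¹ * c := ρ.act_injective hprod
  rw [hgU] at hlen
  refine ⟨⟨[], l, ⟨⟨by simp, rfl⟩, by simp⟩, hl, List.nil_prefix⟩,
    ⟨l, l ++ l3, hl, ?_, List.prefix_append _ _⟩⟩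
  refine isReducedTWord_of_length (ρ := ρ) ⟨?_, ?_⟩ ?_
  · intro t ht
    rcases List.mem_append.1 ht with ht | ht
    · exact hl.1.1 t ht
    · exact (hl3 t ht).1
  · rw [List.prod_append, hl.1.2, hprod, mul_inv_cancel_left]
  · rw [hx.fixedSpace_eq_bot, finrank_bot, List.length_append]
    omega

end IsCyclicOrbit
end Realization
end CoxeterPlane

namespace CoxeterPlane
open scoped InnerProductSpace
open Module (finrank)
namespace Realization

variable {B W V : Type*} [Group W] {M : CoxeterMatrix B} {cs : CoxeterSystem M W}
  [NormedAddCommGroup V] [InnerProductSpace ℝ V] {ρ : Realization cs V}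

/-! ### Orbits on which a reflection moves few points -/

variable (ρ) in
/-- A reflection that sends `a` to `b ≠ a` fixes all points of `o` except possibly `±a`, `±b`. -/
def FewMoved (o : Set V) : Prop :=
  ∀ t, cs.IsReflection t → ∀ a ∈ o, ρ.act t a ≠ a → ∀ d ∈ o, d ≠ a → d ≠ -a → d ≠ ρ.act t a →
    d ≠ -ρ.act t a → ρ.act t d = d

theorem eq_of_isReflection_of_act_eq {t t' : W} (ht : cs.IsReflection t) (ht' : cs.IsReflection t')
    {a b : V} (hab : ρ.act t a = b) (hab' : ρ.act t' a = b) (hne : a ≠ b) : t = t' :=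
  ρ.eq_of_act_eq fun v => by
    rw [ρ.act_eq_of_isReflection ht hab hne, ρ.act_eq_of_isReflection ht' hab' hne]

/-- Induction on a word `r * y` for `γ`, given a reflection `t` taking `a` to `y a`. If `r` moves `y
a`, then in general it fixes `a`, and `r t r⁻¹` takes `a` to `r y a`; if `a = -(y a)`, the conjugate
`t r t⁻¹` works instead. Few moved points justify both; only the target `-a` escapes, and it is left
to the hypothesis `hneg`. -/
theorem exists_reflection_of_mem_closure {o : Set V} (hW : ∀ w, ∀ a ∈ o, ρ.act w a ∈ o)
    (ho : ρ.FewMoved o) {R : Set W} (hR : ∀ t ∈ R, cs.IsReflection t)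
    (hneg : ∀ a ∈ o, ∀ γ ∈ Subgroup.closure R, ρ.act γ a = -a →
      ∃ t ∈ Subgroup.closure R, cs.IsReflection t ∧ ρ.act t a = -a)
    {γ : W} (hγ : γ ∈ Subgroup.closure R) {a : V} (ha : a ∈ o) (hne : ρ.act γ a ≠ a) :
    ∃ t ∈ Subgroup.closure R, cs.IsReflection t ∧ ρ.act t a = ρ.act γ a := by
  have key : ∀ r ∈ R, ∀ y ∈ Subgroup.closure R,
      (ρ.act y a ≠ a → ∃ t ∈ Subgroup.closure R, cs.IsReflection t ∧ ρ.act t a = ρ.act y a) →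
      ρ.act (r * y) a ≠ a →
      ∃ t ∈ Subgroup.closure R, cs.IsReflection t ∧ ρ.act t a = ρ.act (r * y) a := by
    intro r hr g hg ih hne
    have hrR := Subgroup.subset_closure hr
    have hrr := hR r hr
    rw [act_mul_apply] at hne ⊢
    set y := ρ.act g a with hy
    have hyo : y ∈ o := hW g a ha
    by_cases h1 : ρ.act r y = y
    · rw [h1] at hne ⊢
      exact ih hne
    by_cases h2 : y = a
    · exact ⟨r, hrR, hrr, by rw [h2]⟩
    by_cases h3 : ρ.act r y = -a
    · rw [h3]
      exact hneg a ha (r * g) (mul_mem hrR hg) (by rw [act_mul_apply, ← h3])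
    obtain ⟨t, htR, ht, e⟩ := ih h2
    by_cases h4 : a = -y
    · refine ⟨t * r * t⁻¹, mul_mem (mul_mem htR hrR) (inv_mem htR), hrr.conj t, ?_⟩
      have e1 : ρ.act t⁻¹ a = y := by rw [ht.inv, e]
      rw [act_mul_apply, act_mul_apply, e1]
      refine ho t ht a ha (by rwa [e]) _ (hW r y hyo) hne h3 ?_ ?_
      · rwa [e]
      · rw [e, ← h4]; exact hne
    · refine ⟨r * t * r⁻¹, mul_mem (mul_mem hrR htR) (inv_mem hrR), ht.conj r, ?_⟩
      have e1 : ρ.act r⁻¹ a = a := by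
        rw [hrr.inv]
        refine ho r hrr y hyo h1 a ha (Ne.symm h2) h4 (Ne.symm hne) ?_
        intro h; exact h3 (by rw [h, neg_neg])
      rw [act_mul_apply, act_mul_apply, e1, e]
  induction hγ using Subgroup.closure_induction_left with
  | one => exact absurd (ρ.act_one_apply a) hne
  | mul_left r hr y hy ih => exact key r hr y hy ih hne
  | inv_mul_cancel r hr y hy ih =>
    rw [(hR r hr).inv] at hne ⊢
    exact key r hr y hy ih hne

theorem inner_sub_eq_zero {x : ℤ → V} (hT : ρ.ReflectionTransitive x)
    (ho : ρ.FewMoved (Set.range x)) {k l m : ℤ} (hkl : x k ≠ x l) (h1 : x m ≠ x k) (h2 : x m ≠ -x k)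
    (h3 : x m ≠ x l) (h4 : x m ≠ -x l) : ⟪x k - x l, x m⟫_ℝ = 0 := by
  obtain ⟨t, ht, e⟩ := hT k l hkl
  refine ρ.inner_eq_zero_of_act_eq_self (t := t) e ?_
  exact ho t ht (x k) ⟨k, rfl⟩ (by rw [e]; exact hkl.symm) _ ⟨m, rfl⟩ h1 h2 (by rwa [e])
    (by rwa [e])

namespace IsCyclicOrbit

variable {c : W} {h : ℕ} {x : ℤ → V} (hx : ρ.IsCyclicOrbit c h x)
include hx

theorem act_mem_range (w : W) : ∀ a ∈ Set.range x, ρ.act w a ∈ Set.range x := by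
  rintro _ ⟨k, rfl⟩
  obtain ⟨l, e⟩ := hx.exists_act w k
  exact ⟨l, e.symm⟩

theorem apply_shift {k l : ℤ} {r : ℝ} (e : x l = r • x k) (d : ℤ) : x (l + d) = r • x (k + d) := by
  induction d using Int.induction_on with
  | zero => simpa using e
  | succ d ih => rw [← add_assoc, ← add_assoc, ← hx.act_succ, ih, map_smul, hx.act_succ]
  | pred d ih =>
    apply (ρ.act c).injective
    rw [hx.act_succ, map_smul, hx.act_succ]
    convert! ih using 2 <;> ring_nf

/-- Antipodality of one pair spreads along the orbit by `c`. The index shift, reduced to `0 ≤ d <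
h`, is nonzero and its double is a multiple of `h`, hence equal to `h`. -/
theorem exists_antipode {k l : ℤ} (e : x l = -x k) (hne : x l ≠ x k) :
    ∃ d : ℤ, (h : ℤ) = 2 * d ∧ ∀ m, x (m + d) = -x m := by
  have hshift : ∀ m, x (m + (l - k)) = -x m := fun m => by
    have := hx.apply_shift (k := k) (l := l) (r := -1) (by rw [e, neg_one_smul]) (m - k)
    rw [neg_one_smul] at this
    convert! this using 2 <;> ring_nf
  obtain ⟨d, h1, h2, e'⟩ := hx.exists_mem_window 0 (l - k)
  have hshift' : ∀ m, x (m + d) = -x m := fun m => by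
    rw [← hshift m, hx.eq_iff]
    have := (hx.eq_iff _ _).1 e'
    convert! this using 1; ring
  have h3 : (h : ℤ) ∣ 2 * d := by
    have : x 0 = x (2 * d) := by
      rw [two_mul, hshift']
      conv_rhs => rw [← zero_add d, hshift', neg_neg]
    simpa using (hx.eq_iff _ _).1 this
  have h4 : d ≠ 0 := by
    rintro rfl
    apply hne
    have := hshift' k
    rw [add_zero] at this
    rw [e, ← this]
  obtain ⟨q, hq⟩ := h3
  have hq1 : q = 1 := by
    have : (0 : ℤ) < h := by exact_mod_cast hx.pos
    have hd : 0 < d := by omega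
    have q1 : 0 < q := by by_contra hh; nlinarith [not_lt.1 hh]
    have q2 : q < 2 := by by_contra hh; nlinarith [not_lt.1 hh]
    omega
  exact ⟨d, by rw [hq, hq1, mul_one], hshift'⟩

theorem arcSum_window (i : ℤ) : arcSum x i (i + h) = 0 := by
  refine ρ.eq_zero_of_fixed _ fun w => hx.act_arcSum_of_mapsTo le_rfl fun m _ _ => ?_
  obtain ⟨l, e⟩ := hx.exists_act w m
  obtain ⟨l', h1, h2, e'⟩ := hx.exists_mem_window i l
  exact ⟨l', h1, h2, by rw [e, e']⟩

theorem ne_zero (hh : 2 ≤ h) (k : ℤ) : x k ≠ 0 := by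
  intro e
  have h1 := hx.apply_shift (r := 0) (l := k) (k := k) (by rw [e, smul_zero]) 1
  rw [zero_smul, ← e] at h1
  have := (hx.eq_iff _ _).1 h1.symm
  rw [add_sub_cancel_left] at this
  have := Int.le_of_dvd one_pos this
  omega

theorem inner_self_eq (k l : ℤ) : ⟪x k, x k⟫_ℝ = ⟪x l, x l⟫_ℝ := by
  have : ∀ k, ⟪x k, x k⟫_ℝ = ⟪x 0, x 0⟫_ℝ := by
    intro k
    induction k using Int.induction_on with
    | zero => rfl
    | succ k ih => rw [← ih, ← hx.act_succ, inner_act_act]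
    | pred k ih => rw [← ih, ← ρ.inner_act_act c (x (_ - 1)), hx.act_succ, sub_add_cancel]
  rw [this k, this l]

/-- All points have the same norm, so this inner product is half of `‖x k - x l‖²`. -/
theorem inner_sub_pos {k l : ℤ} (hne : x k ≠ x l) : 0 < ⟪x k - x l, x k⟫_ℝ := by
  have h1 : 0 < ⟪x k - x l, x k - x l⟫_ℝ :=
    real_inner_self_pos.2 (sub_ne_zero.2 hne)
  have h2 := hx.inner_self_eq k l
  rw [inner_sub_left, inner_sub_right, inner_sub_right, real_inner_comm (x k) (x l)] at h1
  rw [inner_sub_left, real_inner_comm (x k) (x l)]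
  linarith

/-- Suppose `w` took `x m` to `x q` outside the arc. Then the arc sum, being fixed by `w`, would be
orthogonal to `x m - x q`. But only `±x m` and `±x q` have nonzero inner product with that vector;
`x m` and `-x q` contribute positively, `x q` is not on the arc, and neither is `-x m` because the
arc is at most half a period. -/
theorem mapsTo_arc_of_le (hh : 2 ≤ h) (hT : ρ.ReflectionTransitive x)
    (ho : ρ.FewMoved (Set.range x)) {i j : ℤ} (hij : 2 * (j - i) ≤ h) {w : W}
    (hw : ρ.act w (arcSum x i j) = arcSum x i j) (m : ℤ) (h1 : i ≤ m) (h2 : m < j) :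
    ∃ m', i ≤ m' ∧ m' < j ∧ ρ.act w (x m) = x m' := by
  obtain ⟨q0, e0⟩ := hx.exists_act w m
  obtain ⟨q, hq1, hq2, e⟩ := hx.exists_mem_window i q0
  rw [← e] at e0
  refine ⟨q, hq1, ?_, e0⟩
  by_contra hqj
  have hmq : x m ≠ x q := fun e =>
    absurd (hx.eq_of_mem_window (i := i) h1 (by omega) hq1 hq2 e) (by omega)
  have hs : ⟪x m - x q, arcSum x i j⟫_ℝ = 0 := by
    rw [inner_sub_left, ← e0]
    nth_rewrite 2 [← hw]
    rw [inner_act_act, sub_self]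
  have hpos : 0 < ⟪x m - x q, arcSum x i j⟫_ℝ := by
    rw [arcSum, inner_sum]
    refine Finset.sum_pos' (fun p hp => ?_) ⟨m, Finset.mem_Ico.2 ⟨h1, h2⟩, hx.inner_sub_pos hmq⟩
    rw [Finset.mem_Ico] at hp
    by_cases a1 : x p = x m
    · rw [a1]; exact (hx.inner_sub_pos hmq).le
    by_cases a2 : x p = -x m
    · exfalso
      obtain ⟨d, hd, hanti⟩ := hx.exists_antipode a2 a1
      rcases lt_trichotomy p m with hpm | hpm | hpm
      · have := hx.eq_of_mem_window (i := p) (k := m) (l := p + d) (by omega) (by omega) (by omega)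
          (by omega) (by rw [hanti, a2, neg_neg])
        omega
      · exact a1 (by rw [hpm])
      · have := hx.eq_of_mem_window (i := m) (k := p) (l := m + d) (by omega) (by omega) (by omega)
          (by omega) (by rw [hanti, a2])
        omega
    by_cases a3 : x p = x q
    · exact absurd (hx.eq_of_mem_window (i := i) (k := p) (l := q) hp.1 (by omega) hq1 hq2 a3)
        (by omega)
    by_cases a4 : x p = -x q
    · have := hx.inner_sub_pos hmq.symm
      rw [a4, ← neg_sub, inner_neg_neg]
      exact this.le
    · rw [inner_sub_eq_zero hT ho hmq a1 a2 a3 a4]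
  exact hpos.ne' hs

/-- A long arc is handled through its complement: the two sums are opposite, so `w⁻¹` preserves the
complementary arc and `w` cannot move a point into it. -/
theorem arcRigid_of_fewMoved (hh : 2 ≤ h) (hT : ρ.ReflectionTransitive x)
    (ho : ρ.FewMoved (Set.range x)) : ρ.ArcRigid x h := by
  intro i j hij hij' w hw m h1 h2
  by_cases hle : 2 * (j - i) ≤ h
  · exact hx.mapsTo_arc_of_le hh hT ho hle hw m h1 h2
  have hsum := arcSum_add_arcSum x hij.le hij'.le
  rw [hx.arcSum_window] at hsum
  have hw' : ρ.act w⁻¹ (arcSum x j (i + h)) = arcSum x j (i + h) := by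
    rw [eq_neg_of_add_eq_zero_right hsum, map_neg, ρ.act_inv_eq hw]
  obtain ⟨q0, e0⟩ := hx.exists_act w m
  obtain ⟨q, hq1, hq2, e⟩ := hx.exists_mem_window i q0
  rw [← e] at e0
  refine ⟨q, hq1, ?_, e0⟩
  by_contra hqj
  obtain ⟨p, hp1, hp2, ep⟩ := hx.mapsTo_arc_of_le hh hT ho (by omega) hw' q (not_lt.1 hqj) hq2
  rw [← e0, act_inv_act] at ep
  have := hx.eq_of_mem_window (i := i) h1 (by omega) (by omega) hp2 ep
  omega

end IsCyclicOrbit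
end Realization
end CoxeterPlane

namespace CoxeterPlane
open scoped InnerProductSpace
open Module (finrank)
namespace Realization

variable {B W V : Type*} [Group W] {M : CoxeterMatrix B} {cs : CoxeterSystem M W}
  [NormedAddCommGroup V] [InnerProductSpace ℝ V] {ρ : Realization cs V}

/-! ### Noncrossing orbit partitions come from noncrossing subgroups -/

variable (cs) in
theorem isReducedTWord_nil : IsReducedTWord cs ([] : List W) 1 := ⟨⟨by simp, rfl⟩, by simp⟩

variable (cs) in
theorem absLE_one {l : List W} {w : W} (hl : IsReducedTWord cs l w) : AbsLE cs 1 w :=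
  ⟨[], l, isReducedTWord_nil cs, hl, List.nil_prefix⟩

namespace IsCyclicOrbit

variable {c : W} {h : ℕ} {x : ℤ → V} (hx : ρ.IsCyclicOrbit c h x)
include hx

/-- An element sending each point to its successor runs through every block, so its powers are
transitive on blocks. -/
theorem exists_pow_act_eq {W' : Subgroup W} {w : W}
    (hw : ∀ m, ∃ j, m < j ∧ ρ.Linked W' x m j ∧ (∀ p, m < p → p < j → ¬ ρ.Linked W' x m p) ∧
        ρ.act w (x m) = x j) {i j : ℤ} (hij : ρ.Linked W' x i j) :
    ∃ n : ℕ, ρ.act (w ^ n) (x i) = x j := by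
  have key : ∀ d : ℕ, ∀ i : ℤ, ρ.Linked W' x i (i + d) →
      ∃ n : ℕ, ρ.act (w ^ n) (x i) = x (i + d) := by
    intro d
    induction d using Nat.strong_induction_on with
    | _ d ih =>
      intro i hl
      rcases Nat.eq_zero_or_pos d with rfl | hd
      · exact ⟨0, by rw [pow_zero, act_one_apply]; simp⟩
      obtain ⟨k, hk1, hk2, hk3, hk4⟩ := hw i
      have hk : k ≤ i + d := by
        by_contra hlt
        exact hk3 (i + d) (by omega) (by omega) hl
      have e : i + (d : ℤ) = k + ((i + d - k).toNat : ℤ) := by omega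
      have hl' := hk2.symm.trans hl
      rw [e] at hl' ⊢
      obtain ⟨n, hn⟩ := ih (i + d - k).toNat (by omega) k hl'
      exact ⟨n + 1, by rw [pow_succ, act_mul_apply, hk4, hn]⟩
  obtain ⟨j', h1, -, e⟩ := hx.exists_mem_window i j
  have e' : j' = i + ((j' - i).toNat : ℤ) := by omega
  have hl : ρ.Linked W' x i j' := hij.trans (.of_eq e.symm)
  rw [e'] at hl
  obtain ⟨n, hn⟩ := key _ _ hl
  exact ⟨n, by rw [hn, ← e', e]⟩

theorem exists_act_ne {t : W} (ht : cs.IsReflection t) : ∃ k, ρ.act t (x k) ≠ x k := by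
  by_contra hcon
  push Not at hcon
  obtain ⟨b, hb, hv⟩ := ρ.exists_unit_of_isReflection ht
  have hb0 : b = 0 := by
    refine hx.eq_zero_of_inner_eq_zero fun k => ?_
    have h1 := hcon k
    rw [hv, sub_eq_self, smul_eq_zero] at h1
    rcases h1 with h1 | h1
    · linarith
    · rw [h1, inner_zero_left]
  rw [hb0, inner_zero_left] at hb
  exact zero_ne_one hb

/-- Two distinct diameters of a polygon cross, so in a noncrossing partition only one block can
contain antipodal pairs. -/
theorem linked_of_antipodes {W' : Subgroup W} (hnc : ρ.NoncrossingOrbits W' x h)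
    {m d : ℤ} (hd : (h : ℤ) = 2 * d) (hanti : ∀ m, x (m + d) = -x m)
    (hm : ρ.Linked W' x m (m + d)) {k : ℤ} (hk : ρ.Linked W' x k (k + d)) :
    ρ.Linked W' x m k := by
  obtain ⟨q, hq1, hq2, e⟩ := hx.exists_mem_window m k
  have hq : ρ.Linked W' x q (q + d) := by
    refine (Linked.of_eq e).trans (hk.trans (.of_eq ?_))
    rw [hanti, hanti, e]
  suffices ρ.Linked W' x m q from this.trans (.of_eq e)
  rcases hq1.lt_or_eq with h1 | rfl
  · rcases lt_trichotomy q (m + d) with h2 | rfl | h2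
    · exact hnc m q (m + d) (q + d) h1 h2 (by omega) (by omega) hm hq
    · exact hm
    · have e2 : x (q - d) = -x q := by
        have := hanti (q - d)
        rw [sub_add_cancel] at this
        rw [this, neg_neg]
      have hq' : ρ.Linked W' x (q - d) q := by
        refine (Linked.of_eq ?_).trans hq.symm
        rw [e2, hanti]
      exact (hnc m (q - d) (m + d) q (by omega) (by omega) (by omega) (by omega) hm hq').trans hq'
  · exact .refl _ _ _

variable [FiniteDimensional ℝ V]

/-- The reduced words of the element attached to a noncrossing partition; one may prescribe the
first letter. -/
theorem exists_reduced_word (hT : ρ.ReflectionTransitive x) {W' : Subgroup W}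
    (hW' : ρ.ReflectionClosed W') {w : W} (hfix : fixedSpace (ρ.act w) = ρ.fixed W')
    (hwc : ∀ v, v - ρ.act c v ∈ (ρ.fixed W')ᗮ → ρ.act w v = ρ.act c v) :
    (∃ l, IsReducedTWord cs l w ∧ ∀ t ∈ l, t ∈ W') ∧
      ∀ i j, ρ.Linked W' x i j → x i ≠ x j →
        ∃ l t, IsReducedTWord cs l w ∧ (∀ s ∈ l, s ∈ W') ∧ t ∈ l ∧ ρ.act t (x i) = x j := by
  refine ⟨?_, fun i j hij hne => ?_⟩
  · obtain ⟨l, hl, hprod, hlen⟩ := hx.exists_word hT (ρ.act w) (hx.exists_act w)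
      (d := finrank ℝ V - finrank ℝ (fixedSpace (ρ.act w))) (by omega)
    have hle := Submodule.finrank_le (fixedSpace (ρ.act w))
    refine ⟨l, isReducedTWord_of_length (ρ := ρ)
      ⟨fun t ht => (hl t ht).1, ρ.act_injective hprod⟩ (by omega), fun t ht => ?_⟩
    exact hW' t (hl t ht).1 fun v hv => (hl t ht).2 (hfix ▸ hv)
  · obtain ⟨t, ht, e⟩ := hT i j hne
    have htU : ∀ v ∈ ρ.fixed W', ρ.act t v = v := fun v hv =>
      ρ.act_eq_self_of_inner_eq_zero ht e hne
        (Submodule.inner_left_of_mem_orthogonal hv hij.sub_mem)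
    have hle : fixedSpace (ρ.act w) ≤ fixedSpace (ρ.act (t * w)) := by
      intro v hv
      have hv' : v ∈ ρ.fixed W' := hfix ▸ hv
      rw [mem_fixedSpace, act_mul_apply, mem_fixedSpace.1 hv, htU v hv']
    obtain ⟨j', hj1, -, ej⟩ := hx.exists_mem_window i j
    set v := arcSum x i j' with hv
    have hvc : v - ρ.act c v = x i - x j := by rw [hv, hx.arcSum_sub_act hj1, ej]
    have hwv : ρ.act w v = ρ.act c v := hwc v (hvc ▸ hij.sub_mem)
    -- With `b = x i - x j` one has `c v = v - b` and `‖c v‖ = ‖v‖`, so `2 ⟪b, v⟫ = ⟪b, b⟫` and the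
    -- reflection along `b` brings `c v` back to `v`. Thus `t w` fixes `v` while `w` does not, and
    -- `t` can be split off.
    have htv : ρ.act t (ρ.act c v) = v := by
      have h1 := ρ.inner_act_act c v v
      have h2 : ρ.act c v = v - (x i - x j) := by rw [← hvc]; abel
      have hb : ⟪x i - x j, x i - x j⟫_ℝ ≠ 0 := inner_self_ne_zero.2 (sub_ne_zero.2 hne)
      have h3 : 2 * ⟪x i - x j, v⟫_ℝ = ⟪x i - x j, x i - x j⟫_ℝ := by
        rw [h2] at h1
        generalize x i - x j = b at *
        rw [inner_sub_left, inner_sub_right, inner_sub_right, real_inner_comm v b] at h1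
        rw [real_inner_comm] at h1 ⊢
        linarith
      rw [ρ.act_eq_of_isReflection ht e hne, h2]
      have : 2 * ⟪x i - x j, v - (x i - x j)⟫_ℝ / ⟪x i - x j, x i - x j⟫_ℝ = -1 := by
        rw [div_eq_iff hb, inner_sub_right]
        linarith
      rw [this, neg_one_smul]
      abel
    have hlt : fixedSpace (ρ.act w) < fixedSpace (ρ.act (t * w)) := by
      refine lt_of_le_of_ne hle fun h => ?_
      have : v ∈ fixedSpace (ρ.act (t * w)) := by
        rw [mem_fixedSpace, act_mul_apply, hwv, htv]
      rw [← h, mem_fixedSpace, hwv] at this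
      rw [this, sub_self] at hvc
      exact hne (sub_eq_zero.1 hvc.symm)
    have hfl := Submodule.finrank_lt_finrank_of_lt hlt
    have hle' := Submodule.finrank_le (fixedSpace (ρ.act (t * w)))
    obtain ⟨l, hl, hprod, hlen⟩ := hx.exists_word hT (ρ.act (t * w)) (hx.exists_act _)
      (d := finrank ℝ V - finrank ℝ (fixedSpace (ρ.act (t * w)))) (by omega)
    refine ⟨t :: l, t, isReducedTWord_of_length (ρ := ρ) ⟨?_, ?_⟩ ?_, ?_, List.mem_cons_self, e⟩
    · intro s hs
      rcases List.mem_cons.1 hs with rfl | hs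
      · exact ht
      · exact (hl s hs).1
    · rw [List.prod_cons, ρ.act_injective hprod, ← mul_assoc, ht.mul_self, one_mul]
    · rw [List.length_cons]; omega
    · intro s hs
      rcases List.mem_cons.1 hs with rfl | hs
      · exact hW' _ ht htU
      · exact hW' s (hl s hs).1 fun v hv => (hl s hs).2 (hle (hfix ▸ hv))

/-- The point is that the letters of a reduced word of `w` generate `W'`. A reflection of `W'` moves
some point inside its block; a power of `w` has the same effect on this point, hence so does some
reflection generated by the letters, and a reflection is determined by a moved point and its image.
-/
theorem isNoncrossing_of_fewMoved (hh : 2 ≤ h) (hT : ρ.ReflectionTransitive x)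
    (ho : ρ.FewMoved (Set.range x)) {W' : Subgroup W} (hW' : ρ.ReflectionClosed W')
    (hgen : W' ≤ Subgroup.closure {t | cs.IsReflection t ∧ t ∈ W'})
    (hnc : ρ.NoncrossingOrbits W' x h) : IsNoncrossing cs c W' := by
  obtain ⟨w, hfix, hwc, hnext, hint⟩ := hx.exists_element_of_noncrossingOrbits hT hnc
  obtain ⟨hword, hword'⟩ := hx.exists_reduced_word hT hW' hfix hwc
  have hneg_ne : ∀ k l, x l = -x k → x k ≠ x l := by
    intro k l e e'
    rw [← e'] at e
    have h2 : (2 : ℝ) • x k = 0 := by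
      rw [two_smul]; nth_rewrite 2 [e]; exact add_neg_cancel _
    exact hx.ne_zero hh k ((smul_eq_zero.1 h2).resolve_left two_ne_zero)
  obtain ⟨l, hl, hlW, hneg⟩ : ∃ l, IsReducedTWord cs l w ∧ (∀ t ∈ l, t ∈ W') ∧
      ∀ a ∈ Set.range x, ∀ γ ∈ W', ρ.act γ a = -a →
        ∃ t ∈ Subgroup.closure {t | t ∈ l}, cs.IsReflection t ∧ ρ.act t a = -a := by
    -- When some block contains an antipodal pair, the word is chosen to contain a reflection
    -- negating `x m`. Conjugating by powers of `w` serves the other antipodal pairs, which lie in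
    -- the same block.
    by_cases hex : ∃ m m', ρ.Linked W' x m m' ∧ x m' = -x m
    · obtain ⟨m, m', hm, e⟩ := hex
      obtain ⟨d, hd, hanti⟩ := hx.exists_antipode e (hneg_ne _ _ e).symm
      obtain ⟨l, t, hl, hlW, htl, et⟩ := hword' m m' hm (hneg_ne _ _ e)
      refine ⟨l, hl, hlW, ?_⟩
      rintro _ ⟨k, rfl⟩ γ hγ eγ
      have hlink : ρ.Linked W' x m k :=
        hx.linked_of_antipodes hnc hd hanti (hm.trans (.of_eq (by rw [e, hanti])))
          ⟨γ, hγ, by rw [eγ, hanti]⟩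
      obtain ⟨n, hn⟩ := hx.exists_pow_act_eq hnext hlink
      have hwl : w ^ n ∈ Subgroup.closure {t | t ∈ l} := by
        refine pow_mem ?_ n
        rw [← hl.1.2]
        exact list_prod_mem fun s hs => Subgroup.subset_closure hs
      refine ⟨w ^ n * t * (w ^ n)⁻¹,
        mul_mem (mul_mem hwl (Subgroup.subset_closure htl)) (inv_mem hwl),
        (hl.1.1 t htl).conj _, ?_⟩
      rw [act_mul_apply, act_mul_apply, ρ.act_inv_eq hn, et, e, map_neg, hn]
    · obtain ⟨l, hl, hlW⟩ := hword
      refine ⟨l, hl, hlW, ?_⟩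
      rintro _ ⟨k, rfl⟩ γ hγ eγ
      obtain ⟨k', e⟩ := hx.exists_act γ k
      exact absurd ⟨k, k', ⟨γ, hγ, e⟩, by rw [← e, eγ]⟩ hex
  refine ⟨w, hint l hl, l, hl, le_antisymm (hgen.trans ?_) ?_⟩
  · rw [Subgroup.closure_le]
    rintro t ⟨ht, htW⟩
    obtain ⟨k, hk⟩ := hx.exists_act_ne ht
    obtain ⟨k', e⟩ := hx.exists_act t k
    obtain ⟨n, hn⟩ := hx.exists_pow_act_eq hnext ⟨t, htW, e⟩
    have hle : Subgroup.closure {t | t ∈ l} ≤ W' := (Subgroup.closure_le _).2 hlW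
    have hwl : w ^ n ∈ Subgroup.closure {t | t ∈ l} := by
      refine pow_mem ?_ n
      rw [← hl.1.2]
      exact list_prod_mem fun s hs => Subgroup.subset_closure hs
    obtain ⟨t', ht'l, ht', e'⟩ := exists_reflection_of_mem_closure hx.act_mem_range ho hl.1.1
      (fun a ha γ hγ => hneg a ha γ (hle hγ)) hwl ⟨k, rfl⟩ (by rw [hn, ← e]; exact hk)
    rw [hn] at e'
    rw [e] at hk
    rw [eq_of_isReflection_of_act_eq ht ht' e e' hk.symm]
    exact ht'l
  · exact (Subgroup.closure_le _).2 hlW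

/-- Here the fixed space of `W'` decides. If it is zero, closedness makes `W'` everything and the
given word for `c` generates. Otherwise all roots of reflections in `W'` lie in a space of dimension
at most one, so there is at most one reflection and it must be the letter of the word. -/
theorem isNoncrossing_of_finrank_eq_two (hn : finrank ℝ V = 2) (hT : ρ.ReflectionTransitive x)
    {W' : Subgroup W} (hW' : ρ.ReflectionClosed W')
    (hgen : W' ≤ Subgroup.closure {t | cs.IsReflection t ∧ t ∈ W'})
    (hc : ∃ l, IsTWord cs l c ∧ l.length = finrank ℝ V ∧ Subgroup.closure {t | t ∈ l} = ⊤)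
    (hnc : ρ.NoncrossingOrbits W' x h) : IsNoncrossing cs c W' := by
  obtain ⟨w, hfix, hwc, hnext, hint⟩ := hx.exists_element_of_noncrossingOrbits hT hnc
  obtain ⟨⟨l, hl, hlW⟩, -⟩ := hx.exists_reduced_word hT hW' hfix hwc
  have hlen := hx.finrank_eq_of_isReducedTWord hT hl
  rw [hfix] at hlen
  by_cases h0 : ρ.fixed W' = ⊥
  · obtain ⟨l, hl, hlen, hcl⟩ := hc
    have hred : IsReducedTWord cs l c := by
      refine isReducedTWord_of_length (ρ := ρ) hl ?_
      rw [hx.fixedSpace_eq_bot, finrank_bot]; omega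
    refine ⟨c, ⟨absLE_one cs hred, l, l, hred, hred, List.prefix_rfl⟩, l, hred, ?_⟩
    rw [hcl, eq_top_iff, ← cs.subgroup_closure_range_simple, Subgroup.closure_le]
    rintro _ ⟨i, rfl⟩
    refine hW' _ (cs.isReflection_simple i) fun v hv => ?_
    rw [h0, Submodule.mem_bot] at hv
    rw [hv, map_zero]
  refine ⟨w, hint l hl, l, hl, le_antisymm (hgen.trans ?_) ((Subgroup.closure_le _).2 hlW)⟩
  rw [Subgroup.closure_le]
  rintro t ⟨ht, htW⟩
  have hperp : ∀ s, cs.IsReflection s → s ∈ W' → ∃ b ∈ (ρ.fixed W')ᗮ, ⟪b, b⟫_ℝ = 1 ∧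
      ∀ v, ρ.act s v = v - (2 * ⟪b, v⟫_ℝ) • b := by
    intro s hs hsW
    obtain ⟨b, hb, hv⟩ := ρ.exists_unit_of_isReflection hs
    refine ⟨b, ?_, hb, hv⟩
    rw [Submodule.mem_orthogonal']
    intro u hu
    have := hu s hsW
    rw [hv, sub_eq_self, smul_eq_zero] at this
    rcases this with h1 | h1
    · linarith
    · rw [h1, inner_self_eq_norm_sq_to_K] at hb; simp at hb
  obtain ⟨b, hbU, hb, hv⟩ := hperp t ht htW
  have hdim := (ρ.fixed W').finrank_add_finrank_orthogonal
  have hpos : 0 < finrank ℝ (ρ.fixed W') := by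
    rw [Nat.pos_iff_ne_zero]
    exact fun h => h0 (Submodule.finrank_eq_zero.1 h)
  have hb0 : b ≠ 0 := by rintro rfl; simp at hb
  have hpos' : 0 < finrank ℝ (ρ.fixed W')ᗮ := by
    rw [Nat.pos_iff_ne_zero]
    intro h
    rw [Submodule.finrank_eq_zero.1 h, Submodule.mem_bot] at hbU
    exact hb0 hbU
  have hone : finrank ℝ (ρ.fixed W')ᗮ = 1 := by omega
  obtain ⟨s, hs⟩ : ∃ s, s ∈ l := by
    rcases l with _ | ⟨s, l⟩
    · simp at hlen; omega
    · exact ⟨s, List.mem_cons_self⟩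
  obtain ⟨b', hb'U, hb', hv'⟩ := hperp s (hl.1.1 s hs) (hlW s hs)
  obtain ⟨r, hr⟩ := (finrank_eq_one_iff_of_nonzero' (⟨b, hbU⟩ : (ρ.fixed W')ᗮ)
    (by simpa using hb0)).1 hone ⟨b', hb'U⟩
  have hr : r • b = b' := congrArg Subtype.val hr
  have hr2 : r * r = 1 := by
    rw [← hr, inner_smul_left, inner_smul_right, hb] at hb'
    simpa using hb'
  have : t = s := by
    refine ρ.eq_of_act_eq fun v => ?_
    rw [hv, hv', ← hr, inner_smul_left, smul_smul]
    congr 2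
    simp only [RCLike.conj_to_real]
    linear_combination (-2 * ⟪b, v⟫_ℝ) * hr2
  rw [this]
  exact Subgroup.subset_closure hs

end IsCyclicOrbit
end Realization
end CoxeterPlane

namespace CoxeterPlane
open scoped InnerProductSpace

/-! ### Convex hulls of sets of vertices of a regular polygon -/

section Polygon

/-- Twice the signed area of a triangle inscribed in the unit circle, in a form that shows its sign.
-/
theorem inscribed_triangle_area (a b c : ℝ) :
    (Real.cos b - Real.cos a) * (Real.sin c - Real.sin a) -
      (Real.cos c - Real.cos a) * (Real.sin b - Real.sin a) =
    4 * Real.sin ((b - a) / 2) * Real.sin ((c - a) / 2) * Real.sin ((c - b) / 2) := by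
  have h : Real.sin ((c - b) / 2) = Real.sin ((c + a) / 2) * Real.cos ((b + a) / 2) -
      Real.cos ((c + a) / 2) * Real.sin ((b + a) / 2) := by
    rw [← Real.sin_sub]; congr 1; ring
  rw [Real.cos_sub_cos, Real.cos_sub_cos, Real.sin_sub_sin, Real.sin_sub_sin, h]
  ring

theorem inscribed_triangle_area_pos {a b c : ℝ} (hab : a < b) (hbc : b < c)
    (hca : c < a + 2 * Real.pi) :
    0 < (Real.cos b - Real.cos a) * (Real.sin c - Real.sin a) -
      (Real.cos c - Real.cos a) * (Real.sin b - Real.sin a) := by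
  rw [inscribed_triangle_area]
  have h1 := Real.sin_pos_of_pos_of_lt_pi (x := (b - a) / 2) (by linarith) (by linarith)
  have h2 := Real.sin_pos_of_pos_of_lt_pi (x := (c - a) / 2) (by linarith) (by linarith)
  have h3 := Real.sin_pos_of_pos_of_lt_pi (x := (c - b) / 2) (by linarith) (by linarith)
  positivity

theorem exp_angle (h : ℕ) (k : ℤ) :
    Complex.exp (2 * Real.pi * Complex.I * k / h) =
      ⟨Real.cos (2 * Real.pi * k / h), Real.sin (2 * Real.pi * k / h)⟩ := by
  have : 2 * (Real.pi : ℂ) * Complex.I * k / h = ((2 * Real.pi * k / h : ℝ) : ℂ) * Complex.I := by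
    push_cast; ring
  rw [this]
  exact Complex.ext (Complex.exp_ofReal_mul_I_re _) (Complex.exp_ofReal_mul_I_im _)

variable {E : Type*} [AddCommGroup E] [Module ℝ E] {φ : E →ₗ[ℝ] ℂ}
  {r : ℝ} {h : ℕ} {p : ℤ → E}

/-- Each diagonal of a convex quadrilateral is divided in the ratio of the areas of the triangles
cut off by the other one. Here `w1`, `w2`, `w3`, `w4` are twice the areas of `kjl`, `ijl`, `ikl`,
`ikj`, and `w1 + w3 = w2 + w4` counts the quadrilateral in two ways. -/
theorem segments_intersect (hφ : Function.Injective φ)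
    (hp : ∀ k : ℤ, φ (p k) = r * Complex.exp (2 * Real.pi * Complex.I * k / h))
    (hh : 0 < h) {i k j l : ℤ} (hik : i < k) (hkj : k < j) (hjl : j < l) (hli : l < i + h) :
    ∃ v, v ∈ segment ℝ (p i) (p j) ∧ v ∈ segment ℝ (p k) (p l) := by
  have hh' : (0 : ℝ) < h := by exact_mod_cast hh
  set θ : ℤ → ℝ := fun m => 2 * Real.pi * m / h with hθ
  have hlt : ∀ {a b : ℤ}, a < b → θ a < θ b := by
    intro a b hab
    have : (a : ℝ) < b := by exact_mod_cast hab
    have := Real.pi_pos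
    simp only [hθ]
    gcongr
  have hper : ∀ a : ℤ, θ (a + h) = θ a + 2 * Real.pi := by
    intro a; simp only [hθ]; push_cast; field_simp
  have hlt' : θ l < θ i + 2 * Real.pi := by rw [← hper]; exact hlt hli
  have d1 := inscribed_triangle_area_pos (hlt hkj) (hlt hjl) (by linarith [hlt hik])
  have d2 := inscribed_triangle_area_pos (hlt (hik.trans hkj)) (hlt hjl) hlt'
  have d3 := inscribed_triangle_area_pos (hlt hik) (hlt (hkj.trans hjl)) hlt'
  have d4 := inscribed_triangle_area_pos (hlt hik) (hlt hkj) (by linarith [hlt hjl])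
  set w1 := (Real.cos (θ j) - Real.cos (θ k)) * (Real.sin (θ l) - Real.sin (θ k)) -
      (Real.cos (θ l) - Real.cos (θ k)) * (Real.sin (θ j) - Real.sin (θ k)) with hw1
  set w2 := (Real.cos (θ j) - Real.cos (θ i)) * (Real.sin (θ l) - Real.sin (θ i)) -
      (Real.cos (θ l) - Real.cos (θ i)) * (Real.sin (θ j) - Real.sin (θ i)) with hw2
  set w3 := (Real.cos (θ k) - Real.cos (θ i)) * (Real.sin (θ l) - Real.sin (θ i)) -
      (Real.cos (θ l) - Real.cos (θ i)) * (Real.sin (θ k) - Real.sin (θ i)) with hw3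
  set w4 := (Real.cos (θ k) - Real.cos (θ i)) * (Real.sin (θ j) - Real.sin (θ i)) -
      (Real.cos (θ j) - Real.cos (θ i)) * (Real.sin (θ k) - Real.sin (θ i)) with hw4
  have hsum : w1 + w3 = w2 + w4 := by rw [hw1, hw2, hw3, hw4]; ring
  have hs : 0 < w1 + w3 := by positivity
  have hs' : 0 < w2 + w4 := by positivity
  refine ⟨(w1 / (w1 + w3)) • p i + (w3 / (w1 + w3)) • p j,
    ⟨_, _, by positivity, by positivity, by field_simp, rfl⟩,
    ⟨w2 / (w2 + w4), w4 / (w2 + w4), by positivity, by positivity, by field_simp, ?_⟩⟩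
  apply hφ
  rw [map_add, map_add, map_smul, map_smul, map_smul, map_smul, hp, hp, hp, hp, exp_angle,
    exp_angle, exp_angle, exp_angle, ← hsum]
  apply Complex.ext
  · simp only [Complex.add_re, Complex.real_smul, Complex.re_ofReal_mul]
    field_simp
    refine congrArg (r * ·) ?_
    change w2 * Real.cos (θ k) + w4 * Real.cos (θ l) = w1 * Real.cos (θ i) + w3 * Real.cos (θ j)
    rw [hw1, hw2, hw3, hw4]; ring
  · simp only [Complex.add_im, Complex.real_smul, Complex.im_ofReal_mul]
    field_simp
    refine congrArg (r * ·) ?_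
    change w2 * Real.sin (θ k) + w4 * Real.sin (θ l) = w1 * Real.sin (θ i) + w3 * Real.sin (θ j)
    rw [hw1, hw2, hw3, hw4]; ring

theorem cos_le_cos_of_mem_Icc {a θ : ℝ} (ha : 0 ≤ a) (h1 : a ≤ θ) (h2 : θ ≤ 2 * Real.pi - a) :
    Real.cos θ ≤ Real.cos a := by
  rcases le_total θ Real.pi with h | h
  · exact Real.cos_le_cos_of_nonneg_of_le_pi ha h h1
  · rw [← Real.cos_two_pi_sub θ]
    exact Real.cos_le_cos_of_nonneg_of_le_pi ha (by linarith) (by linarith)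

theorem disjoint_convexHull_of_arcs (hr : 0 < r)
    (hp : ∀ k : ℤ, φ (p k) = r * Complex.exp (2 * Real.pi * Complex.I * k / h))
    (hh : 0 < h) {i j : ℤ} (hij : i < j) {S T : Set E}
    (hS : ∀ v ∈ S, ∃ m, i ≤ m ∧ m < j ∧ v = p m) (hT : ∀ v ∈ T, ∃ m, j ≤ m ∧ m < i + h ∧ v = p m) :
    Disjoint (convexHull ℝ S) (convexHull ℝ T) := by
  rcases T.eq_empty_or_nonempty with rfl | ⟨v0, hv0⟩
  · simp
  obtain ⟨m0, hm1, hm2, -⟩ := hT v0 hv0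
  have hh' : (0 : ℝ) < h := by exact_mod_cast hh
  have hπ := Real.pi_pos
  -- The separating functional points to the middle of the arc from vertex `i` to vertex `j - 1`.
  -- Below, `a1` is the angle from there to the ends of this arc, `a2` the angle to the nearest
  -- vertices of the other.
  set ψ : ℝ := Real.pi * (i + j - 1) / h with hψ
  let f : E →ₗ[ℝ] ℝ := Real.cos ψ • (Complex.reLm ∘ₗ φ) + Real.sin ψ • (Complex.imLm ∘ₗ φ)
  have hf : ∀ m : ℤ, f (p m) = r * Real.cos (2 * Real.pi * m / h - ψ) := by
    intro m
    have : f (p m) = Real.cos ψ * (φ (p m)).re + Real.sin ψ * (φ (p m)).im := rfl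
    rw [this, hp, exp_angle, Complex.re_ofReal_mul, Complex.im_ofReal_mul, Real.cos_sub]
    ring
  have hle : (j : ℝ) - i + 1 ≤ h := by
    have : j - i + 1 ≤ h := by omega
    exact_mod_cast this
  have hij1 : (1 : ℝ) ≤ j - i := by
    have : 1 ≤ j - i := by omega
    exact_mod_cast this
  set a1 := Real.pi * (j - i - 1) / h with ha1
  set a2 := Real.pi * (j - i + 1) / h with ha2
  have ha1' : 0 ≤ a1 := by
    rw [ha1]; apply div_nonneg _ hh'.le; apply mul_nonneg hπ.le; linarith
  have ha2' : a2 ≤ Real.pi := by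
    rw [ha2, div_le_iff₀ hh']; nlinarith
  have ha12 : a1 < a2 := by
    rw [ha1, ha2]; gcongr; linarith
  have hlt : r * Real.cos a2 < r * Real.cos a1 := by
    have := Real.cos_lt_cos_of_nonneg_of_le_pi ha1' ha2' ha12
    gcongr
  have h1 : convexHull ℝ S ⊆ {v | r * Real.cos a1 ≤ f v} := by
    refine convexHull_min ?_ (convex_halfSpace_ge f.isLinear _)
    intro v hv
    obtain ⟨m, hm1, hm2, rfl⟩ := hS v hv
    have hm1' : (i : ℝ) ≤ m := by exact_mod_cast hm1
    have hm2' : (m : ℝ) ≤ j - 1 := by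
      have : m ≤ j - 1 := by omega
      exact_mod_cast this
    change r * Real.cos a1 ≤ f (p m)
    rw [hf, ← Real.cos_abs (_ - _)]
    refine mul_le_mul_of_nonneg_left ?_ hr.le
    refine Real.cos_le_cos_of_nonneg_of_le_pi (abs_nonneg _) (by linarith) ?_
    rw [abs_le, hψ, ha1]
    constructor
    · rw [← sub_nonneg]
      have : 2 * Real.pi * m / h - Real.pi * (i + j - 1) / h - -(Real.pi * (j - i - 1) / h) =
        2 * Real.pi * (m - i) / h := by field_simp; ring
      rw [this]
      apply div_nonneg _ hh'.le; apply mul_nonneg (by positivity); linarith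
    · rw [← sub_nonneg]
      have : Real.pi * (j - i - 1) / h - (2 * Real.pi * m / h - Real.pi * (i + j - 1) / h) =
        2 * Real.pi * (j - 1 - m) / h := by field_simp; ring
      rw [this]
      apply div_nonneg _ hh'.le; apply mul_nonneg (by positivity); linarith
  have h2 : convexHull ℝ T ⊆ {v | f v ≤ r * Real.cos a2} := by
    refine convexHull_min ?_ (convex_halfSpace_le f.isLinear _)
    intro v hv
    obtain ⟨m, hm1, hm2, rfl⟩ := hT v hv
    have hm1' : (j : ℝ) ≤ m := by exact_mod_cast hm1
    have hm2' : (m : ℝ) ≤ i + h - 1 := by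
      have : m ≤ i + h - 1 := by omega
      exact_mod_cast this
    change f (p m) ≤ r * Real.cos a2
    rw [hf]
    refine mul_le_mul_of_nonneg_left ?_ hr.le
    refine cos_le_cos_of_mem_Icc (by linarith) ?_ ?_
    · rw [hψ, ha2, ← sub_nonneg]
      have : 2 * Real.pi * m / h - Real.pi * (i + j - 1) / h - Real.pi * (j - i + 1) / h =
        2 * Real.pi * (m - j) / h := by field_simp; ring
      rw [this]
      apply div_nonneg _ hh'.le; apply mul_nonneg (by positivity); linarith
    · rw [hψ, ha2, ← sub_nonneg]
      have : 2 * Real.pi - Real.pi * (j - i + 1) / h -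
          (2 * Real.pi * m / h - Real.pi * (i + j - 1) / h) =
        2 * Real.pi * (i + h - 1 - m) / h := by field_simp; ring
      rw [this]
      apply div_nonneg _ hh'.le; apply mul_nonneg (by positivity); linarith
  rw [Set.disjoint_left]
  intro v hv1 hv2
  have e1 : r * Real.cos a1 ≤ f v := h1 hv1
  have e2 : f v ≤ r * Real.cos a2 := h2 hv2
  linarith

end Polygon

/-! ### Disjoint hulls and noncrossing partitions -/

namespace Realization

variable {B W V : Type*} [Group W] {M : CoxeterMatrix B} {cs : CoxeterSystem M W}
  [NormedAddCommGroup V] [InnerProductSpace ℝ V] {ρ : Realization cs V}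

namespace IsCyclicOrbit

variable {c : W} {h : ℕ} {x : ℤ → V} (hx : ρ.IsCyclicOrbit c h x)
include hx

theorem mem_orbit_iff {W' : Subgroup W} {k : ℤ} {v : V} :
    v ∈ ρ.orbit W' (x k) ↔ ∃ l, v = x l ∧ ρ.Linked W' x k l := by
  constructor
  · rintro ⟨w, hw, rfl⟩
    obtain ⟨l, e⟩ := hx.exists_act w k
    exact ⟨l, e, w, hw, e⟩
  · rintro ⟨l, rfl, w, hw, e⟩
    exact ⟨w, hw, e⟩

/-- The hulls of the `W'`-orbits in the Coxeter plane are disjoint iff the orbits are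
noncrossing. -/
theorem hullsDisjoint_iff [FiniteDimensional ℝ V] [Fintype B] [DecidableEq B] (β : Bipartition M)
    {φ : ρ.plane β →ₗ[ℝ] ℂ} (hφ : Function.Injective φ) {r : ℝ} (hr : 0 < r)
    (hp : ∀ k : ℤ, φ (ρ.proj β (x k)) = r * Complex.exp (2 * Real.pi * Complex.I * k / h))
    (W' : Subgroup W) :
    ρ.HullsDisjoint β (Set.range x) W' ↔ ρ.NoncrossingOrbits W' x h := by
  constructor
  · intro hd i k j l hik hkj hjl hli hij hkl
    by_contra hne
    have hmem : ∀ k, ρ.orbit W' (x k) ∈ ρ.blocks W' (Set.range x) := fun k => ⟨x k, ⟨k, rfl⟩, rfl⟩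
    have hneq : ρ.orbit W' (x i) ≠ ρ.orbit W' (x k) := by
      intro e
      have : x k ∈ ρ.orbit W' (x i) := by
        rw [e, hx.mem_orbit_iff]
        exact ⟨k, rfl, .refl _ _ _⟩
      obtain ⟨l, e, hl⟩ := hx.mem_orbit_iff.1 this
      exact hne (hl.trans (.of_eq e.symm))
    have hdis := hd (hmem i) (hmem k) hneq
    obtain ⟨v, hv1, hv2⟩ := segments_intersect (p := fun k => ρ.proj β (x k)) hφ hp hx.pos hik hkj
      hjl hli
    have hsub : ∀ i j, ρ.Linked W' x i j → segment ℝ (ρ.proj β (x i)) (ρ.proj β (x j)) ⊆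
        convexHull ℝ (ρ.proj β '' ρ.orbit W' (x i)) := fun i j hij =>
      segment_subset_convexHull
        (Set.mem_image_of_mem _ (hx.mem_orbit_iff.2 ⟨i, rfl, .refl _ _ _⟩))
        (Set.mem_image_of_mem _ (hx.mem_orbit_iff.2 ⟨j, rfl, hij⟩))
    exact Set.disjoint_left.1 hdis (hsub i j hij hv1) (hsub k l hkl hv2)
  · rintro hnc _ ⟨_, ⟨a, rfl⟩, rfl⟩ _ ⟨_, ⟨b, rfl⟩, rfl⟩ hne
    have hab : ¬ ρ.Linked W' x a b := by
      intro hab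
      apply hne
      ext v
      rw [hx.mem_orbit_iff, hx.mem_orbit_iff]
      exact exists_congr fun l => and_congr_right fun _ => ⟨hab.symm.trans, hab.trans⟩
    classical
    -- The block of `a` is listed in a window whose ends both represent `x b`. A point `m` of the
    -- block of `b` between the extremes `i` and `j` of this list would give the crossing `i < m < j
    -- < b + h`.
    set A := (Finset.Ioo b (b + h)).filter fun m => ρ.Linked W' x a m with hA
    have hmemA : ∀ m, ρ.Linked W' x a m → ∃ m', m' ∈ A ∧ x m' = x m := by
      intro m hm
      obtain ⟨m', h1, h2, e⟩ := hx.exists_mem_window b m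
      have hm' := hm.trans (.of_eq e.symm)
      refine ⟨m', ?_, e⟩
      rw [hA, Finset.mem_filter, Finset.mem_Ioo]
      refine ⟨⟨lt_of_le_of_ne h1 ?_, h2⟩, hm'⟩
      rintro rfl
      exact hab hm'
    have hAne : A.Nonempty := by
      obtain ⟨m, hm, -⟩ := hmemA a (.refl _ _ _)
      exact ⟨m, hm⟩
    set i := A.min' hAne with hi
    set j := A.max' hAne with hj
    have hiA := A.min'_mem hAne
    have hjA := A.max'_mem hAne
    rw [← hi, hA, Finset.mem_filter, Finset.mem_Ioo] at hiA
    rw [← hj, hA, Finset.mem_filter, Finset.mem_Ioo] at hjA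
    have hij : i ≤ j := A.min'_le j (A.max'_mem hAne)
    refine disjoint_convexHull_of_arcs (φ := φ) (p := fun k => ρ.proj β (x k)) hr hp hx.pos
      (i := i) (j := j + 1) (by omega) ?_ ?_
    · rintro _ ⟨v, hv, rfl⟩
      obtain ⟨m, rfl, hm⟩ := hx.mem_orbit_iff.1 hv
      obtain ⟨m', hm', e⟩ := hmemA m hm
      have h1 : i ≤ m' := A.min'_le _ hm'
      have h2 : m' ≤ j := A.le_max' _ hm'
      exact ⟨m', h1, by omega, by simp only [e]⟩
    · rintro _ ⟨v, hv, rfl⟩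
      obtain ⟨m0, rfl, hm0⟩ := hx.mem_orbit_iff.1 hv
      obtain ⟨m, h1, h2, e⟩ := hx.exists_mem_window i m0
      have hbm : ρ.Linked W' x b m := hm0.trans (.of_eq e.symm)
      refine ⟨m, ?_, h2, by simp only [e]⟩
      by_contra hmj
      have hmi : i ≠ m := by
        intro h
        rw [← h] at hbm
        exact hab (hiA.2.trans hbm.symm)
      have hmj' : m ≠ j := by
        intro h
        rw [h] at hbm
        exact hab (hjA.2.trans hbm.symm)
      have hb' : ρ.Linked W' x m (b + h) := hbm.symm.trans (.of_eq (hx.apply_add b).symm)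
      have := hnc i m j (b + h) (by omega) (by omega) (by omega) (by omega)
        (hiA.2.symm.trans hjA.2) hb'
      exact hab (hiA.2.trans (this.trans hbm.symm))

end IsCyclicOrbit
end Realization
end CoxeterPlane

namespace CoxeterPlane
open scoped InnerProductSpace
open Module (finrank)

/-! ### The Gram matrix -/

section Gram

variable {B : Type*} {M : CoxeterMatrix B}

theorem gram_apply (i j : B) : gram M i j = -Real.cos (Real.pi / (M i j : ℝ)) := rfl

theorem gram_symm (i j : B) : gram M i j = gram M j i := by
  rw [gram_apply, gram_apply, M.symmetric]

theorem gram_self (i : B) : gram M i i = 1 := by simp [gram_apply]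

theorem gram_eq_zero {i j : B} (h : M i j = 2) : gram M i j = 0 := by simp [gram_apply, h]

theorem gram_neg {i j : B} (hij : i ≠ j) (h : M i j ≠ 2) : gram M i j < 0 := by
  have h1 := M.off_diagonal i j hij
  rw [gram_apply, neg_lt_zero]
  rcases Nat.eq_zero_or_pos (M i j) with h0 | h0
  · simp [h0]
  · have h3 : (3 : ℝ) ≤ (M i j : ℝ) := by
      have : 3 ≤ M i j := by omega
      exact_mod_cast this
    have hπ := Real.pi_pos
    refine Real.cos_pos_of_mem_Ioo ⟨?_, ?_⟩
    · have : 0 < Real.pi / (M i j : ℝ) := by positivity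
      linarith
    · rw [div_lt_div_iff₀ (by linarith) two_pos]
      nlinarith

theorem gram_nonpos {i j : B} (hij : i ≠ j) : gram M i j ≤ 0 := by
  by_cases h : M i j = 2
  · rw [gram_eq_zero h]
  · exact (gram_neg hij h).le

/-- The Coxeter diagram is connected. -/
def DiagramConnected (M : CoxeterMatrix B) : Prop :=
  ∀ f : B → ℝ, (∀ i j, M i j ≠ 2 → f i = f j) → ∀ i j, f i = f j

variable [Fintype B]

/-- A positive eigenvector of the Gram matrix. -/
structure IsPerronVector (M : CoxeterMatrix B) (z : B → ℝ) (μ : ℝ) : Prop where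
  pos : ∀ i, 0 < z i
  eigen : ∀ i, ∑ j, gram M i j * z j = μ * z i

theorem isPerronVector_iff {z : B → ℝ} {μ : ℝ} :
    IsPerronVector M z μ ↔ (∀ i, 0 < z i) ∧ (gram M).mulVec z = μ • z := by
  constructor
  · exact fun h => ⟨h.pos, funext fun i => h.eigen i⟩
  · exact fun h => ⟨h.1, fun i => congrFun h.2 i⟩

namespace IsPerronVector

variable {z : B → ℝ} {μ : ℝ} (hz : IsPerronVector M z μ)
include hz

/-- Expand `(b i - b j)²` and evaluate the pure squares by the eigenvector equation. As off-diagonal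
Gram entries are nonpositive, the last sum is nonnegative; positive definiteness and uniqueness of
the eigenvector both follow from this. -/
theorem quadratic_form (b : B → ℝ) :
    2 * ∑ i, ∑ j, gram M i j * (z i * b i) * (z j * b j) =
      2 * μ * (∑ i, (z i * b i) ^ 2) + ∑ i, ∑ j, -gram M i j * z i * z j * (b i - b j) ^ 2 := by
  have h1 : ∑ i, ∑ j, gram M i j * z i * z j * b i ^ 2 = μ * ∑ i, (z i * b i) ^ 2 := by
    rw [Finset.mul_sum]
    refine Finset.sum_congr rfl fun i _ => ?_
    have : ∑ j, gram M i j * z i * z j * b i ^ 2 = (∑ j, gram M i j * z j) * (z i * b i ^ 2) := by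
      rw [Finset.sum_mul]
      exact Finset.sum_congr rfl fun j _ => by ring
    rw [this, hz.eigen]
    ring
  have h2 : ∑ i, ∑ j, gram M i j * z i * z j * b j ^ 2 = μ * ∑ i, (z i * b i) ^ 2 := by
    rw [← h1, Finset.sum_comm]
    refine Finset.sum_congr rfl fun i _ => Finset.sum_congr rfl fun j _ => ?_
    rw [gram_symm]; ring
  have h3 : ∑ i, ∑ j, -gram M i j * z i * z j * (b i - b j) ^ 2 =
      2 * (∑ i, ∑ j, gram M i j * (z i * b i) * (z j * b j)) -
        ∑ i, ∑ j, gram M i j * z i * z j * b i ^ 2 -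
        ∑ i, ∑ j, gram M i j * z i * z j * b j ^ 2 := by
    simp only [Finset.mul_sum, ← Finset.sum_sub_distrib]
    exact Finset.sum_congr rfl fun i _ => Finset.sum_congr rfl fun j _ => by ring
  rw [h3, h1, h2]
  ring

theorem term_nonneg (b : B → ℝ) (i j : B) : 0 ≤ -gram M i j * z i * z j * (b i - b j) ^ 2 := by
  by_cases hij : i = j
  · simp [hij]
  · have h1 := gram_nonpos (M := M) hij
    have h2 := hz.pos i
    have h3 := hz.pos j
    have : 0 ≤ -gram M i j := by linarith
    positivity

theorem eq_zero_of_quadratic_form (hμ : 0 < μ) {a : B → ℝ}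
    (ha : ∑ i, ∑ j, gram M i j * a i * a j = 0) (i : B) : a i = 0 := by
  have h := hz.quadratic_form fun i => a i / z i
  have e : ∀ i, z i * (a i / z i) = a i := fun i => mul_div_cancel₀ _ (hz.pos i).ne'
  simp only [e, ha] at h
  have h1 : 0 ≤ ∑ i, ∑ j, -gram M i j * z i * z j * (a i / z i - a j / z j) ^ 2 :=
    Finset.sum_nonneg fun i _ => Finset.sum_nonneg fun j _ =>
      hz.term_nonneg (fun i => a i / z i) i j
  have h2 : 0 ≤ ∑ i, a i ^ 2 := Finset.sum_nonneg fun i _ => sq_nonneg _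
  have h3 : ∑ i, a i ^ 2 = 0 := by nlinarith
  have := (Finset.sum_eq_zero_iff_of_nonneg fun i _ => sq_nonneg _).1 h3 i (Finset.mem_univ i)
  exact pow_eq_zero_iff two_ne_zero |>.1 this

/-- Pairing the two vectors through the symmetric Gram matrix shows that the eigenvalues agree. Then
`quadratic_form` for the ratio `z' / z` makes a sum of nonnegative terms vanish, so the ratio is
constant along every edge. -/
theorem unique (hconn : DiagramConnected M) {z' : B → ℝ} {μ' : ℝ} (hz' : IsPerronVector M z' μ')
    [Nonempty B] : ∃ r : ℝ, ∀ i, z' i = r * z i := by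
  have hpos : 0 < ∑ i, z i * z' i :=
    Finset.sum_pos (fun i _ => mul_pos (hz.pos i) (hz'.pos i)) Finset.univ_nonempty
  have h1 : μ' * ∑ i, z i * z' i = μ * ∑ i, z i * z' i := by
    have e1 : ∑ i, ∑ j, gram M i j * z' j * z i = μ' * ∑ i, z i * z' i := by
      rw [Finset.mul_sum]
      refine Finset.sum_congr rfl fun i _ => ?_
      rw [← Finset.sum_mul, hz'.eigen]; ring
    have e2 : ∑ i, ∑ j, gram M i j * z' j * z i = μ * ∑ i, z i * z' i := by
      rw [Finset.mul_sum, Finset.sum_comm]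
      refine Finset.sum_congr rfl fun i _ => ?_
      have : ∑ j, gram M j i * z' i * z j = (∑ j, gram M i j * z j) * z' i := by
        rw [Finset.sum_mul]
        refine Finset.sum_congr rfl fun j _ => ?_
        rw [gram_symm]; ring
      rw [this, hz.eigen]; ring
    rw [← e1, e2]
  have hμ : μ' = μ := mul_right_cancel₀ hpos.ne' h1
  subst hμ
  have h := hz.quadratic_form fun i => z' i / z i
  have e : ∀ i, z i * (z' i / z i) = z' i := fun i => mul_div_cancel₀ _ (hz.pos i).ne'
  simp only [e] at h
  have h2 : ∑ i, ∑ j, gram M i j * z' i * z' j = μ' * ∑ i, z' i ^ 2 := by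
    rw [Finset.mul_sum]
    refine Finset.sum_congr rfl fun i _ => ?_
    have : ∑ j, gram M i j * z' i * z' j = (∑ j, gram M i j * z' j) * z' i := by
      rw [Finset.sum_mul]
      exact Finset.sum_congr rfl fun j _ => by ring
    rw [this, hz'.eigen]; ring
  have h3 : ∑ i, ∑ j, -gram M i j * z i * z j * (z' i / z i - z' j / z j) ^ 2 = 0 := by
    rw [h2] at h; linarith
  have h4 : ∀ i j, -gram M i j * z i * z j * (z' i / z i - z' j / z j) ^ 2 = 0 := by
    intro i j
    have h5 := (Finset.sum_eq_zero_iff_of_nonneg fun i _ =>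
      Finset.sum_nonneg fun j _ => hz.term_nonneg (fun i => z' i / z i) i j).1 h3 i
      (Finset.mem_univ i)
    exact (Finset.sum_eq_zero_iff_of_nonneg fun j _ =>
      hz.term_nonneg (fun i => z' i / z i) i j).1 h5 j (Finset.mem_univ j)
  have h5 := hconn (fun i => z' i / z i) fun i j hij => by
    by_cases hne : i = j
    · rw [hne]
    have h6 := h4 i j
    have h7 := gram_neg hne hij
    have h8 := hz.pos i
    have h9 := hz.pos j
    have h10 : -gram M i j * z i * z j ≠ 0 := by
      have : 0 < -gram M i j := by linarith
      positivity
    exact sub_eq_zero.1 (pow_eq_zero_iff two_ne_zero |>.1 ((mul_eq_zero.1 h6).resolve_left h10))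
  obtain ⟨i0⟩ := ‹Nonempty B›
  refine ⟨z' i0 / z i0, fun i => ?_⟩
  rw [← h5 i i0, div_mul_cancel₀ _ (hz.pos i).ne']

end IsPerronVector
end Gram

namespace Realization

variable {B W V : Type*} [Group W] {M : CoxeterMatrix B} {cs : CoxeterSystem M W}
  [NormedAddCommGroup V] [InnerProductSpace ℝ V] (ρ : Realization cs V)

/-! ### Simple roots -/

theorem eq_zero_of_inner_root {v : V} (hv : ∀ i, ⟪ρ.root i, v⟫_ℝ = 0) : v = 0 := by
  refine ρ.eq_zero_of_fixed v fun w => ?_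
  induction w using cs.simple_induction_left with
  | one => exact ρ.act_one_apply v
  | mul_simple_left w i ih => rw [act_mul_apply, ih, act_simple_apply, hv]; simp

theorem span_root [FiniteDimensional ℝ V] : Submodule.span ℝ (Set.range ρ.root) = ⊤ := by
  rw [← Submodule.orthogonal_eq_bot_iff, eq_bot_iff]
  intro v hv
  exact ρ.eq_zero_of_inner_root fun i => hv _ (Submodule.subset_span ⟨i, rfl⟩)

section Simple

variable [Fintype B]

theorem inner_sum_root (a b : B → ℝ) :
    ⟪∑ i, a i • ρ.root i, ∑ j, b j • ρ.root j⟫_ℝ = ∑ i, ∑ j, gram M i j * a i * b j := by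
  rw [sum_inner]
  refine Finset.sum_congr rfl fun i _ => ?_
  rw [inner_sum]
  refine Finset.sum_congr rfl fun j _ => ?_
  rw [inner_smul_left, inner_smul_right, ρ.inner_root]
  simp only [RCLike.conj_to_real]
  ring

theorem linearIndependent_root {z : B → ℝ} {μ : ℝ} (hz : IsPerronVector M z μ) (hμ : 0 < μ) :
    LinearIndependent ℝ ρ.root := by
  rw [Fintype.linearIndependent_iff]
  intro a ha
  refine hz.eq_zero_of_quadratic_form hμ ?_
  rw [← ρ.inner_sum_root, ha, inner_zero_left]

theorem finrank_eq_card (ρ : Realization cs V) [FiniteDimensional ℝ V] {z : B → ℝ} {μ : ℝ}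
    (hz : IsPerronVector M z μ) (hμ : 0 < μ) : finrank ℝ V = Fintype.card B := by
  rw [← finrank_top, ← ρ.span_root, finrank_span_eq_card (ρ.linearIndependent_root hz hμ)]

/-- An irreducible reflection group has no invariant subspaces. -/
theorem eq_top_of_invariant [FiniteDimensional ℝ V] (hconn : DiagramConnected M)
    {D : Submodule ℝ V} (hD : ∀ w, ∀ v ∈ D, ρ.act w v ∈ D) (hne : D ≠ ⊥) : D = ⊤ := by
  classical
  have h1 : ∀ i, ρ.root i ∉ D → ∀ v ∈ D, ⟪ρ.root i, v⟫_ℝ = 0 := by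
    intro i hi v hv
    by_contra hne
    apply hi
    have h2 : v - ρ.act (cs.simple i) v ∈ D := D.sub_mem hv (hD _ v hv)
    rw [act_simple_apply, sub_sub_cancel] at h2
    exact (D.smul_mem_iff (by simpa using hne)).1 h2
  have h2 := hconn (fun i => if ρ.root i ∈ D then 1 else 0) fun i j hij => by
    have key : ∀ i j, M i j ≠ 2 → ρ.root i ∈ D → ρ.root j ∈ D := by
      intro i j hij hi
      by_contra hj
      have hne : i ≠ j := by rintro rfl; exact hj hi
      have h3 := h1 j hj _ hi
      rw [real_inner_comm, ρ.inner_root] at h3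
      exact (gram_neg hne hij).ne h3
    have := key i j hij
    have := key j i (by rwa [M.symmetric])
    by_cases hi : ρ.root i ∈ D <;> by_cases hj : ρ.root j ∈ D <;> simp_all
  by_cases hall : ∀ i, ρ.root i ∈ D
  · rw [eq_top_iff, ← ρ.span_root, Submodule.span_le]
    rintro _ ⟨i, rfl⟩
    exact hall i
  · push Not at hall
    obtain ⟨i, hi⟩ := hall
    exfalso
    apply hne
    rw [eq_bot_iff]
    intro v hv
    refine ρ.eq_zero_of_inner_root fun j => h1 j ?_ v hv
    intro hj
    have := h2 i j
    simp [hi, hj] at this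

end Simple

/-! ### The action of the Coxeter element on the Coxeter plane -/

theorem act_noncommProd [DecidableEq B] (S : Finset B) (hS : ∀ i ∈ S, ∀ j ∈ S, i ≠ j → M i j = 2)
    (comm : (S : Set B).Pairwise (Function.onFun Commute cs.simple)) (v : V) :
    ρ.act (S.noncommProd cs.simple comm) v = v - ∑ i ∈ S, (2 * ⟪ρ.root i, v⟫_ℝ) • ρ.root i := by
  induction S using Finset.induction_on with
  | empty => simp
  | insert i S hi ih =>
    rw [Finset.noncommProd_insert_of_notMem _ _ _ _ hi, act_mul_apply,
      ih (fun j hj k hk => hS j (Finset.mem_insert_of_mem hj) k (Finset.mem_insert_of_mem hk)),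
      act_simple_apply, Finset.sum_insert hi]
    have : ⟪ρ.root i, ∑ j ∈ S, (2 * ⟪ρ.root j, v⟫_ℝ) • ρ.root j⟫_ℝ = 0 := by
      rw [inner_sum]
      refine Finset.sum_eq_zero fun j hj => ?_
      rw [inner_smul_right, ρ.inner_root, gram_eq_zero, mul_zero]
      exact hS i (Finset.mem_insert_self _ _) j (Finset.mem_insert_of_mem hj)
        fun h => hi (h ▸ hj)
    rw [inner_sub_right, this, sub_zero]
    abel

/-- The vector `∑_{i ∈ S} z_i α_i`. -/
noncomputable def partVector (z : B → ℝ) (S : Finset B) : V := ∑ i ∈ S, z i • ρ.root i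

theorem inner_root_partVector_self {S : Finset B} (hS : ∀ i ∈ S, ∀ j ∈ S, i ≠ j → M i j = 2)
    (z : B → ℝ) {i : B} (hi : i ∈ S) : ⟪ρ.root i, ρ.partVector z S⟫_ℝ = z i := by
  rw [partVector, inner_sum, Finset.sum_eq_single_of_mem i hi]
  · rw [inner_smul_right, inner_root_self, mul_one]
  · intro j hj hne
    rw [inner_smul_right, ρ.inner_root, gram_eq_zero (hS i hi j hj hne.symm), mul_zero]

theorem act_partVector_self [DecidableEq B] {S : Finset B}
    (hS : ∀ i ∈ S, ∀ j ∈ S, i ≠ j → M i j = 2)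
    (comm : (S : Set B).Pairwise (Function.onFun Commute cs.simple)) (z : B → ℝ) :
    ρ.act (S.noncommProd cs.simple comm) (ρ.partVector z S) = -ρ.partVector z S := by
  rw [ρ.act_noncommProd S hS]
  have : ∑ i ∈ S, (2 * ⟪ρ.root i, ρ.partVector z S⟫_ℝ) • ρ.root i = (2 : ℝ) • ρ.partVector z S := by
    conv_rhs => rw [partVector, Finset.smul_sum]
    refine Finset.sum_congr rfl fun i hi => ?_
    rw [ρ.inner_root_partVector_self hS z hi, smul_smul]
  rw [this, two_smul]
  abel

theorem inner_partVector_self {S : Finset B} (hS : ∀ i ∈ S, ∀ j ∈ S, i ≠ j → M i j = 2)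
    (z : B → ℝ) : ⟪ρ.partVector z S, ρ.partVector z S⟫_ℝ = ∑ i ∈ S, z i ^ 2 := by
  conv_lhs => enter [2]; rw [partVector]
  rw [sum_inner]
  refine Finset.sum_congr rfl fun i hi => ?_
  rw [inner_smul_left, ρ.inner_root_partVector_self hS z hi]
  simp [sq]

variable [Fintype B] [DecidableEq B]

section Opposite

variable {z : B → ℝ} {μ : ℝ} (hz : IsPerronVector M z μ) {S T : Finset B}
  (hdisj : Disjoint S T) (hunion : S ∪ T = Finset.univ)
include hz hdisj hunion

theorem inner_root_partVector_other (hS : ∀ i ∈ S, ∀ j ∈ S, i ≠ j → M i j = 2) {i : B}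
    (hi : i ∈ S) : ⟪ρ.root i, ρ.partVector z T⟫_ℝ = (μ - 1) * z i := by
  have h1 : ⟪ρ.root i, ρ.partVector z S⟫_ℝ + ⟪ρ.root i, ρ.partVector z T⟫_ℝ = μ * z i := by
    rw [← inner_add_right, partVector, partVector, ← Finset.sum_union hdisj, hunion, inner_sum,
      ← hz.eigen]
    refine Finset.sum_congr rfl fun j _ => ?_
    rw [inner_smul_right, ρ.inner_root, mul_comm]
  rw [ρ.inner_root_partVector_self hS z hi] at h1
  linarith

theorem act_partVector_other (hS : ∀ i ∈ S, ∀ j ∈ S, i ≠ j → M i j = 2)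
    (comm : (S : Set B).Pairwise (Function.onFun Commute cs.simple)) :
    ρ.act (S.noncommProd cs.simple comm) (ρ.partVector z T) =
      ρ.partVector z T - (2 * (μ - 1)) • ρ.partVector z S := by
  rw [ρ.act_noncommProd S hS, partVector, partVector, Finset.smul_sum]
  congr 1
  refine Finset.sum_congr rfl fun i hi => ?_
  have := ρ.inner_root_partVector_other hz hdisj hunion hS hi
  rw [partVector] at this
  rw [this, smul_smul]
  congr 1; ring

theorem inner_partVector_other (hS : ∀ i ∈ S, ∀ j ∈ S, i ≠ j → M i j = 2) :
    ⟪ρ.partVector z S, ρ.partVector z T⟫_ℝ = (μ - 1) * ∑ i ∈ S, z i ^ 2 := by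
  conv_lhs => enter [2]; rw [partVector]
  rw [sum_inner, Finset.mul_sum]
  refine Finset.sum_congr rfl fun i hi => ?_
  rw [inner_smul_left, ρ.inner_root_partVector_other hz hdisj hunion hS hi]
  simp only [RCLike.conj_to_real]
  ring

end Opposite

theorem plane_eq_span {z : B → ℝ} {μ : ℝ} (hz : IsPerronVector M z μ)
    (hconn : DiagramConnected M) [Nonempty B] (β : Bipartition M) :
    ρ.plane β = Submodule.span ℝ {ρ.partVector z β.pos, ρ.partVector z β.neg} := by
  apply le_antisymm
  · rw [plane, Submodule.span_le]
    rintro v ⟨z', hz', ⟨μ', hμ'⟩, hv⟩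
    obtain ⟨r, hr⟩ := hz.unique hconn (isPerronVector_iff.2 ⟨hz', hμ'⟩)
    have h : ∀ S : Finset B, ∑ i ∈ S, z' i • ρ.root i = r • ρ.partVector z S := by
      intro S
      rw [partVector, Finset.smul_sum]
      exact Finset.sum_congr rfl fun i _ => by rw [hr, smul_smul]
    rw [h, h] at hv
    rcases hv with rfl | rfl
    · exact Submodule.smul_mem _ _ (Submodule.subset_span (by simp))
    · exact Submodule.smul_mem _ _ (Submodule.subset_span (by simp))
  · rw [Submodule.span_le]
    have h := (isPerronVector_iff.1 hz)
    rintro v (rfl | rfl)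
    · exact Submodule.subset_span ⟨z, h.1, ⟨μ, h.2⟩, Or.inl rfl⟩
    · exact Submodule.subset_span ⟨z, h.1, ⟨μ, h.2⟩, Or.inr rfl⟩

/-- A complex coordinate on the Coxeter plane (extended to `V` by the orthogonal projection) in
which the Coxeter element is the rotation by `2π / h`. -/
structure IsPlaneCoordinate [FiniteDimensional ℝ V] (β : Bipartition M) (h : ℕ)
    (Φ : V →ₗ[ℝ] ℂ) : Prop where
  norm_map : ∀ v ∈ ρ.plane β, ‖Φ v‖ = ‖v‖
  map_proj : ∀ v, Φ (ρ.proj β v) = Φ v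
  map_act : ∀ v, Φ (ρ.act (bipartiteCoxeterElement cs β) v) =
    Complex.exp (2 * Real.pi * Complex.I / h) * Φ v
  ne_zero : Φ ≠ 0

theorem inner_proj [FiniteDimensional ℝ V] (β : Bipartition M) {e : V} (he : e ∈ ρ.plane β)
    (v : V) : ⟪e, (ρ.proj β v : V)⟫_ℝ = ⟪e, v⟫_ℝ := by
  have := Submodule.inner_orthogonalProjectionOnto_eq_of_mem_left (K := ρ.plane β) ⟨e, he⟩ v
  exact this

/-- On the plane `c₊` and `c₋` are the reflections along `p` and `q`. These have equal length and
inner product `-cos (π / h)` times its square, so the mirrors meet at angle `π / h` and the product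
is a rotation by `2π / h`. -/
theorem exists_planeCoordinate [FiniteDimensional ℝ V] {z : B → ℝ} {h : ℕ} (hh : 3 ≤ h)
    (hz : IsPerronVector M z (1 - Real.cos (Real.pi / h))) (hconn : DiagramConnected M)
    [Nonempty B] (β : Bipartition M) : ∃ Φ, ρ.IsPlaneCoordinate β h Φ := by
  have hh' : (3 : ℝ) ≤ h := by exact_mod_cast hh
  have hπ := Real.pi_pos
  set θ := Real.pi / h with hθ
  have hθ0 : 0 < θ := by positivity
  have hθ1 : θ < Real.pi / 2 := by
    rw [hθ, div_lt_div_iff₀ (by linarith) two_pos]; nlinarith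
  have hcos : 0 < Real.cos θ := Real.cos_pos_of_mem_Ioo ⟨by linarith, hθ1⟩
  have hsin : 0 < Real.sin θ := Real.sin_pos_of_pos_of_lt_pi hθ0 (by linarith)
  have hunion' : β.neg ∪ β.pos = Finset.univ := by rw [Finset.union_comm, β.union_eq]
  set p := ρ.partVector z β.pos with hp
  set q := ρ.partVector z β.neg with hq
  set N := ∑ i ∈ β.pos, z i ^ 2 with hN
  have hpp : ⟪p, p⟫_ℝ = N := ρ.inner_partVector_self β.pos_eq_two z
  have hqq' : ⟪q, q⟫_ℝ = ∑ i ∈ β.neg, z i ^ 2 := ρ.inner_partVector_self β.neg_eq_two z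
  have hpq : ⟪p, q⟫_ℝ = -Real.cos θ * N := by
    rw [hp, hq, ρ.inner_partVector_other hz β.disjoint β.union_eq β.pos_eq_two]; ring
  have hqp : ⟪q, p⟫_ℝ = -Real.cos θ * ∑ i ∈ β.neg, z i ^ 2 := by
    rw [hp, hq, ρ.inner_partVector_other hz β.disjoint.symm hunion' β.neg_eq_two]; ring
  -- `⟪p, q⟫` computed from either side gives `-cos θ` times either norm; `3 ≤ h` guarantees that
  -- `cos θ` can be cancelled.
  have hNN : ∑ i ∈ β.neg, z i ^ 2 = N := by
    rw [real_inner_comm, hpq] at hqp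
    exact (mul_left_cancel₀ (neg_ne_zero.2 hcos.ne') hqp).symm
  rw [hNN] at hqq' hqp
  have hNpos : 0 < N := by
    have h1 : 0 < ∑ i, z i ^ 2 :=
      Finset.sum_pos (fun i _ => pow_pos (hz.pos i) 2) Finset.univ_nonempty
    rw [← β.union_eq, Finset.sum_union β.disjoint, hNN] at h1
    linarith
  have hPp : ρ.act (cPos cs β) p = -p := ρ.act_partVector_self β.pos_eq_two _ z
  have hQq : ρ.act (cNeg cs β) q = -q := ρ.act_partVector_self β.neg_eq_two _ z
  have hPq : ρ.act (cPos cs β) q = q - (2 * (1 - Real.cos θ - 1)) • p :=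
    ρ.act_partVector_other hz β.disjoint β.union_eq β.pos_eq_two _
  have hQp : ρ.act (cNeg cs β) p = p - (2 * (1 - Real.cos θ - 1)) • q :=
    ρ.act_partVector_other hz β.disjoint.symm hunion' β.neg_eq_two _
  have hplane : ρ.plane β = Submodule.span ℝ {p, q} := ρ.plane_eq_span hz hconn β
  clear_value p q N
  have hcp : ρ.act (bipartiteCoxeterElement cs β) p = -p - (2 * Real.cos θ) • q := by
    rw [bipartiteCoxeterElement, act_mul_apply, hPp, map_neg, hQp]
    module
  have hcq : ρ.act (bipartiteCoxeterElement cs β) q =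
      (2 * Real.cos θ) • p + (4 * Real.cos θ ^ 2 - 1) • q := by
    rw [bipartiteCoxeterElement, act_mul_apply, hPq, map_sub, map_smul, hQq, hQp]
    module
  obtain ⟨ℓ, hl0, rfl⟩ : ∃ ℓ : ℝ, 0 < ℓ ∧ ℓ * ℓ = N :=
    ⟨√N, Real.sqrt_pos.2 hNpos, Real.mul_self_sqrt hNpos.le⟩
  set e := ℓ⁻¹ • p with he
  -- Gram-Schmidt applied to `p, q`; the sign orients `(e, f)` so that `c` turns by `+2θ`.
  set f := (-(ℓ * Real.sin θ)⁻¹) • (q + Real.cos θ • p) with hf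
  have hs2 : Real.sin θ ^ 2 = 1 - Real.cos θ ^ 2 := by
    have := Real.sin_sq_add_cos_sq θ; linarith
  have hee : ⟪e, e⟫_ℝ = 1 := by
    rw [he, inner_smul_left, inner_smul_right, hpp]
    simp only [RCLike.conj_to_real]
    field_simp
  have hef : ⟪e, f⟫_ℝ = 0 := by
    rw [he, hf, inner_smul_left, inner_smul_right, inner_add_right, inner_smul_right, hpp, hpq]
    ring
  have hff : ⟪f, f⟫_ℝ = 1 := by
    rw [hf, inner_smul_left, inner_smul_right, inner_add_right, inner_smul_right, inner_add_left,
      inner_add_left, inner_smul_left, inner_smul_left, hpp, hpq, hqp, hqq']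
    simp only [RCLike.conj_to_real]
    field_simp
    rw [hs2]
    ring
  have hcos2 : Real.cos (2 * θ) = 2 * Real.cos θ ^ 2 - 1 := Real.cos_two_mul θ
  have hsin2 : Real.sin (2 * θ) = 2 * Real.sin θ * Real.cos θ := Real.sin_two_mul θ
  have hp' : p = ℓ • e := by rw [he, smul_smul, mul_inv_cancel₀ hl0.ne', one_smul]
  have hq' : q = (-(ℓ * Real.sin θ)) • f - (Real.cos θ * ℓ) • e := by
    rw [hf, he, smul_smul, smul_smul, mul_assoc (Real.cos θ), mul_inv_cancel₀ hl0.ne', mul_one,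
      neg_mul_neg, mul_inv_cancel₀ (by positivity), one_smul]
    abel
  have hce : ρ.act (bipartiteCoxeterElement cs β) e =
      Real.cos (2 * θ) • e + Real.sin (2 * θ) • f := by
    rw [he, map_smul, hcp, ← he, hcos2, hsin2, hq']
    nth_rewrite 1 [hp']
    match_scalars <;> field_simp <;> ring
  have hcf : ρ.act (bipartiteCoxeterElement cs β) f =
      -Real.sin (2 * θ) • e + Real.cos (2 * θ) • f := by
    rw [hf, map_smul, map_add, map_smul, hcp, hcq, ← hf, hcos2, hsin2, hq', hp']
    match_scalars
    · field_simp
      rw [hs2]; ring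
    · field_simp
      ring
  have hpP : p ∈ ρ.plane β := hplane ▸ Submodule.subset_span (by simp)
  have hqP : q ∈ ρ.plane β := hplane ▸ Submodule.subset_span (by simp)
  have heP : e ∈ ρ.plane β := Submodule.smul_mem _ _ hpP
  have hfP : f ∈ ρ.plane β :=
    Submodule.smul_mem _ _ (Submodule.add_mem _ hqP (Submodule.smul_mem _ _ hpP))
  clear_value e f
  let Φ : V →ₗ[ℝ] ℂ := (innerₗ V e).smulRight (1 : ℂ) + (innerₗ V f).smulRight Complex.I
  have hΦ : ∀ v, Φ v = ⟪e, v⟫_ℝ + ⟪f, v⟫_ℝ * Complex.I := by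
    intro v
    simp [Φ]
  refine ⟨Φ, ?_, ?_, ?_, ?_⟩
  · intro v hv
    have hv' : v ∈ Submodule.span ℝ {e, f} := by
      have : ρ.plane β ≤ Submodule.span ℝ {e, f} := by
        rw [hplane, Submodule.span_le]
        have h1 : e ∈ Submodule.span ℝ {e, f} := Submodule.subset_span (by simp)
        have h2 : f ∈ Submodule.span ℝ {e, f} := Submodule.subset_span (by simp)
        rintro _ (rfl | rfl)
        · rw [SetLike.mem_coe, hp']; exact Submodule.smul_mem _ _ h1
        · rw [SetLike.mem_coe, hq']
          exact Submodule.sub_mem _ (Submodule.smul_mem _ _ h2) (Submodule.smul_mem _ _ h1)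
      exact this hv
    obtain ⟨a, b, rfl⟩ := Submodule.mem_span_pair.1 hv'
    have h1 : ⟪e, a • e + b • f⟫_ℝ = a := by
      rw [inner_add_right, inner_smul_right, inner_smul_right, hee, hef]; ring
    have h2 : ⟪f, a • e + b • f⟫_ℝ = b := by
      rw [inner_add_right, inner_smul_right, inner_smul_right, real_inner_comm, hff, hef]; ring
    have h3 : ‖a • e + b • f‖ ^ 2 = a ^ 2 + b ^ 2 := by
      rw [← real_inner_self_eq_norm_sq, inner_add_left, inner_smul_left, inner_smul_left, h1, h2]
      simp only [RCLike.conj_to_real]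
      ring
    rw [← sq_eq_sq₀ (norm_nonneg _) (norm_nonneg _), h3, hΦ, h1, h2, Complex.sq_norm,
      Complex.normSq_add_mul_I]
  · intro v
    rw [hΦ, hΦ, ρ.inner_proj β heP, ρ.inner_proj β hfP]
  · intro v
    have h1 : e = Real.cos (2 * θ) • ρ.act (bipartiteCoxeterElement cs β) e -
        Real.sin (2 * θ) • ρ.act (bipartiteCoxeterElement cs β) f := by
      rw [hce, hcf]
      match_scalars
      · linear_combination -Real.sin_sq_add_cos_sq (2 * θ)
      · ring
    have h2 : f = Real.sin (2 * θ) • ρ.act (bipartiteCoxeterElement cs β) e +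
        Real.cos (2 * θ) • ρ.act (bipartiteCoxeterElement cs β) f := by
      rw [hce, hcf]
      match_scalars
      · linear_combination -Real.sin_sq_add_cos_sq (2 * θ)
      · ring
    have h3 : ⟪e, ρ.act (bipartiteCoxeterElement cs β) v⟫_ℝ =
        Real.cos (2 * θ) * ⟪e, v⟫_ℝ - Real.sin (2 * θ) * ⟪f, v⟫_ℝ := by
      nth_rewrite 1 [h1]
      rw [inner_sub_left, inner_smul_left, inner_smul_left, inner_act_act, inner_act_act]
      simp
    have h4 : ⟪f, ρ.act (bipartiteCoxeterElement cs β) v⟫_ℝ =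
        Real.sin (2 * θ) * ⟪e, v⟫_ℝ + Real.cos (2 * θ) * ⟪f, v⟫_ℝ := by
      nth_rewrite 1 [h2]
      rw [inner_add_left, inner_smul_left, inner_smul_left, inner_act_act, inner_act_act]
      simp
    have h5 : Complex.exp (2 * Real.pi * Complex.I / h) =
        Real.cos (2 * θ) + Real.sin (2 * θ) * Complex.I := by
      have : 2 * (Real.pi : ℂ) * Complex.I / h = ((2 * θ : ℝ) : ℂ) * Complex.I := by
        rw [hθ]; push_cast; ring
      rw [this, Complex.exp_mul_I, ← Complex.ofReal_cos, ← Complex.ofReal_sin]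
    rw [hΦ, hΦ, h3, h4, h5]
    push_cast
    linear_combination (-(Complex.sin (2 * θ) * ⟪f, v⟫_ℝ)) * Complex.I_mul_I
  · intro h0
    have := hΦ e
    rw [h0, hee, real_inner_comm, hef] at this
    simp at this

end Realization
end CoxeterPlane

namespace CoxeterPlane
open scoped InnerProductSpace
open Module (finrank)
namespace Realization

variable {B W V : Type*} [Group W] {M : CoxeterMatrix B} {cs : CoxeterSystem M W}
  [NormedAddCommGroup V] [InnerProductSpace ℝ V] {ρ : Realization cs V}

/-! ### Small orbits project to regular polygons -/

theorem act_mem_orbit {y : V} (w : W) {a : V} (ha : a ∈ ρ.orbit ⊤ y) :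
    ρ.act w a ∈ ρ.orbit ⊤ y := by
  obtain ⟨g, -, rfl⟩ := ha
  exact ⟨w * g, Subgroup.mem_top _, ρ.act_mul_apply w g y⟩

theorem orbit_finite [Finite W] (W' : Subgroup W) (y : V) : (ρ.orbit W' y).Finite := by
  refine (Set.finite_range fun w => ρ.act w y).subset ?_
  rintro _ ⟨w, -, rfl⟩
  exact ⟨w, rfl⟩

theorem IsCyclicOrbit.ncard_range {c : W} {h : ℕ} {x : ℤ → V}
    (hx : ρ.IsCyclicOrbit c h x) : (Set.range x).ncard = h := by
  classical
  have : Set.range x = ((Finset.Ico (0 : ℤ) h).image x : Finset V) := by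
    apply Set.Subset.antisymm
    · rintro _ ⟨k, rfl⟩
      obtain ⟨l, h1, h2, e⟩ := hx.exists_mem_window 0 k
      simp only [Finset.coe_image, Finset.coe_Ico, Set.mem_image, Set.mem_Ico]
      exact ⟨l, ⟨h1, by omega⟩, e⟩
    · intro v hv
      simp only [Finset.coe_image, Set.mem_image] at hv
      obtain ⟨k, -, rfl⟩ := hv
      exact ⟨k, rfl⟩
  rw [this, Set.ncard_coe_finset, Finset.card_image_of_injOn]
  · simp
  · intro k hk l hl e
    simp only [Finset.coe_Ico, Set.mem_Ico] at hk hl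
    exact hx.eq_of_mem_window (i := 0) hk.1 (by omega) hl.1 (by omega) e

variable [FiniteDimensional ℝ V] [Fintype B]

theorem span_orbit_eq_top (hconn : DiagramConnected M) {y : V} (hy : y ≠ 0) :
    Submodule.span ℝ (ρ.orbit ⊤ y) = ⊤ := by
  refine ρ.eq_top_of_invariant hconn (fun w v hv => ?_) fun h => hy ?_
  · induction hv using Submodule.span_induction with
    | mem a ha => exact Submodule.subset_span (act_mem_orbit w ha)
    | zero => rw [map_zero]; exact Submodule.zero_mem _
    | add a b _ _ ha hb => rw [map_add]; exact Submodule.add_mem _ ha hb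
    | smul r a _ ha => rw [map_smul]; exact Submodule.smul_mem _ _ ha
  · have : y ∈ Submodule.span ℝ (ρ.orbit ⊤ y) :=
      Submodule.subset_span ⟨1, Subgroup.mem_top _, ρ.act_one_apply y⟩
    rwa [h, Submodule.mem_bot] at this

variable [DecidableEq B] {β : Bipartition M} {h : ℕ} {Φ : V →ₗ[ℝ] ℂ}

theorem IsPlaneCoordinate.map_zpow (hΦ : ρ.IsPlaneCoordinate β h Φ) (k : ℤ) (v : V) :
    Φ (ρ.act (bipartiteCoxeterElement cs β ^ k) v) =
      Complex.exp (2 * Real.pi * Complex.I / h) ^ k * Φ v := by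
  have hne := Complex.exp_ne_zero (2 * Real.pi * Complex.I / h)
  induction k using Int.induction_on with
  | zero => simp
  | succ k ih => rw [zpow_add_one, zpow_add_one₀ hne, ← mul_comm _ (_ ^ (k : ℤ)), mul_assoc, ← ih,
      (Commute.zpow_self _ _).eq, act_mul_apply, hΦ.map_act]
  | pred k ih =>
    apply mul_left_cancel₀ hne
    rw [← hΦ.map_act, ← act_mul_apply, ← zpow_one_add, ← mul_assoc, ← zpow_one_add₀ hne,
      show (1 : ℤ) + (-k - 1) = -k by ring, ih]

/-- The orbit spans, so some point has nonzero coordinate. Its translates under `c ^ k`, `0 ≤ k <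
h`, have distinct coordinates and so exhaust an orbit of at most `h` points. -/
theorem IsPlaneCoordinate.exists_cyclicOrbit [Finite W] (hΦ : ρ.IsPlaneCoordinate β h Φ)
    (hh : 0 < h) (hconn : DiagramConnected M) {o : Set V} (ho : ρ.IsNontrivialOrbit o)
    (hcard : o.ncard ≤ h) :
    ∃ x : ℤ → V, ρ.IsCyclicOrbit (bipartiteCoxeterElement cs β) h x ∧ Set.range x = o ∧
      Φ (x 0) ≠ 0 ∧ ∀ k, x k = ρ.act (bipartiteCoxeterElement cs β ^ k) (x 0) := by
  obtain ⟨y, hy, rfl⟩ := ho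
  set c := bipartiteCoxeterElement cs β with hc
  have hspan := span_orbit_eq_top (ρ := ρ) hconn hy
  obtain ⟨x0, hx0, hΦx0⟩ : ∃ a ∈ ρ.orbit ⊤ y, Φ a ≠ 0 := by
    by_contra hcon
    push Not at hcon
    apply hΦ.ne_zero
    have : Submodule.span ℝ (ρ.orbit ⊤ y) ≤ LinearMap.ker Φ := Submodule.span_le.2 hcon
    rw [hspan] at this
    exact LinearMap.ker_eq_top.1 (top_le_iff.1 this)
  set x : ℤ → V := fun k => ρ.act (c ^ k) x0 with hx
  have hprim := Complex.isPrimitiveRoot_exp h hh.ne'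
  have hx00 : x 0 = x0 := by simp [hx]
  have hdvd : ∀ k l, x k = x l → (h : ℤ) ∣ l - k := by
    intro k l e
    have e' := congrArg Φ e
    simp only [hx] at e'
    rw [hΦ.map_zpow, hΦ.map_zpow] at e'
    have e'' := mul_right_cancel₀ hΦx0 e'
    rw [← hprim.zpow_eq_one_iff_dvd, zpow_sub₀ (Complex.exp_ne_zero _), e'',
      div_self (zpow_ne_zero _ (Complex.exp_ne_zero _))]
  have hxo : ∀ k, x k ∈ ρ.orbit ⊤ y := fun k => act_mem_orbit _ hx0
  have hadd : ∀ k l, x (k + l) = ρ.act (c ^ k) (x l) := fun k l => by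
    simp only [hx]; rw [zpow_add, act_mul_apply]
  classical
  set F : Finset V := (Finset.Ico (0 : ℤ) h).image x with hF
  have hFcard : F.card = h := by
    rw [hF, Finset.card_image_of_injOn]
    · simp
    · intro k hk l hl e
      simp only [Finset.coe_Ico, Set.mem_Ico] at hk hl
      have := Int.eq_zero_of_abs_lt_dvd (hdvd k l e) (by rw [abs_lt]; constructor <;> omega)
      omega
  have hFo : (F : Set V) = ρ.orbit ⊤ y := by
    refine Set.eq_of_subset_of_ncard_le ?_ ?_ (orbit_finite _ _)
    · intro v hv
      rw [hF, Finset.mem_coe, Finset.mem_image] at hv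
      obtain ⟨k, -, rfl⟩ := hv
      exact hxo k
    · rw [Set.ncard_coe_finset, hFcard]; exact hcard
  have hmemF : ∀ v ∈ ρ.orbit ⊤ y, ∃ k : ℤ, 0 ≤ k ∧ k < h ∧ x k = v := by
    intro v hv
    rw [← hFo, hF, Finset.mem_coe, Finset.mem_image] at hv
    obtain ⟨k, hk, e⟩ := hv
    rw [Finset.mem_Ico] at hk
    exact ⟨k, hk.1, hk.2, e⟩
  -- `x h` equals some `x k` with `0 ≤ k < h`; comparing coordinates, `h` divides `h - k`, so `k =
  -- 0`.
  have hxh : x h = x 0 := by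
    obtain ⟨k, h1, h2, e⟩ := hmemF _ (hxo h)
    obtain ⟨m, hm⟩ := hdvd k h e
    have : (h : ℤ) ∣ k := ⟨1 - m, by rw [mul_sub, ← hm]; ring⟩
    have := Int.eq_zero_of_dvd_of_nonneg_of_lt h1 h2 this
    rw [← e, this]
  have hper : ∀ k, x (k + h) = x k := fun k => by rw [hadd, hxh, ← hadd, add_zero]
  have hper' : ∀ k m : ℤ, x (k + h * m) = x k := by
    intro k m
    induction m using Int.induction_on with
    | zero => simp
    | succ m ih => rw [mul_add, mul_one, ← add_assoc, hper, ih]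
    | pred m ih => rw [← hper, mul_sub, mul_one, add_assoc, sub_add_cancel, ih]
  have hrange : Set.range x = ρ.orbit ⊤ y := by
    apply Set.Subset.antisymm
    · rintro _ ⟨k, rfl⟩; exact hxo k
    · intro v hv
      obtain ⟨k, -, -, e⟩ := hmemF v hv
      exact ⟨k, e⟩
  refine ⟨x, ⟨hh, ?_, ?_, ?_, ?_⟩, hrange, ?_, ?_⟩
  · intro k
    rw [add_comm, hadd, zpow_one]
  · refine fun k l => ⟨hdvd k l, ?_⟩
    rintro ⟨m, hm⟩
    rw [show l = k + h * m by omega, hper']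
  · intro w k
    obtain ⟨l, -, -, e⟩ := hmemF _ (act_mem_orbit w (hxo k))
    exact ⟨l, e.symm⟩
  · rw [hrange, hspan]
  · rwa [hx00]
  · intro k
    rw [hx00]

/-- The coordinate on the Coxeter plane, rotated such that a given point becomes real. -/
theorem exists_polygon_coordinate {x : ℤ → V} (hΦ : ρ.IsPlaneCoordinate β h Φ) (h0 : Φ (x 0) ≠ 0)
    (hxk : ∀ k, x k = ρ.act (bipartiteCoxeterElement cs β ^ k) (x 0)) :
    ∃ φ : ρ.plane β →ₗᵢ[ℝ] ℂ, ∃ r : ℝ, 0 < r ∧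
      ∀ k : ℤ, φ (ρ.proj β (x k)) = r * Complex.exp (2 * Real.pi * Complex.I * k / h) := by
  set u : ℂ := (‖Φ (x 0)‖ : ℂ) / Φ (x 0) with hu
  have hu1 : ‖u‖ = 1 := by
    rw [hu, norm_div, Complex.norm_real, norm_norm, div_self (norm_ne_zero_iff.2 h0)]
  let φ0 : ρ.plane β →ₗ[ℝ] ℂ := (LinearMap.mulLeft ℝ u ∘ₗ Φ) ∘ₗ (ρ.plane β).subtype
  have hφ0 : ∀ v, φ0 v = u * Φ v := fun v => rfl
  refine ⟨⟨φ0, fun v => ?_⟩, ‖Φ (x 0)‖, norm_pos_iff.2 h0, fun k => ?_⟩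
  · rw [hφ0, norm_mul, hu1, one_mul, hΦ.norm_map v v.2]
    rfl
  · change φ0 _ = _
    rw [hφ0, hΦ.map_proj, hxk, hΦ.map_zpow, hu, ← Complex.exp_int_mul,
      show (k : ℂ) * (2 * Real.pi * Complex.I / h) = 2 * Real.pi * Complex.I * k / h by ring]
    field_simp

namespace IsCyclicOrbit

variable {x : ℤ → V} (hx : ρ.IsCyclicOrbit (bipartiteCoxeterElement cs β) h x)
include hx

omit [FiniteDimensional ℝ V] in
theorem coxeterNumber_eq : coxeterNumber cs β = h := by
  set c := bipartiteCoxeterElement cs β with hc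
  have hpow : ∀ (n : ℕ) k, ρ.act (c ^ n) (x k) = x (k + n) := by
    intro n
    induction n with
    | zero => intro k; simp
    | succ n ih =>
      intro k
      rw [pow_succ, act_mul_apply, hx.act_succ, ih]
      congr 1; push_cast; ring
  apply Nat.dvd_antisymm
  · rw [coxeterNumber, orderOf_dvd_iff_pow_eq_one]
    refine ρ.eq_of_act_eq fun v => ?_
    have hle : Submodule.span ℝ (Set.range x) ≤ fixedSpace (ρ.act (c ^ h)) := by
      rw [Submodule.span_le]
      rintro _ ⟨k, rfl⟩
      change ρ.act (c ^ h) (x k) = x k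
      rw [hpow, hx.apply_add]
    rw [act_one_apply]
    exact hle (hx.span_eq ▸ Submodule.mem_top)
  · have h1 := hpow (orderOf c) 0
    rw [pow_orderOf_eq_one, act_one_apply] at h1
    have h2 := (hx.eq_iff _ _).1 h1
    rw [zero_add, sub_zero] at h2
    exact_mod_cast h2

theorem projectsToPolygon {φ : ρ.plane β →ₗᵢ[ℝ] ℂ} {r : ℝ} (hr : 0 < r)
    (hp : ∀ k : ℤ, φ (ρ.proj β (x k)) = r * Complex.exp (2 * Real.pi * Complex.I * k / h))
    (hxk : ∀ k, x k = ρ.act (bipartiteCoxeterElement cs β ^ k) (x 0)) :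
    ρ.ProjectsToPolygon β (Set.range x) := by
  refine ⟨?_, φ, r, hr, x 0, ⟨0, rfl⟩, ?_, ?_⟩
  · rintro _ ⟨k, rfl⟩ _ ⟨l, rfl⟩ e
    have e' := congrArg φ e
    rw [hp, hp] at e'
    have e'' := mul_left_cancel₀ (by exact_mod_cast hr.ne') e'
    rw [hx.eq_iff, ← (Complex.isPrimitiveRoot_exp h hx.pos.ne').zpow_eq_one_iff_dvd,
      zpow_sub₀ (Complex.exp_ne_zero _), ← Complex.exp_int_mul, ← Complex.exp_int_mul,
      show (k : ℂ) * (2 * Real.pi * Complex.I / h) = 2 * Real.pi * Complex.I * k / h by ring,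
      show (l : ℂ) * (2 * Real.pi * Complex.I / h) = 2 * Real.pi * Complex.I * l / h by ring, e'',
      div_self (Complex.exp_ne_zero _)]
  · ext v
    constructor
    · rintro ⟨k, rfl⟩
      obtain ⟨l, h1, -, e⟩ := hx.exists_mem_window 0 k
      refine ⟨l.toNat, ?_⟩
      rw [← e, hxk l, ← zpow_natCast, Int.toNat_of_nonneg h1]
    · rintro ⟨k, rfl⟩
      exact ⟨k, by rw [hxk, zpow_natCast]⟩
  · intro k
    rw [hx.coxeterNumber_eq, ← zpow_natCast, ← hxk, hp]
    push_cast
    rfl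

end IsCyclicOrbit
end Realization
end CoxeterPlane

namespace CoxeterPlane
open scoped InnerProductSpace
open Module (finrank)
namespace Realization

variable {B W V : Type*} [Group W] {M : CoxeterMatrix B} {cs : CoxeterSystem M W}
  [NormedAddCommGroup V] [InnerProductSpace ℝ V] {ρ : Realization cs V}

/-! ### Linear relations between consecutive points of a cyclic orbit -/

namespace IsCyclicOrbit

section Window
variable {c : W} {h : ℕ} {x : ℤ → V} (hx : ρ.IsCyclicOrbit c h x) [FiniteDimensional ℝ V]
include hx

/-- By Cayley-Hamilton every `x (j + n)` is a combination of the `n` preceding points, so a window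
of `n` points spans all later ones, and periodicity gives the rest. -/
theorem span_window (i : ℤ) :
    Submodule.span ℝ (Set.range fun p : Fin (finrank ℝ V) => x (i + p)) = ⊤ := by
  set n := finrank ℝ V with hn
  set S := Submodule.span ℝ (Set.range fun p : Fin n => x (i + p)) with hS
  let f : V →ₗ[ℝ] V := (ρ.act c).toLinearEquiv.toLinearMap
  have hf : ∀ (k : ℕ) j, (f ^ k) (x j) = x (j + k) := by
    intro k
    induction k with
    | zero => intro j; simp
    | succ k ih =>
      intro j
      rw [pow_succ', Module.End.mul_apply, ih]
      change ρ.act c _ = _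
      rw [hx.act_succ]
      congr 1; push_cast; ring
  have hrec : ∀ j, x (j + n) = -∑ k ∈ Finset.range n, f.charpoly.coeff k • x (j + k) := by
    intro j
    have h1 := congrArg (fun g : V →ₗ[ℝ] V => g (x j)) f.aeval_self_charpoly
    simp only [Polynomial.aeval_eq_sum_range, LinearMap.charpoly_natDegree,
      LinearMap.zero_apply, LinearMap.sum_apply, LinearMap.smul_apply, hf] at h1
    rw [Finset.sum_range_succ, ← hn] at h1
    have h2 : f.charpoly.coeff n = 1 := by
      have := f.charpoly_monic.coeff_natDegree
      rwa [LinearMap.charpoly_natDegree] at this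
    rw [h2, one_smul] at h1
    exact eq_neg_of_add_eq_zero_right h1
  have hmem : ∀ m : ℕ, x (i + m) ∈ S := by
    intro m
    induction m using Nat.strong_induction_on with
    | _ m ih =>
    by_cases hm : m < n
    · exact Submodule.subset_span ⟨⟨m, hm⟩, rfl⟩
    · obtain ⟨d, rfl⟩ := Nat.exists_eq_add_of_le (not_lt.1 hm)
      rw [show i + ((n + d : ℕ) : ℤ) = i + d + n by push_cast; ring, hrec]
      refine Submodule.neg_mem _ (Submodule.sum_mem _ fun k hk => Submodule.smul_mem _ _ ?_)
      have := ih (d + k) (by have := Finset.mem_range.1 hk; omega)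
      rwa [Nat.cast_add, ← add_assoc] at this
  rw [eq_top_iff, ← hx.span_eq, Submodule.span_le]
  rintro _ ⟨k, rfl⟩
  obtain ⟨l, h1, -, e⟩ := hx.exists_mem_window i k
  have := hmem (l - i).toNat
  rwa [Int.toNat_of_nonneg (by omega), add_sub_cancel, e] at this

/-- The dual basis of a window of `dim V` consecutive points. -/
theorem exists_dual (i p : ℤ) (hp : i ≤ p) (hp' : p < i + finrank ℝ V) :
    ∃ δ : V →ₗ[ℝ] ℝ, δ (x p) = 1 ∧ ∀ m, i ≤ m → m < i + finrank ℝ V → m ≠ p → δ (x m) = 0 := by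
  let b := basisOfTopLeSpanOfCardEqFinrank (fun p : Fin (finrank ℝ V) => x (i + p))
    (hx.span_window i).ge (by simp)
  have hb : ∀ q : Fin (finrank ℝ V), b q = x (i + q) := fun q => by
    simp [b]
  have hb' : ∀ m, i ≤ m → ∀ hm : m < i + finrank ℝ V, x m = b ⟨(m - i).toNat, by omega⟩ := by
    intro m h1 h2
    rw [hb]
    congr 1
    simp only
    omega
  refine ⟨b.coord ⟨(p - i).toNat, by omega⟩, ?_, fun m h1 h2 hne => ?_⟩
  · rw [hb' p hp hp', Module.Basis.coord_apply, Module.Basis.repr_self, Finsupp.single_eq_same]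
  · rw [hb' m h1 h2, Module.Basis.coord_apply, Module.Basis.repr_self, Finsupp.single_eq_of_ne]
    intro e
    rw [Fin.mk.injEq] at e
    omega

end Window

end IsCyclicOrbit

theorem exists_smul_of_isReflection {t : W} (ht : cs.IsReflection t) {a : V} (ha : ρ.act t a ≠ a)
    (d : V) : ∃ r : ℝ, d - ρ.act t d = r • (a - ρ.act t a) :=
  ⟨_, by rw [ρ.act_eq_of_isReflection ht rfl ha.symm d, sub_sub_cancel]⟩

namespace IsCyclicOrbit

variable {c : W} {h : ℕ} {x : ℤ → V} (hx : ρ.IsCyclicOrbit c h x) [FiniteDimensional ℝ V]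
include hx

/-! ### Orbits with one more element than the dimension -/

section Simplex
variable (hn : h = finrank ℝ V + 1)
include hn

/-- Omitting `f` leaves `dim V` consecutive points, a basis; `δ` is the coordinate at `d`, and the
relation that all points add up to zero gives its value at `f`. -/
theorem exists_dual_sub {d f : V} (hd : d ∈ Set.range x) (hf : f ∈ Set.range x) (hne : d ≠ f) :
    ∃ δ : V →ₗ[ℝ] ℝ, δ d = 1 ∧ δ f = -1 ∧ ∀ a ∈ Set.range x, a ≠ d → a ≠ f → δ a = 0 := by
  obtain ⟨k, rfl⟩ := hf
  obtain ⟨k', rfl⟩ := hd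
  obtain ⟨p, h1, h2, e⟩ := hx.exists_mem_window k k'
  rw [← e] at hne ⊢
  have hpk : p ≠ k := fun e => hne (by rw [e])
  obtain ⟨δ, hδ, hδ'⟩ := hx.exists_dual (k + 1) p (by omega) (by omega)
  refine ⟨δ, hδ, ?_, ?_⟩
  · have h3 := hx.arcSum_window k
    rw [← arcSum_add_arcSum x (show k ≤ k + 1 by omega) (show k + 1 ≤ k + h by omega),
      arcSum_succ] at h3
    have h4 := congrArg δ h3
    rw [map_add, map_zero, arcSum, map_sum, Finset.sum_eq_single p, hδ] at h4
    · linarith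
    · intro m hm hne
      rw [Finset.mem_Ico] at hm
      exact hδ' m hm.1 (by omega) hne
    · intro hp
      rw [Finset.mem_Ico] at hp
      omega
  · rintro _ ⟨m, rfl⟩ hmp hmk
    obtain ⟨q, h3, h4, e⟩ := hx.exists_mem_window k m
    rw [← e] at hmp hmk ⊢
    refine hδ' q ?_ (by omega) fun e => hmp (by rw [e])
    have : q ≠ k := fun e => hmk (by rw [e])
    omega

/-- Since `3 ≤ h` there is a point `p` other than `±x k`; a functional equal to `1` at `x k`, `-1`
at `p` and `0` at the other points would vanish at `-x k`. -/
theorem neg_notMem_of_eq_finrank_add_one (hh : 3 ≤ h) {a : V} (ha : a ∈ Set.range x) :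
    -a ∉ Set.range x := by
  intro hna
  obtain ⟨k, rfl⟩ := ha
  have hx0 := hx.ne_zero (by omega) k
  obtain ⟨p, hp⟩ : ∃ p, x p ≠ x k ∧ x p ≠ -x k := by
    by_contra hcon
    push Not at hcon
    have h1 : x (k + 1) ≠ x k := fun e => by
      have := (hx.eq_iff _ _).1 e
      have := Int.eq_zero_of_abs_lt_dvd this (by rw [abs_lt]; constructor <;> omega)
      omega
    have h2 : x (k + 2) ≠ x k := fun e => by
      have := (hx.eq_iff _ _).1 e
      have := Int.eq_zero_of_abs_lt_dvd this (by rw [abs_lt]; constructor <;> omega)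
      omega
    have h3 : x (k + 1) = x (k + 2) := by rw [hcon _ h1, hcon _ h2]
    have := (hx.eq_iff _ _).1 h3
    have := Int.eq_zero_of_abs_lt_dvd this (by rw [abs_lt]; constructor <;> omega)
    omega
  obtain ⟨δ, h1, -, h3⟩ := hx.exists_dual_sub hn ⟨k, rfl⟩ ⟨p, rfl⟩ hp.1.symm
  have h3 := h3 _ hna
  have h4 : -x k ≠ x k := fun e => hx0 <| by
    have h4 : (2 : ℝ) • x k = 0 := by
      rw [two_smul]
      nth_rewrite 1 [← e]
      exact neg_add_cancel _
    simpa using h4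
  have h5 := h3 h4 hp.2.symm
  rw [map_neg, h1] at h5
  norm_num at h5

/-- If `t` moved `d` as well, `d - t d` would be a multiple of `a - t a`; the functional equal to
`1` at `d`, `-1` at `t d` and `0` at `a`, `t a` rules this out. -/
theorem fewMoved_of_eq_finrank_add_one : ρ.FewMoved (Set.range x) := by
  intro t ht a ha hta d hd h1 _ h3 _
  by_contra hne
  obtain ⟨r, hr⟩ := exists_smul_of_isReflection ht hta d
  obtain ⟨δ, e1, e2, e3⟩ := hx.exists_dual_sub hn hd (hx.act_mem_range t d hd) (Ne.symm hne)
  have e4 := e3 a ha (Ne.symm h1) fun e => h3 (by rw [e, act_act_of_isReflection _ ht])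
  have e5 := e3 _ (hx.act_mem_range t a ha) (Ne.symm h3) fun e => h1 ((ρ.act t).injective e.symm)
  have := congrArg δ hr
  rw [map_smul, map_sub, map_sub, e1, e2, e4, e5] at this
  norm_num at this

end Simplex

/-! ### Centrally symmetric orbits of twice as many elements as the dimension -/

section CrossPolytope
variable (hn : h = 2 * finrank ℝ V) (hneg : ∀ k, x (k + finrank ℝ V) = -x k)
include hn hneg

/-- A half period is a basis and the other half consists of its negatives. -/
theorem exists_dual_neg {d : V} (hd : d ∈ Set.range x) :
    ∃ δ : V →ₗ[ℝ] ℝ, δ d = 1 ∧ ∀ a ∈ Set.range x, a ≠ d → a ≠ -d → δ a = 0 := by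
  obtain ⟨k, rfl⟩ := hd
  have := hx.pos
  obtain ⟨δ, hδ, hδ'⟩ := hx.exists_dual k k le_rfl (by omega)
  refine ⟨δ, hδ, ?_⟩
  rintro _ ⟨m, rfl⟩ h1 h2
  obtain ⟨q, h3, h4, e⟩ := hx.exists_mem_window k m
  rw [← e] at h1 h2 ⊢
  have hqk : q ≠ k := fun e => h1 (by rw [e])
  by_cases hq : q < k + finrank ℝ V
  · exact hδ' q h3 hq hqk
  · have e5 : x q = -x (q - finrank ℝ V) := by rw [← hneg, sub_add_cancel]
    rw [e5, map_neg, hδ' _ (by omega) (by omega), neg_zero]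
    intro e6
    exact h2 (by rw [e5, e6])

theorem fewMoved_of_eq_two_mul_finrank : ρ.FewMoved (Set.range x) := by
  intro t ht a ha hta d hd h1 h2 h3 h4
  by_contra hne
  obtain ⟨r, hr⟩ := exists_smul_of_isReflection ht hta d
  obtain ⟨δ, e1, e2⟩ := hx.exists_dual_neg hn hneg hd
  have e4 := e2 a ha (Ne.symm h1) fun e => h2 (by rw [e, neg_neg])
  have e5 := e2 _ (hx.act_mem_range t a ha) (Ne.symm h3) fun e => h4 (by rw [e, neg_neg])
  have e6 := congrArg δ hr
  rw [map_smul, map_sub, map_sub, e1, e4, e5, sub_self, smul_zero] at e6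
  by_cases h7 : ρ.act t d = -d
  · rw [h7, map_neg, e1] at e6; norm_num at e6
  · rw [e2 _ (hx.act_mem_range t d hd) hne h7] at e6; norm_num at e6

end CrossPolytope

end IsCyclicOrbit

/-! ### Parabolic subgroups are closed -/

theorem reflectionClosed_map_conj {W' : Subgroup W} (hW' : ρ.ReflectionClosed W') (w : W) :
    ρ.ReflectionClosed (W'.map (MulAut.conj w).toMonoidHom) := by
  intro t ht hfix
  have h1 : w⁻¹ * t * w⁻¹⁻¹ ∈ W' := by
    refine hW' _ (ht.conj w⁻¹) fun v hv => ?_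
    have h2 : ρ.act w v ∈ ρ.fixed (W'.map (MulAut.conj w).toMonoidHom) := by
      rintro _ ⟨g, hg, rfl⟩
      change ρ.act (w * g * w⁻¹) _ = _
      rw [act_mul_apply, act_inv_act, act_mul_apply, hv g hg]
    rw [act_mul_apply, act_mul_apply, inv_inv, hfix _ h2, act_inv_act]
  refine ⟨_, h1, ?_⟩
  change w * _ * w⁻¹ = t
  group

theorem le_closure_of_isParabolic {W' : Subgroup W} (hW' : IsParabolic cs W') :
    W' ≤ Subgroup.closure {t | cs.IsReflection t ∧ t ∈ W'} := by
  obtain ⟨J, w, rfl⟩ := hW'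
  rw [MonoidHom.map_closure, Subgroup.closure_le]
  rintro _ ⟨_, ⟨i, hi, rfl⟩, rfl⟩
  refine Subgroup.subset_closure ⟨(cs.isReflection_simple i).conj w, ?_⟩
  exact Subgroup.subset_closure ⟨_, ⟨i, hi, rfl⟩, rfl⟩

theorem isReflection_of_mem_image {J : Set B} : ∀ t ∈ cs.simple '' J, cs.IsReflection t := by
  rintro _ ⟨i, -, rfl⟩
  exact cs.isReflection_simple i

namespace IsCyclicOrbit

variable {c : W} {h : ℕ} {x : ℤ → V} (hx : ρ.IsCyclicOrbit c h x)
include hx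

/-- The sum of the `W'`-translates of `a` is fixed by `W'`, hence orthogonal to `a - b`. If neither
`b` nor `-a` were a translate, every term of this inner product would be nonnegative and the term of
the identity positive. -/
theorem act_ne_neg_of_fixed_of_act_ne [Finite W] (hT : ρ.ReflectionTransitive x)
    (ho : ρ.FewMoved (Set.range x)) {W' : Subgroup W} {a b : V} (ha : a ∈ Set.range x)
    (hb : b ∈ Set.range x) (hne : a ≠ b) (hab : a - b ∈ (ρ.fixed W')ᗮ)
    (h1 : ∀ g ∈ W', ρ.act g a ≠ b) : ∃ g ∈ W', ρ.act g a = -a := by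
  by_contra hcon
  push Not at hcon
  have := Fintype.ofFinite W'
  obtain ⟨k, rfl⟩ := ha
  obtain ⟨l, rfl⟩ := hb
  have hv : ∑ g : W', ρ.act (g : W) (x k) ∈ ρ.fixed W' := by
    intro w hw
    rw [map_sum]
    refine Fintype.sum_equiv (Equiv.mulLeft ⟨w, hw⟩) _ _ fun g => ?_
    rw [← act_mul_apply]
    rfl
  have h2 := Submodule.inner_left_of_mem_orthogonal hv hab
  rw [inner_sum] at h2
  have hpos := hx.inner_sub_pos hne
  have hterm : ∀ g : W', 0 ≤ ⟪x k - x l, ρ.act (g : W) (x k)⟫_ℝ := by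
    intro g
    obtain ⟨m, hm⟩ := hx.exists_act g k
    rw [hm]
    by_cases e1 : x m = x k
    · rw [e1]; exact hpos.le
    have e2 : x m ≠ -x k := fun e => hcon g g.2 (by rw [hm, e])
    have e3 : x m ≠ x l := fun e => h1 g g.2 (by rw [hm, e])
    by_cases e4 : x m = -x l
    · have := hx.inner_sub_pos hne.symm
      rw [e4, inner_neg_right, ← inner_neg_left, neg_sub]
      exact this.le
    exact (inner_sub_eq_zero hT ho hne e1 e2 e3 e4).ge
  have h3 := (Finset.sum_eq_zero_iff_of_nonneg fun g _ => hterm g).1 h2 1 (Finset.mem_univ _)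
  rw [Subgroup.coe_one, act_one_apply] at h3
  exact hpos.ne' h3

/-- Let `t` move `x k` to `x l`. If the subgroup did not link them, the averaging lemma would link
each of them to its antipode, and `hlink` would link them to each other. So they are linked, and a
reflection of the subgroup with the same effect must be `t`. -/
theorem reflectionClosed_closure [Finite W] (hT : ρ.ReflectionTransitive x)
    (ho : ρ.FewMoved (Set.range x)) {R : Set W} (hR : ∀ t ∈ R, cs.IsReflection t)
    (hneg : ∀ a ∈ Set.range x, ∀ γ ∈ Subgroup.closure R, ρ.act γ a = -a →
      ∃ t ∈ Subgroup.closure R, cs.IsReflection t ∧ ρ.act t a = -a)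
    (hlink : ∀ a ∈ Set.range x, ∀ b ∈ Set.range x, (∃ γ ∈ Subgroup.closure R, ρ.act γ a = -a) →
      (∃ γ ∈ Subgroup.closure R, ρ.act γ b = -b) → ∃ γ ∈ Subgroup.closure R, ρ.act γ a = b) :
    ρ.ReflectionClosed (Subgroup.closure R) := by
  intro t ht hfix
  obtain ⟨k, hk⟩ := hx.exists_act_ne ht
  obtain ⟨l, hl⟩ := hx.exists_act t k
  rw [hl] at hk
  have hab : x k - x l ∈ (ρ.fixed (Subgroup.closure R))ᗮ := by
    intro u hu
    rw [real_inner_comm]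
    exact ρ.inner_eq_zero_of_act_eq_self hl (hfix u hu)
  obtain ⟨γ, hγ, e⟩ : ∃ γ ∈ Subgroup.closure R, ρ.act γ (x k) = x l := by
    by_contra hcon
    push Not at hcon
    have h1 := hx.act_ne_neg_of_fixed_of_act_ne hT ho ⟨k, rfl⟩ ⟨l, rfl⟩ hk.symm hab hcon
    have h2 := hx.act_ne_neg_of_fixed_of_act_ne hT ho ⟨l, rfl⟩ ⟨k, rfl⟩ hk
      (by rw [← neg_sub]; exact Submodule.neg_mem _ hab)
      (fun g hg e => hcon g⁻¹ (inv_mem hg) (ρ.act_inv_eq e))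
    obtain ⟨γ, hγ, e⟩ := hlink _ ⟨k, rfl⟩ _ ⟨l, rfl⟩ h1 h2
    exact hcon γ hγ e
  obtain ⟨t', ht', hr, e'⟩ := exists_reflection_of_mem_closure hx.act_mem_range ho hR hneg hγ
    ⟨k, rfl⟩ (by rw [e]; exact hk)
  rw [eq_of_isReflection_of_act_eq ht hr hl (e'.trans e) hk.symm]
  exact ht'

theorem act_zpow (m k : ℤ) : ρ.act (c ^ m) (x k) = x (k + m) := by
  induction m using Int.induction_on with
  | zero => simp
  | succ m ih => rw [add_comm (m : ℤ), zpow_one_add, act_mul_apply, ih, hx.act_succ,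
      add_assoc, add_comm (m : ℤ)]
  | pred m ih =>
    apply (ρ.act c).injective
    rw [← act_mul_apply, ← zpow_one_add, hx.act_succ, show (1 : ℤ) + (-m - 1) = -m by ring, ih]
    congr 1; ring

/-- A power of `c` moves `x k` to `x l`, and `exists_reflection_of_mem_closure` replaces it by a
reflection. -/
theorem reflectionTransitive_of_fewMoved (ho : ρ.FewMoved (Set.range x))
    (hneg : ∀ a ∈ Set.range x, -a ∈ Set.range x → ∃ t, cs.IsReflection t ∧ ρ.act t a = -a) :
    ρ.ReflectionTransitive x := by
  intro k l hne
  have htop : Subgroup.closure (Set.range cs.simple) = ⊤ := cs.subgroup_closure_range_simple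
  have hc : ρ.act (c ^ (l - k)) (x k) = x l := by
    rw [hx.act_zpow, add_sub_cancel]
  obtain ⟨t, -, ht, e⟩ := exists_reflection_of_mem_closure (ρ := ρ) hx.act_mem_range ho
    (R := Set.range cs.simple) (by rintro _ ⟨i, rfl⟩; exact cs.isReflection_simple i)
    (fun a ha γ _ e => by
      obtain ⟨t, ht, e'⟩ := hneg a ha (e ▸ hx.act_mem_range γ a ha)
      exact ⟨t, htop ▸ Subgroup.mem_top t, ht, e'⟩)
    (γ := c ^ (l - k)) (htop ▸ Subgroup.mem_top _) ⟨k, rfl⟩ (by rw [hc]; exact hne.symm)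
  exact ⟨t, ht, e.trans hc⟩

end IsCyclicOrbit

end Realization
end CoxeterPlane

/-! ### Sign changes in type B; the equivalence for simplices and cross-polytopes -/

namespace CoxeterPlane
open scoped InnerProductSpace
open Module (finrank)
namespace Realization

variable {B W V : Type*} [Group W] {M : CoxeterMatrix B} {cs : CoxeterSystem M W}
  [NormedAddCommGroup V] [InnerProductSpace ℝ V] {ρ : Realization cs V}

/-- The factor `2` is chosen so that the simple reflection at `i` takes `ω` to `ω - root i`; the
other simple reflections fix `ω`. -/
theorem exists_dual_root [FiniteDimensional ℝ V] (hlin : LinearIndependent ℝ ρ.root) (i : B) :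
    ∃ ω, 2 * ⟪ρ.root i, ω⟫_ℝ = 1 ∧ ∀ j, j ≠ i → ⟪ρ.root j, ω⟫_ℝ = 0 := by
  set S := Submodule.span ℝ (ρ.root '' {j | j ≠ i}) with hS
  have hi : ρ.root i ∉ S := hlin.notMem_span_image (by simp)
  have hne : Sᗮ ≠ ⊥ := by
    rw [Ne, Submodule.orthogonal_eq_bot_iff]
    intro h
    exact hi (h ▸ Submodule.mem_top)
  obtain ⟨u, hu, hu0⟩ := Submodule.exists_mem_ne_zero_of_ne_bot hne
  have hu' : ∀ j, j ≠ i → ⟪ρ.root j, u⟫_ℝ = 0 := fun j hj =>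
    hu _ (Submodule.subset_span ⟨j, hj, rfl⟩)
  have hui : ⟪ρ.root i, u⟫_ℝ ≠ 0 := by
    intro h
    refine hu0 (ρ.eq_zero_of_inner_root fun j => ?_)
    by_cases hj : j = i
    · rw [hj, h]
    · exact hu' j hj
  refine ⟨(2 * ⟪ρ.root i, u⟫_ℝ)⁻¹ • u, ?_, fun j hj => ?_⟩
  · rw [inner_smul_right]; field_simp
  · rw [inner_smul_right, hu' j hj, mul_zero]

/-- The permutation action on an invariant set. -/
def permHom (o : Set V) (hW : ∀ w, ∀ a ∈ o, ρ.act w a ∈ o) : W →* Equiv.Perm o where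
  toFun w :=
    { toFun := fun a => ⟨ρ.act w a, hW w a a.2⟩
      invFun := fun a => ⟨ρ.act w⁻¹ a, hW w⁻¹ a a.2⟩
      left_inv := fun a => Subtype.ext (ρ.act_inv_act w a)
      right_inv := fun a => Subtype.ext (ρ.act_act_inv w a) }
  map_one' := Equiv.ext fun a => Subtype.ext (ρ.act_one_apply a)
  map_mul' u w := Equiv.ext fun a => Subtype.ext (ρ.act_mul_apply u w a)

theorem permHom_apply {o : Set V} (hW : ∀ w, ∀ a ∈ o, ρ.act w a ∈ o) (w : W) (a : o) :
    (permHom o hW w a : V) = ρ.act w a := rfl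

open Classical in
-- Such a reflection acts as the double transposition `(a b)(-a -b)`.
theorem sign_permHom_eq_one {o : Set V} [Fintype o] (hW : ∀ w, ∀ a ∈ o, ρ.act w a ∈ o)
    (ho : ρ.FewMoved o) (hneg : ∀ a ∈ o, -a ∈ o) (h0 : (0 : V) ∉ o) {t : W}
    (ht : cs.IsReflection t) {a : V} (ha : a ∈ o) (hta : ρ.act t a ≠ a) (hta' : ρ.act t a ≠ -a) :
    Equiv.Perm.sign (permHom o hW t) = 1 := by
  set b := ρ.act t a with hb
  have hbo : b ∈ o := hW t a ha
  have htb : ρ.act t b = a := act_act_of_isReflection _ ht a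
  have hself : ∀ v ∈ o, v ≠ -v := by
    intro v hv e
    have h4 : (2 : ℝ) • v = 0 := by
      rw [two_smul]
      nth_rewrite 2 [e]
      exact add_neg_cancel _
    have : v = 0 := by simpa using h4
    exact h0 (this ▸ hv)
  have hba : b ≠ a := hta
  have hba' : b ≠ -a := hta'
  have hab' : a ≠ -b := fun e => hba' (by rw [e, neg_neg])
  have key : permHom o hW t =
      Equiv.swap ⟨a, ha⟩ ⟨b, hbo⟩ * Equiv.swap ⟨-a, hneg a ha⟩ ⟨-b, hneg b hbo⟩ := by
    ext ⟨v, hv⟩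
    rw [permHom_apply, Equiv.Perm.mul_apply]
    by_cases h1 : v = a
    · subst h1
      rw [Equiv.swap_apply_of_ne_of_ne (a := (⟨-v, hneg v hv⟩ : o)), Equiv.swap_apply_left]
      · exact fun e => hself v hv (congrArg Subtype.val e)
      · exact fun e => hab' (congrArg Subtype.val e)
    by_cases h2 : v = b
    · subst h2
      rw [Equiv.swap_apply_of_ne_of_ne (a := (⟨-a, hneg a ha⟩ : o)), Equiv.swap_apply_right]
      · exact htb
      · exact fun e => hba' (congrArg Subtype.val e)
      · exact fun e => hself _ hv (congrArg Subtype.val e)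
    by_cases h3 : v = -a
    · subst h3
      rw [Equiv.swap_apply_left, Equiv.swap_apply_of_ne_of_ne]
      · change ρ.act t (-a) = -b
        rw [map_neg]
      · exact fun e => hab' (congrArg Subtype.val e).symm
      · exact fun e => hself b hbo (congrArg Subtype.val e).symm
    by_cases h4 : v = -b
    · subst h4
      rw [Equiv.swap_apply_right, Equiv.swap_apply_of_ne_of_ne]
      · change ρ.act t (-b) = -a
        rw [map_neg, htb]
      · exact fun e => hself a ha (congrArg Subtype.val e).symm
      · exact fun e => hba' (congrArg Subtype.val e).symm
    rw [Equiv.swap_apply_of_ne_of_ne (a := (⟨-a, hneg a ha⟩ : o)), Equiv.swap_apply_of_ne_of_ne]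
    · exact ho t ht a ha hta v hv h1 h3 h2 h4
    all_goals exact fun e => by first
      | exact h1 (congrArg Subtype.val e)
      | exact h2 (congrArg Subtype.val e)
      | exact h3 (congrArg Subtype.val e)
      | exact h4 (congrArg Subtype.val e)
  rw [key, map_mul, Equiv.Perm.sign_swap, Equiv.Perm.sign_swap]
  · norm_num
  · exact fun e => hba (neg_injective (congrArg Subtype.val e)).symm
  · exact fun e => hba (congrArg Subtype.val e).symm

namespace IsCyclicOrbit

variable {c : W} {h : ℕ} {x : ℤ → V} (hx : ρ.IsCyclicOrbit c h x)
include hx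

open Classical in
theorem sign_permHom_self [Fintype (Set.range x)] (hh : 2 ≤ h) (heven : Even h) :
    Equiv.Perm.sign (permHom (Set.range x) hx.act_mem_range c) = -1 := by
  set f := permHom (Set.range x) hx.act_mem_range c with hf
  have hne : ∀ a, f a ≠ a := by
    rintro ⟨_, k, rfl⟩ e
    have e' := congrArg Subtype.val e
    rw [hf, permHom_apply, hx.act_succ, hx.eq_iff] at e'
    have := Int.eq_zero_of_abs_lt_dvd e' (by rw [abs_lt]; constructor <;> omega)
    omega
  have hcyc : f.IsCycle := by
    refine ⟨⟨x 0, 0, rfl⟩, hne _, ?_⟩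
    rintro ⟨_, k, rfl⟩ -
    refine ⟨k, Subtype.ext ?_⟩
    rw [hf, ← map_zpow, permHom_apply, hx.act_zpow, zero_add]
  have hsupp : f.support = Finset.univ := by
    ext a; simp [hne a]
  have hcard : Fintype.card (Set.range x) = h := by
    rw [← hx.ncard_range, ← Nat.card_coe_set_eq, Nat.card_eq_fintype_card]
  rw [hcyc.sign, hsupp, Finset.card_univ, hcard, heven.neg_one_pow]

variable [FiniteDimensional ℝ V] (hn : h = 2 * finrank ℝ V)
  (hneg : ∀ k, x (k + finrank ℝ V) = -x k)
include hn hneg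

/-- Parity: if no simple reflection negated a point, all of them would act by even permutations,
whereas `c` acts as one cycle of even length. -/
theorem exists_simple_act_eq_neg : ∃ i k, ρ.act (cs.simple i) (x k) = -x k := by
  classical
  by_contra hcon
  push Not at hcon
  have hpos := hx.pos
  have hh : 2 ≤ h := by omega
  have hfin : (Set.range x).Finite := Set.finite_of_ncard_pos (by rw [hx.ncard_range]; omega)
  have := hfin.fintype
  have hall : ∀ w, Equiv.Perm.sign (permHom (Set.range x) hx.act_mem_range w) = 1 := by
    intro w
    induction w using cs.simple_induction with
    | one => rw [map_one, map_one]
    | mul u w hu hw => rw [map_mul, map_mul, hu, hw, mul_one]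
    | simple i =>
      obtain ⟨k, hk⟩ := hx.exists_act_ne (cs.isReflection_simple i)
      refine sign_permHom_eq_one _ (hx.fewMoved_of_eq_two_mul_finrank hn hneg) ?_ ?_
        (cs.isReflection_simple i) ⟨k, rfl⟩ hk (hcon i k)
      · rintro _ ⟨l, rfl⟩
        exact ⟨_, hneg l⟩
      · rintro ⟨l, e⟩
        exact hx.ne_zero hh l e
  have h1 := hx.sign_permHom_self hh (hn ▸ even_two_mul _)
  rw [hall] at h1
  exact absurd h1 (by decide)

theorem exists_reflection_act_eq_neg (a : V) (ha : a ∈ Set.range x) :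
    ∃ t, cs.IsReflection t ∧ ρ.act t a = -a := by
  obtain ⟨i, k, hi⟩ := hx.exists_simple_act_eq_neg hn hneg
  obtain ⟨l, rfl⟩ := ha
  have e : ρ.act (c ^ (l - k)) (x k) = x l := by rw [hx.act_zpow, add_sub_cancel]
  refine ⟨c ^ (l - k) * cs.simple i * (c ^ (l - k))⁻¹, (cs.isReflection_simple i).conj _, ?_⟩
  rw [act_mul_apply, act_mul_apply, ρ.act_inv_eq e, hi, map_neg, e]

theorem reflectionTransitive_of_eq_two_mul_finrank : ρ.ReflectionTransitive x :=
  hx.reflectionTransitive_of_fewMoved (hx.fewMoved_of_eq_two_mul_finrank hn hneg) fun a ha _ =>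
    hx.exists_reflection_act_eq_neg hn hneg a ha

/-- Pair with the dual vector `ω` of the root `i`. Simple reflections other than the one at `i`
preserve `⟪ω, ·⟫`, and the one at `i` moves only `±e` and changes the sign there; so the absolute
value is constant on the orbit, and nonzero. Taking `a` to `-a` flips the sign, which forces `i ∈ J`
and a passage through `±e`. -/
theorem exists_mem_closure_act_eq (hlin : LinearIndependent ℝ ρ.root) {i : B} {e : V}
    (he : e ∈ Set.range x) (hi : ρ.act (cs.simple i) e = -e) (J : Set B) {a : V}
    (ha : a ∈ Set.range x) {γ : W} (hγ : γ ∈ Subgroup.closure (cs.simple '' J))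
    (hγa : ρ.act γ a = -a) :
    i ∈ J ∧ ∃ g ∈ Subgroup.closure (cs.simple '' J), ρ.act g a = e := by
  have hpos := hx.pos
  have hh : 2 ≤ h := by omega
  have ho := hx.fewMoved_of_eq_two_mul_finrank hn hneg
  obtain ⟨ω, hω, hω'⟩ := exists_dual_root hlin i
  have hself : ρ.act (cs.simple i) e ≠ e := by
    intro e'
    have h4 : (2 : ℝ) • e = 0 := by
      rw [two_smul]
      nth_rewrite 2 [← e']
      rw [hi]
      exact add_neg_cancel _
    obtain ⟨k, rfl⟩ := he
    exact hx.ne_zero hh k (by simpa using h4)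
  have hsimple : ∀ j, j ≠ i → ∀ v, ⟪ω, ρ.act (cs.simple j) v⟫_ℝ = ⟪ω, v⟫_ℝ := by
    intro j hj v
    rw [act_simple_apply, inner_sub_right, inner_smul_right, real_inner_comm (ρ.root j) ω, hω' j hj,
      mul_zero, sub_zero]
  have hfix : ∀ d ∈ Set.range x, d ≠ e → d ≠ -e → ρ.act (cs.simple i) d = d := by
    intro d hd h1 h2
    refine ho _ (cs.isReflection_simple i) e he hself d hd h1 h2 ?_ ?_
    · rwa [hi]
    · rwa [hi, neg_neg]
  have habs : ∀ w, ⟪ω, ρ.act w e⟫_ℝ = ⟪ω, e⟫_ℝ ∨ ⟪ω, ρ.act w e⟫_ℝ = -⟪ω, e⟫_ℝ := by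
    intro w
    induction w using cs.simple_induction_left with
    | one => rw [act_one_apply]; exact Or.inl rfl
    | mul_simple_left w j ih =>
      rw [act_mul_apply]
      by_cases hj : j = i
      · subst hj
        by_cases h1 : ρ.act w e = e
        · rw [h1, hi, inner_neg_right]; exact Or.inr rfl
        by_cases h2 : ρ.act w e = -e
        · rw [h2, map_neg, hi, neg_neg]; exact Or.inl rfl
        rwa [hfix _ (hx.act_mem_range w e he) h1 h2]
      · rwa [hsimple j hj]
  have hne : ⟪ω, a⟫_ℝ ≠ 0 := by
    intro h0
    have hω0 : ω = 0 := by
      refine hx.eq_zero_of_inner_eq_zero fun k => ?_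
      obtain ⟨k0, rfl⟩ := he
      obtain ⟨l, rfl⟩ := ha
      have h1 := habs (c ^ (l - k0))
      have h2 := habs (c ^ (k - k0))
      rw [hx.act_zpow, add_sub_cancel] at h1 h2
      have h3 : ⟪ω, x k0⟫_ℝ = 0 := by rcases h1 with h1 | h1 <;> linarith
      rw [h3] at h2
      simpa using h2
    rw [hω0, inner_zero_right] at hω
    norm_num at hω
  by_contra hcon
  have hstep : ∀ s ∈ cs.simple '' J, ∀ g ∈ Subgroup.closure (cs.simple '' J),
      ⟪ω, ρ.act g a⟫_ℝ = ⟪ω, a⟫_ℝ → ⟪ω, ρ.act (s * g) a⟫_ℝ = ⟪ω, a⟫_ℝ := by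
    rintro _ ⟨j, hj, rfl⟩ g hg ih
    rw [act_mul_apply]
    by_cases hji : j = i
    · subst hji
      rw [hfix _ (hx.act_mem_range g a ha), ih]
      · exact fun e' => hcon ⟨hj, g, hg, e'⟩
      · refine fun e' => hcon ⟨hj, cs.simple j * g,
          mul_mem (Subgroup.subset_closure ⟨j, hj, rfl⟩) hg, ?_⟩
        rw [act_mul_apply, e', map_neg, hi, neg_neg]
    · rw [hsimple j hji, ih]
  have hconst : ∀ g ∈ Subgroup.closure (cs.simple '' J), ⟪ω, ρ.act g a⟫_ℝ = ⟪ω, a⟫_ℝ := by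
    intro g hg
    induction hg using Subgroup.closure_induction_left with
    | one => rw [act_one_apply]
    | mul_left s hs g hg ih => exact hstep s hs g hg ih
    | inv_mul_cancel s hs g hg ih =>
      rw [(isReflection_of_mem_image s hs).inv]
      exact hstep s hs g hg ih
  have := hconst γ hγ
  rw [hγa, inner_neg_right] at this
  exact hne (by linarith)

theorem reflectionClosed_of_eq_two_mul_finrank [Finite W] (hlin : LinearIndependent ℝ ρ.root)
    {W' : Subgroup W} (hW' : IsParabolic cs W') : ρ.ReflectionClosed W' := by
  obtain ⟨J, w, rfl⟩ := hW'
  obtain ⟨i, k, hi⟩ := hx.exists_simple_act_eq_neg hn hneg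
  have key := fun {a} ha {γ} => hx.exists_mem_closure_act_eq hn hneg hlin ⟨k, rfl⟩ hi J (a := a) ha
    (γ := γ)
  refine reflectionClosed_map_conj (hx.reflectionClosed_closure
    (hx.reflectionTransitive_of_eq_two_mul_finrank hn hneg)
    (hx.fewMoved_of_eq_two_mul_finrank hn hneg) isReflection_of_mem_image ?_ ?_) w
  · intro a ha γ hγ e
    obtain ⟨hiJ, g, hg, e'⟩ := key ha hγ e
    refine ⟨g⁻¹ * cs.simple i * g⁻¹⁻¹,
      mul_mem (mul_mem (inv_mem hg) (Subgroup.subset_closure ⟨i, hiJ, rfl⟩)) (by simpa using hg),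
      (cs.isReflection_simple i).conj _, ?_⟩
    rw [act_mul_apply, act_mul_apply, inv_inv, e', hi, map_neg, ρ.act_inv_eq e']
  · rintro a ha b hb ⟨γ, hγ, e⟩ ⟨γ', hγ', e'⟩
    obtain ⟨-, g, hg, h1⟩ := key ha hγ e
    obtain ⟨-, g', hg', h2⟩ := key hb hγ' e'
    exact ⟨g'⁻¹ * g, mul_mem (inv_mem hg') hg, by rw [act_mul_apply, h1, ρ.act_inv_eq h2]⟩

theorem isNoncrossing_iff_of_eq_two_mul_finrank [Finite W] (hlin : LinearIndependent ℝ ρ.root)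
    {W' : Subgroup W} (hW' : IsParabolic cs W') :
    IsNoncrossing cs c W' ↔ ρ.NoncrossingOrbits W' x h := by
  have hpos := hx.pos
  have hT := hx.reflectionTransitive_of_eq_two_mul_finrank hn hneg
  have ho := hx.fewMoved_of_eq_two_mul_finrank hn hneg
  have hcl := hx.reflectionClosed_of_eq_two_mul_finrank hn hneg hlin hW'
  exact ⟨hx.noncrossingOrbits_of_isNoncrossing hT
    (hx.arcRigid_of_fewMoved (by omega) hT ho) hcl,
    hx.isNoncrossing_of_fewMoved (by omega) hT ho hcl (le_closure_of_isParabolic hW')⟩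

omit hn hneg in
theorem isNoncrossing_iff_of_eq_finrank_add_one [Finite W] (hn : h = finrank ℝ V + 1) (hh : 3 ≤ h)
    {W' : Subgroup W} (hW' : IsParabolic cs W') :
    IsNoncrossing cs c W' ↔ ρ.NoncrossingOrbits W' x h := by
  have ho := hx.fewMoved_of_eq_finrank_add_one hn
  have hneg := fun {a} => hx.neg_notMem_of_eq_finrank_add_one hn hh (a := a)
  have hT := hx.reflectionTransitive_of_fewMoved ho fun a ha hna => absurd hna (hneg ha)
  have hcl : ρ.ReflectionClosed W' := by
    obtain ⟨J, w, rfl⟩ := hW'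
    refine reflectionClosed_map_conj (hx.reflectionClosed_closure hT ho isReflection_of_mem_image
      (fun a ha γ _ e => absurd (e ▸ hx.act_mem_range γ a ha) (hneg ha)) ?_) w
    rintro a ha b _ ⟨γ, _, e⟩
    exact absurd (e ▸ hx.act_mem_range γ a ha) (hneg ha)
  exact ⟨hx.noncrossingOrbits_of_isNoncrossing hT
    (hx.arcRigid_of_fewMoved (by omega) hT ho) hcl,
    hx.isNoncrossing_of_fewMoved (by omega) hT ho hcl (le_closure_of_isParabolic hW')⟩

end IsCyclicOrbit

end Realization
end CoxeterPlane

namespace CoxeterPlane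
open scoped InnerProductSpace
open Module (finrank)
namespace Realization

variable {B W V : Type*} [Group W] {M : CoxeterMatrix B} {cs : CoxeterSystem M W}
  [NormedAddCommGroup V] [InnerProductSpace ℝ V] {ρ : Realization cs V}

/-! ### Dihedral groups -/

theorem _root_.CoxeterPlane.simple_mul_zpow (i j : B) (k : ℤ) :
    cs.simple i * (cs.simple j * cs.simple i) ^ k =
      (cs.simple j * cs.simple i) ^ (-k) * cs.simple i := by
  have h2 := conj_zpow (i := k) (a := cs.simple i) (b := cs.simple j * cs.simple i)
  have h3 : cs.simple i * (cs.simple j * cs.simple i) * (cs.simple i)⁻¹ =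
      (cs.simple j * cs.simple i)⁻¹ := by
    rw [mul_inv_rev, cs.inv_simple, cs.inv_simple]
    simp [mul_assoc]
  rw [h3, inv_zpow, ← zpow_neg] at h2
  rw [h2, inv_mul_cancel_right]

theorem eq_simple_of_act_eq_self {i : B} {t : W} (ht : cs.IsReflection t)
    (hfix : ∀ v, ⟪ρ.root i, v⟫_ℝ = 0 → ρ.act t v = v) : t = cs.simple i := by
  obtain ⟨b, hb, hv⟩ := ρ.exists_unit_of_isReflection ht
  have hb0 : b ≠ 0 := by rintro rfl; simp at hb
  have hi := ρ.inner_root_self i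
  set r := ⟪ρ.root i, b⟫_ℝ with hr
  have h0 : ⟪ρ.root i, b - r • ρ.root i⟫_ℝ = 0 := by
    rw [inner_sub_right, inner_smul_right, hi, mul_one, sub_self]
  have h1 : ⟪b, b - r • ρ.root i⟫_ℝ = 0 := by
    have h2 := hfix _ h0
    rw [hv, sub_eq_self, smul_eq_zero] at h2
    simpa [hb0] using h2
  have hb' : b = r • ρ.root i := by
    rw [← sub_eq_zero, ← inner_self_eq_zero (𝕜 := ℝ)]
    nth_rewrite 1 [inner_sub_left]
    rw [h1, inner_smul_left, h0, mul_zero, sub_zero]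
  have hr2 : r * r = 1 := by
    rw [hb', inner_smul_left, inner_smul_right, hi] at hb
    simpa using hb
  refine ρ.eq_of_act_eq fun v => ?_
  rw [hv, act_simple_apply, hb', inner_smul_left, smul_smul]
  congr 2
  simp only [conj_trivial]
  linear_combination 2 * ⟪ρ.root i, v⟫_ℝ * hr2

namespace IsCyclicOrbit

variable {i j : B} (hij : ∀ k, k = i ∨ k = j) {h : ℕ} {x : ℤ → V}
  (hx : ρ.IsCyclicOrbit (cs.simple j * cs.simple i) h x)
include hx

/-- `cs.simple i` inverts `c`, so it reverses the indices; `cs.simple j` is `c` times it, which adds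
one. -/
theorem exists_act_simple_eq : ∃ a, (∀ k, ρ.act (cs.simple i) (x k) = x (a - k)) ∧
    ∀ k, ρ.act (cs.simple j) (x k) = x (a + 1 - k) := by
  obtain ⟨a, ha⟩ := hx.exists_act (cs.simple i) 0
  have key : ∀ k, ρ.act (cs.simple i) (x k) = x (a - k) := by
    intro k
    have h4 := hx.act_zpow k 0
    rw [zero_add] at h4
    rw [← h4, ← act_mul_apply, simple_mul_zpow, act_mul_apply, ha, hx.act_zpow]
    congr 1
  refine ⟨a, key, fun k => ?_⟩
  have h5 := key (a - k)
  rw [sub_sub_cancel] at h5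
  rw [← h5, ← act_mul_apply, hx.act_succ]
  congr 1; ring

/-- Conjugating by `c ^ q` changes the index sum of exchanged points by `2q`; the two simple
reflections supply both parities. -/
theorem reflectionTransitive_of_rank_two : ρ.ReflectionTransitive x := by
  intro k l _
  obtain ⟨a, hi, hj⟩ := hx.exists_act_simple_eq
  have key : ∀ (s : W) (b q : ℤ), (∀ k, ρ.act s (x k) = x (b - k)) → k + l = b + 2 * q →
      ρ.act ((cs.simple j * cs.simple i) ^ q * s * ((cs.simple j * cs.simple i) ^ q)⁻¹) (x k) =
        x l := by
    intro s b q hs e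
    rw [act_mul_apply, act_mul_apply, ← zpow_neg, hx.act_zpow, hs, hx.act_zpow]
    congr 1; omega
  rcases Int.even_or_odd' (k + l - a) with ⟨q, hq | hq⟩
  · exact ⟨_, (cs.isReflection_simple i).conj _, key _ a q hi (by omega)⟩
  · exact ⟨_, (cs.isReflection_simple j).conj _, key _ (a + 1) q hj (by omega)⟩

include hij

theorem exists_act_eq_add_or_sub (w : W) :
    ∃ q, (∀ k, ρ.act w (x k) = x (q + k)) ∨ ∀ k, ρ.act w (x k) = x (q - k) := by
  obtain ⟨a, hi, hj⟩ := hx.exists_act_simple_eq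
  have hs : ∀ m, ∃ b, ∀ k, ρ.act (cs.simple m) (x k) = x (b - k) := by
    intro m
    rcases hij m with rfl | rfl
    exacts [⟨a, hi⟩, ⟨a + 1, hj⟩]
  induction w using cs.simple_induction_left with
  | one => exact ⟨0, Or.inl fun k => by rw [act_one_apply, zero_add]⟩
  | mul_simple_left w m ih =>
    obtain ⟨b, hb⟩ := hs m
    obtain ⟨q, hq | hq⟩ := ih
    · exact ⟨b - q, Or.inr fun k => by rw [act_mul_apply, hq, hb, sub_sub]⟩
    · exact ⟨b - q, Or.inl fun k => by
        rw [act_mul_apply, hq, hb, sub_sub_eq_add_sub, sub_add_eq_add_sub]⟩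

/-- `w` acts on indices by a translation or a reversal, so it takes an arc to an arc of the same
length. Applying `1 - c` to equal arc sums compares endpoint differences, and in the coordinate `Φ`
the nonzero number `ζ ^ a - ζ ^ b` forces the arcs to coincide modulo `h`. -/
theorem arcRigid_of_rank_two {Φ : V →ₗ[ℝ] ℂ} {ζ z : ℂ} (hζ : IsPrimitiveRoot ζ h) (hz : z ≠ 0)
    (hΦ : ∀ k, Φ (x k) = ζ ^ k * z) : ρ.ArcRigid x h := by
  intro a b hab hba w hw
  have hζ0 : ζ ≠ 0 := hζ.ne_zero hx.pos.ne'
  have hne : ζ ^ a - ζ ^ b ≠ 0 := by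
    intro e
    rw [sub_eq_zero] at e
    have h1 : ζ ^ (b - a) = 1 := by rw [zpow_sub₀ hζ0, e, div_self (zpow_ne_zero _ hζ0)]
    have h2 := Int.eq_zero_of_abs_lt_dvd ((hζ.zpow_eq_one_iff_dvd _).1 h1)
      (by rw [abs_lt]; constructor <;> omega)
    omega
  have hdiff : ∀ k l, Φ (x k - x l) = (ζ ^ k - ζ ^ l) * z := fun k l => by
    rw [map_sub, hΦ, hΦ, sub_mul]
  have hsum := hx.arcSum_sub_act hab.le
  obtain ⟨q, hq | hq⟩ := hx.exists_act_eq_add_or_sub hij w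
  · have h1 : ρ.act w (arcSum x a b) = arcSum x (a + q) (b + q) := by
      rw [arcSum, map_sum, arcSum]
      refine Finset.sum_bij (fun m _ => m + q) ?_ ?_ ?_ ?_
      · intro m hm; rw [Finset.mem_Ico] at hm ⊢; omega
      · intro m _ m' _ e; omega
      · intro m hm; rw [Finset.mem_Ico] at hm
        exact ⟨m - q, by rw [Finset.mem_Ico]; omega, by omega⟩
      · intro m _; rw [hq, add_comm]
    rw [h1] at hw
    have h2 := hx.arcSum_sub_act (show a + q ≤ b + q by omega)
    rw [hw, hsum] at h2
    have h3 := congrArg Φ h2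
    rw [hdiff, hdiff, zpow_add₀ hζ0, zpow_add₀ hζ0, ← sub_mul] at h3
    have h4 := mul_left_cancel₀ hne ((mul_one _).trans (mul_right_cancel₀ hz h3))
    intro m h5 h6
    refine ⟨m, h5, h6, ?_⟩
    rw [hq, hx.eq_iff]
    have := (hζ.zpow_eq_one_iff_dvd _).1 h4.symm
    rwa [← dvd_neg, neg_sub, add_sub_cancel_right]
  · have h1 : ρ.act w (arcSum x a b) = arcSum x (q + 1 - b) (q + 1 - a) := by
      rw [arcSum, map_sum, arcSum]
      refine Finset.sum_bij (fun m _ => q - m) ?_ ?_ ?_ ?_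
      · intro m hm; rw [Finset.mem_Ico] at hm ⊢; omega
      · intro m _ m' _ e; omega
      · intro m hm; rw [Finset.mem_Ico] at hm
        exact ⟨q - m, by rw [Finset.mem_Ico]; omega, by omega⟩
      · intro m _; rw [hq]
    rw [h1] at hw
    have h2 := hx.arcSum_sub_act (show q + 1 - b ≤ q + 1 - a by omega)
    rw [hw, hsum] at h2
    have h3 := mul_right_cancel₀ hz ((hdiff _ _).symm.trans ((congrArg Φ h2).trans (hdiff _ _)))
    have h4 : ζ ^ (q + 1 - b) - ζ ^ (q + 1 - a) = (ζ ^ a - ζ ^ b) * ζ ^ (q + 1 - (a + b)) := by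
      rw [sub_mul, ← zpow_add₀ hζ0, ← zpow_add₀ hζ0]
      congr 2 <;> ring
    rw [h4] at h3
    have h5 := mul_left_cancel₀ hne ((mul_one _).trans h3)
    have h6 := (hζ.zpow_eq_one_iff_dvd _).1 h5.symm
    intro m h7 h8
    refine ⟨a + b - 1 - m, by omega, by omega, ?_⟩
    rw [hq, hx.eq_iff, ← dvd_neg]
    rwa [show -(a + b - 1 - m - (q - m)) = q + 1 - (a + b) by ring]

theorem reflectionClosed_of_rank_two {W' : Subgroup W} (hW' : IsParabolic cs W') :
    ρ.ReflectionClosed W' := by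
  obtain ⟨J, w, rfl⟩ := hW'
  refine reflectionClosed_map_conj ?_ w
  have hone : ∀ m, (∀ k ∈ J, k = m) → ∀ t, cs.IsReflection t →
      (∀ v ∈ ρ.fixed (Subgroup.closure (cs.simple '' J)), ρ.act t v = v) → t = cs.simple m := by
    intro m hm t ht hfix
    refine eq_simple_of_act_eq_self (ρ := ρ) ht fun v hv => hfix v ?_
    rw [fixed_closure]
    rintro _ ⟨k, hk, rfl⟩
    rw [hm k hk, act_simple_apply, hv, mul_zero, zero_smul, sub_zero]
  intro t ht hfix
  by_cases hi : i ∈ J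
  · by_cases hj : j ∈ J
    · have : J = Set.univ := Set.eq_univ_of_forall fun k => by
        rcases hij k with rfl | rfl <;> assumption
      rw [this, Set.image_univ, cs.subgroup_closure_range_simple]
      exact Subgroup.mem_top _
    · rw [hone i (fun k hk => (hij k).resolve_right fun e => hj (e ▸ hk)) t ht hfix]
      exact Subgroup.subset_closure ⟨i, hi, rfl⟩
  · by_cases hj : j ∈ J
    · rw [hone j (fun k hk => (hij k).resolve_left fun e => hi (e ▸ hk)) t ht hfix]
      exact Subgroup.subset_closure ⟨j, hj, rfl⟩
    · exfalso
      obtain ⟨k, hk⟩ := hx.exists_act_ne ht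
      refine hk (hfix _ ?_)
      rw [fixed_closure]
      rintro _ ⟨m, hm, rfl⟩
      rcases hij m with rfl | rfl <;> contradiction

theorem isNoncrossing_iff_of_rank_two [FiniteDimensional ℝ V] (hn : finrank ℝ V = 2)
    {Φ : V →ₗ[ℝ] ℂ} {ζ z : ℂ} (hζ : IsPrimitiveRoot ζ h) (hz : z ≠ 0)
    (hΦ : ∀ k, Φ (x k) = ζ ^ k * z) {W' : Subgroup W} (hW' : IsParabolic cs W') :
    IsNoncrossing cs (cs.simple j * cs.simple i) W' ↔ ρ.NoncrossingOrbits W' x h := by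
  have hT := hx.reflectionTransitive_of_rank_two
  have hcl := hx.reflectionClosed_of_rank_two hij hW'
  refine ⟨hx.noncrossingOrbits_of_isNoncrossing hT (hx.arcRigid_of_rank_two hij hζ hz hΦ) hcl,
    hx.isNoncrossing_of_finrank_eq_two hn hT hcl (le_closure_of_isParabolic hW')
      ⟨[cs.simple j, cs.simple i], ⟨?_, by simp⟩, by rw [hn]; rfl, ?_⟩⟩
  · intro t ht
    simp only [List.mem_cons, List.not_mem_nil, or_false] at ht
    rcases ht with rfl | rfl <;> exact cs.isReflection_simple _
  · rw [eq_top_iff, ← cs.subgroup_closure_range_simple, Subgroup.closure_le]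
    rintro _ ⟨k, rfl⟩
    refine Subgroup.subset_closure ?_
    rcases hij k with rfl | rfl <;> simp

end IsCyclicOrbit

end Realization
end CoxeterPlane

/-! ### Assembling the theorem type by type -/

namespace CoxeterPlane
open scoped InnerProductSpace
open Module (finrank)
namespace Realization

variable {B W V : Type*} [Group W] {M : CoxeterMatrix B} {cs : CoxeterSystem M W}
  [NormedAddCommGroup V] [InnerProductSpace ℝ V] {ρ : Realization cs V}

theorem _root_.CoxeterPlane.one_sub_cos_pi_div_pos {h : ℕ} (hh : 0 < h) :
    0 < 1 - Real.cos (Real.pi / h) := by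
  have h3 : (0 : ℝ) < h := by exact_mod_cast hh
  have h4 : Real.cos (Real.pi / h) < Real.cos 0 := by
    refine Real.cos_lt_cos_of_nonneg_of_le_pi le_rfl ?_ (div_pos Real.pi_pos h3)
    rw [div_le_iff₀ h3]
    have : (1 : ℝ) ≤ h := by exact_mod_cast hh
    nlinarith [Real.pi_pos]
  rw [Real.cos_zero] at h4
  linarith

theorem exists_orbit_subset {F : Set V} (hF : ∀ i, ∀ a ∈ F, ρ.act (cs.simple i) a ∈ F) {y : V}
    (hy : y ∈ F) (hy0 : y ≠ 0) : ∃ o, ρ.IsNontrivialOrbit o ∧ o ⊆ F := by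
  refine ⟨_, ⟨y, hy0, rfl⟩, ?_⟩
  rintro _ ⟨w, -, rfl⟩
  induction w using cs.simple_induction_left with
  | one => rwa [act_one_apply]
  | mul_simple_left w i ih => rw [act_mul_apply]; exact hF i _ ih

theorem act_bipartiteCoxeterElement [Fintype B] [DecidableEq B] (β : Bipartition M) (v : V) :
    ρ.act (bipartiteCoxeterElement cs β) v = ρ.act (cNeg cs β) (ρ.act (cPos cs β) v) :=
  ρ.act_mul_apply _ _ _

variable [FiniteDimensional ℝ V] [Fintype B] [DecidableEq B] {β : Bipartition M} {h : ℕ}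
  {Φ : V →ₗ[ℝ] ℂ} [Finite W]

/-- The type enters through the plane coordinate, one orbit of at most `h` points, and the algebraic
equivalence for cyclic orbits. The small orbit only bounds the size of `o`; it need not be `o`. -/
theorem projectsToPolygon_and_isNoncrossing_iff (hconn : DiagramConnected M) (hh : 0 < h)
    (hΦ : ρ.IsPlaneCoordinate β h Φ) {o : Set V} (ho : ρ.IsSmallestOrbit o)
    (hsmall : ∃ o', ρ.IsNontrivialOrbit o' ∧ o'.ncard ≤ h)
    (hnc : ∀ x, ρ.IsCyclicOrbit (bipartiteCoxeterElement cs β) h x →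
      (∃ z, z ≠ 0 ∧ ∀ k : ℤ, Φ (x k) = Complex.exp (2 * Real.pi * Complex.I / h) ^ k * z) →
      ∀ W', IsParabolic cs W' →
        (IsNoncrossing cs (bipartiteCoxeterElement cs β) W' ↔ ρ.NoncrossingOrbits W' x h)) :
    (o.ncard = coxeterNumber cs β ∧ ρ.ProjectsToPolygon β o) ∧
    ∀ W' : Subgroup W, IsParabolic cs W' →
      (IsNoncrossing cs (bipartiteCoxeterElement cs β) W' ↔ ρ.HullsDisjoint β o W') := by
  obtain ⟨o', ho', hcard⟩ := hsmall
  obtain ⟨x, hx, rfl, hx0, hxk⟩ :=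
    hΦ.exists_cyclicOrbit hh hconn ho.1 ((ho.2 o' ho').trans hcard)
  obtain ⟨φ, r, hr, hp⟩ := exists_polygon_coordinate hΦ hx0 hxk
  refine ⟨⟨by rw [hx.ncard_range, hx.coxeterNumber_eq], hx.projectsToPolygon hr hp hxk⟩,
    fun W' hW' => ?_⟩
  rw [hx.hullsDisjoint_iff β (φ := φ.toLinearMap) φ.injective hr hp]
  exact hnc x hx ⟨Φ (x 0), hx0, fun k => by rw [hxk, hΦ.map_zpow]⟩ W' hW'

/-! ### Rank one -/

/-- `V` is a line, `c` is `-1` and `h = 2`: a one-dimensional cross-polytope. The coordinate is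
built by hand, as `exists_planeCoordinate` needs `3 ≤ h`. -/
theorem projectsToPolygon_and_isNoncrossing_iff_of_unique (i : B) (hi : ∀ j, j = i)
    (β : Bipartition M) {o : Set V} (ho : ρ.IsSmallestOrbit o) : (o.ncard = coxeterNumber cs β ∧ ρ.ProjectsToPolygon β o) ∧
    ∀ W' : Subgroup W, IsParabolic cs W' →
      (IsNoncrossing cs (bipartiteCoxeterElement cs β) W' ↔ ρ.HullsDisjoint β o W') := by
  have huniv : (Finset.univ : Finset B) = {i} := by ext j; simp [hi j]
  have hz : IsPerronVector M (fun _ => 1) 1 := by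
    refine ⟨fun _ => one_pos, fun j => ?_⟩
    rw [huniv, Finset.sum_singleton, hi j, gram_self]
  have hconn : DiagramConnected M := fun f _ j k => by rw [hi j, hi k]
  have hn : finrank ℝ V = 1 := by
    rw [ρ.finrank_eq_card hz one_pos, ← Finset.card_univ, huniv, Finset.card_singleton]
  have hv : ∀ v, v = ⟪ρ.root i, v⟫_ℝ • ρ.root i := by
    intro v
    rw [← sub_eq_zero]
    refine ρ.eq_zero_of_inner_root fun j => ?_
    rw [hi j, inner_sub_right, inner_smul_right, inner_root_self, mul_one, sub_self]
  have hs : ∀ v, ρ.act (cs.simple i) v = -v := by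
    intro v
    rw [act_simple_apply]
    nth_rewrite 1 3 [hv v]
    module
  have hβ : (β.pos = {i} ∧ β.neg = ∅) ∨ (β.pos = ∅ ∧ β.neg = {i}) := by
    have h1 := β.union_eq
    have h2 := β.disjoint
    rw [huniv] at h1
    have hmem : i ∈ β.pos ∪ β.neg := by rw [h1]; simp
    have hsub : ∀ S : Finset B, i ∈ S → S = {i} := fun S hS => by
      ext j; simp [hi j, hS]
    have hsub' : ∀ S : Finset B, i ∉ S → S = ∅ := fun S hS => by
      ext j; simp [hi j, hS]
    rcases Finset.mem_union.1 hmem with h3 | h3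
    · exact Or.inl ⟨hsub _ h3, hsub' _ (Finset.disjoint_left.1 h2 h3)⟩
    · exact Or.inr ⟨hsub' _ (Finset.disjoint_right.1 h2 h3), hsub _ h3⟩
  have hc : ∀ v, ρ.act (bipartiteCoxeterElement cs β) v = -v := by
    intro v
    have h1 : ∀ u, ρ.act (cPos cs β) u = u - ∑ i ∈ β.pos, (2 * ⟪ρ.root i, u⟫_ℝ) • ρ.root i :=
      fun u => ρ.act_noncommProd β.pos β.pos_eq_two _ u
    have h2 : ∀ u, ρ.act (cNeg cs β) u = u - ∑ i ∈ β.neg, (2 * ⟪ρ.root i, u⟫_ℝ) • ρ.root i :=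
      fun u => ρ.act_noncommProd β.neg β.neg_eq_two _ u
    rw [act_bipartiteCoxeterElement, h1, h2, ← hs v, act_simple_apply]
    rcases hβ with ⟨e1, e2⟩ | ⟨e1, e2⟩ <;> simp [e1, e2]
  have hplane : ρ.root i ∈ ρ.plane β := by
    refine Submodule.subset_span ⟨fun _ => 1, fun _ => one_pos, ⟨1, ?_⟩, ?_⟩
    · exact (isPerronVector_iff.1 hz).2
    · rcases hβ with ⟨e1, e2⟩ | ⟨e1, e2⟩ <;> simp [e1, e2]
  let Φ : V →ₗ[ℝ] ℂ := Complex.ofRealCLM.toLinearMap ∘ₗ (innerSL ℝ (ρ.root i)).toLinearMap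
  have hΦv : ∀ v, Φ v = (⟪ρ.root i, v⟫_ℝ : ℂ) := fun v => rfl
  have hexp : Complex.exp (2 * Real.pi * Complex.I / (2 : ℕ)) = -1 := by
    rw [← Complex.exp_pi_mul_I]
    congr 1
    push_cast
    ring
  have hΦ : ρ.IsPlaneCoordinate β 2 Φ := by
    refine ⟨fun v _ => ?_, fun v => ?_, fun v => ?_, fun h => ?_⟩
    · rw [hΦv, Complex.norm_real]
      nth_rewrite 2 [hv v]
      have h1 := ρ.inner_root_self i
      rw [real_inner_self_eq_norm_sq] at h1
      have h2 : ‖ρ.root i‖ = 1 := by nlinarith [norm_nonneg (ρ.root i)]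
      rw [norm_smul, h2, mul_one]
    · rw [hΦv, hΦv, ρ.inner_proj β hplane]
    · rw [hΦv, hΦv, hc, hexp, inner_neg_right]
      push_cast
      ring
    · have h1 := hΦv (ρ.root i)
      rw [h, inner_root_self] at h1
      simp at h1
  have hroot : ρ.root i ≠ 0 := fun e => by
    have := ρ.inner_root_self i
    rw [e, inner_zero_left] at this
    exact zero_ne_one this
  refine projectsToPolygon_and_isNoncrossing_iff hconn two_pos hΦ ho ?_ fun x hx _ W' hW' => ?_
  · obtain ⟨o', h1, h2⟩ := exists_orbit_subset (ρ := ρ) (F := {ρ.root i, -ρ.root i}) (y := ρ.root i)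
      (by rintro j a (rfl | rfl) <;> rw [hi j, hs] <;> simp) (by simp) hroot
    exact ⟨o', h1, (Set.ncard_le_ncard h2).trans (Set.ncard_insert_le _ _ |>.trans (by simp))⟩
  · refine hx.isNoncrossing_iff_of_eq_two_mul_finrank (by rw [hn, mul_one]) (fun k => ?_)
      (ρ.linearIndependent_root hz one_pos) hW'
    rw [hn, Nat.cast_one, ← hx.act_succ, hc]

/-! ### Rank two -/

theorem projectsToPolygon_and_isNoncrossing_iff_of_I {k : ℕ} (hk : 1 ≤ k) (e : B ≃ Fin 2)
    (hM : M.reindex e = CoxeterMatrix.I k) (β : Bipartition M) {o : Set V}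
    (ho : ρ.IsSmallestOrbit o) : (o.ncard = coxeterNumber cs β ∧ ρ.ProjectsToPolygon β o) ∧
    ∀ W' : Subgroup W, IsParabolic cs W' →
      (IsNoncrossing cs (bipartiteCoxeterElement cs β) W' ↔ ρ.HullsDisjoint β o W') := by
  have hcard : Fintype.card B = 2 := by rw [Fintype.card_congr e, Fintype.card_fin]
  have hMij : ∀ a b, a ≠ b → M a b = k + 2 := by
    intro a b hab
    have h1 := congrArg (fun N : CoxeterMatrix (Fin 2) => N (e a) (e b)) hM
    simp only [CoxeterMatrix.reindex_apply, Equiv.symm_apply_apply] at h1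
    rw [h1]
    change (if e a = e b then 1 else k + 2) = k + 2
    rw [if_neg (e.injective.ne hab)]
  have hsub : ∀ S : Finset B, (∀ i ∈ S, ∀ j ∈ S, i ≠ j → M i j = 2) → S.card ≤ 1 := by
    intro S hS
    rw [Finset.card_le_one]
    intro a ha b hb
    by_contra hab
    have h1 := hS a ha b hb hab
    rw [hMij a b hab] at h1
    omega
  have hcards : β.pos.card + β.neg.card = 2 := by
    rw [← Finset.card_union_of_disjoint β.disjoint, β.union_eq, Finset.card_univ, hcard]
  have h1 := hsub _ β.pos_eq_two
  have h2 := hsub _ β.neg_eq_two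
  obtain ⟨i, hi⟩ := Finset.card_eq_one.1 (show β.pos.card = 1 by omega)
  obtain ⟨j, hj⟩ := Finset.card_eq_one.1 (show β.neg.card = 1 by omega)
  have hne : i ≠ j := by
    rintro rfl
    have := β.disjoint
    rw [hi, hj] at this
    simp at this
  have hij : ∀ m, m = i ∨ m = j := by
    intro m
    have : m ∈ β.pos ∪ β.neg := by rw [β.union_eq]; exact Finset.mem_univ m
    rw [hi, hj] at this
    simpa using this
  have huniv : (Finset.univ : Finset B) = {i, j} := by
    rw [← β.union_eq, hi, hj]; rfl
  have hc : bipartiteCoxeterElement cs β = cs.simple j * cs.simple i := by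
    refine ρ.eq_of_act_eq fun v => ?_
    have h1 : ∀ u, ρ.act (cPos cs β) u = u - ∑ i ∈ β.pos, (2 * ⟪ρ.root i, u⟫_ℝ) • ρ.root i :=
      fun u => ρ.act_noncommProd β.pos β.pos_eq_two _ u
    have h2 : ∀ u, ρ.act (cNeg cs β) u = u - ∑ i ∈ β.neg, (2 * ⟪ρ.root i, u⟫_ℝ) • ρ.root i :=
      fun u => ρ.act_noncommProd β.neg β.neg_eq_two _ u
    rw [act_bipartiteCoxeterElement, h1, h2, hi, hj, Finset.sum_singleton, Finset.sum_singleton,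
      ← act_simple_apply, ← act_simple_apply, act_mul_apply]
  have hconn : DiagramConnected M := by
    intro f hf a b
    by_cases hab : a = b
    · rw [hab]
    · exact hf a b (by rw [hMij a b hab]; omega)
  have hz : IsPerronVector M (fun _ => 1) (1 - Real.cos (Real.pi / (k + 2 : ℕ))) := by
    refine ⟨fun _ => one_pos, fun m => ?_⟩
    have h1 : gram M i j = -Real.cos (Real.pi / (k + 2 : ℕ)) := by rw [gram_apply, hMij i j hne]
    rw [huniv, Finset.sum_pair hne]
    rcases hij m with rfl | rfl
    · rw [gram_self, h1]; ring
    · rw [gram_self, gram_symm, h1]; ring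
  have hμ := one_sub_cos_pi_div_pos (show 0 < k + 2 by omega)
  have : Nonempty B := ⟨i⟩
  obtain ⟨Φ, hΦ⟩ := ρ.exists_planeCoordinate (show 3 ≤ k + 2 by omega) hz hconn β
  refine projectsToPolygon_and_isNoncrossing_iff hconn (show 0 < k + 2 by omega) hΦ ho ?_
    fun x hx hzx W' hW' => ?_
  -- `ω` is fixed by `cs.simple i`, so its orbit is contained in its translates by powers of `g`, of
  -- which there are at most `k + 2`.
  · obtain ⟨ω, h3, h4⟩ := exists_dual_root (ρ.linearIndependent_root hz hμ) j
    have hω0 : ω ≠ 0 := by rintro rfl; simp at h3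
    set g := cs.simple j * cs.simple i with hg
    have hgm : g ^ (k + 2) = 1 := by
      rw [← hMij j i hne.symm]; exact cs.simple_mul_simple_pow j i
    have hiω : ρ.act (cs.simple i) ω = ω := by
      rw [act_simple_apply, h4 i hne, mul_zero, zero_smul, sub_zero]
    have hiF : ∀ m : ℤ, ρ.act (cs.simple i) (ρ.act (g ^ m) ω) = ρ.act (g ^ (-m)) ω := by
      intro m
      rw [← act_mul_apply, simple_mul_zpow, act_mul_apply, hiω]
    have hjF : ∀ m : ℤ, ρ.act (cs.simple j) (ρ.act (g ^ m) ω) = ρ.act (g ^ (1 - m)) ω := by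
      intro m
      have h5 : cs.simple j = g * cs.simple i := by rw [hg]; simp [mul_assoc]
      rw [h5, act_mul_apply, hiF, ← act_mul_apply, ← zpow_one_add, sub_eq_add_neg]
    obtain ⟨o', h5, h6⟩ := exists_orbit_subset (ρ := ρ)
      (F := Set.range fun m : ℤ => ρ.act (g ^ m) ω)
      (y := ω) (by
        rintro m _ ⟨q, rfl⟩
        rcases hij m with rfl | rfl
        · exact ⟨-q, (hiF q).symm⟩
        · exact ⟨1 - q, (hjF q).symm⟩) ⟨0, by simp⟩ hω0
    classical
    refine ⟨o', h5, ?_⟩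
    have h7 : o' ⊆ ((Finset.range (k + 2)).image fun m => ρ.act (g ^ m) ω : Finset V) := by
      refine h6.trans ?_
      rintro _ ⟨q, rfl⟩
      have h8 : (0 : ℤ) < (k + 2 : ℕ) := by omega
      have h9 := Int.emod_nonneg q h8.ne'
      have h10 := Int.emod_lt_of_pos q h8
      rw [Finset.mem_coe, Finset.mem_image]
      refine ⟨(q % (k + 2 : ℕ)).toNat, by rw [Finset.mem_range]; omega, ?_⟩
      rw [← zpow_natCast, Int.toNat_of_nonneg h9]
      change _ = ρ.act (g ^ q) ω
      nth_rewrite 2 [← Int.emod_add_mul_ediv q (k + 2 : ℕ)]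
      rw [zpow_add, zpow_mul, zpow_natCast, hgm, one_zpow, mul_one]
    refine (Set.ncard_le_ncard h7 (Finset.finite_toSet _)).trans ?_
    rw [Set.ncard_coe_finset]
    exact Finset.card_image_le.trans (by simp)
  · obtain ⟨z, hz0, hzx⟩ := hzx
    rw [hc] at hx ⊢
    exact hx.isNoncrossing_iff_of_rank_two hij (by rw [ρ.finrank_eq_card hz hμ, hcard])
      (Complex.isPrimitiveRoot_exp (k + 2) (by omega)) hz0 hzx hW'

end Realization
end CoxeterPlane

namespace CoxeterPlane
open scoped InnerProductSpace
open Module (finrank)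

/-! ### Linear diagrams -/

theorem diagramConnected_of_path {B : Type*} {M : CoxeterMatrix B} {n : ℕ} (e : B ≃ Fin n)
    (hM : ∀ i j, (e i : ℕ) + 1 = e j → M i j ≠ 2) : DiagramConnected M := by
  intro f hf
  have key : ∀ (d : ℕ) (i j : B), (e i : ℕ) + d = e j → f i = f j := by
    intro d
    induction d with
    | zero => intro i j hij; rw [e.injective (Fin.ext hij)]
    | succ d ih =>
      intro i j hij
      have hlt := (e j).isLt
      have h1 : (e (e.symm ⟨e i + d, by omega⟩) : ℕ) = e i + d := by rw [e.apply_symm_apply]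
      rw [ih i _ h1.symm]
      exact hf _ _ (hM _ _ (by rw [h1]; omega))
  intro i j
  rcases le_total (e i : ℕ) (e j) with hle | hle
  · exact key (e j - e i) i j (by omega)
  · exact (key (e i - e j) j i (by omega)).symm

theorem isPerronVector_comp {B : Type*} [Fintype B] {M : CoxeterMatrix B} {n : ℕ} (e : B ≃ Fin n)
    {z : Fin n → ℝ} {μ : ℝ} (hz : ∀ a, 0 < z a)
    (heig : ∀ a, ∑ b, gram M (e.symm a) (e.symm b) * z b = μ * z a) :
    IsPerronVector M (fun i => z (e i)) μ := by
  refine ⟨fun i => hz _, fun i => ?_⟩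
  rw [← heig (e i), ← e.symm.sum_comp]
  simp

/-- One row of the path matrix with entries `1` and `-1/2`, applied to `s 1, ..., s n`; `s 0 = 0` is
the boundary condition at the left end. -/
theorem sum_path {n k : ℕ} (hk : k < n) {s : ℕ → ℝ} (hs : s 0 = 0) :
    ∑ j : Fin n, ((if (j : ℕ) = k then s (j + 1) else 0) -
      (if (j : ℕ) + 1 = k then s (j + 1) else 0) / 2 -
      (if (j : ℕ) = k + 1 then s (j + 1) else 0) / 2) =
    s (k + 1) - s k / 2 - (if k + 1 < n then s (k + 2) else 0) / 2 := by
  rw [Fin.sum_univ_eq_sum_range (fun j => (if j = k then s (j + 1) else 0) -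
      (if j + 1 = k then s (j + 1) else 0) / 2 - (if j = k + 1 then s (j + 1) else 0) / 2) n,
    Finset.sum_sub_distrib, Finset.sum_sub_distrib, ← Finset.sum_div, ← Finset.sum_div,
    Finset.sum_ite_eq', Finset.sum_ite_eq', if_pos (Finset.mem_range.2 hk)]
  congr 2
  · congr 1
    rcases k with _ | k
    · rw [hs]; exact Finset.sum_eq_zero fun j _ => by simp
    · simp only [Nat.add_right_cancel_iff]
      rw [Finset.sum_ite_eq', if_pos (Finset.mem_range.2 (by omega))]
  · simp

theorem sin_path (θ : ℝ) (k : ℕ) :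
    Real.sin ((k + 1 : ℕ) * θ) - Real.sin (k * θ) / 2 - Real.sin ((k + 2 : ℕ) * θ) / 2 =
      (1 - Real.cos θ) * Real.sin ((k + 1 : ℕ) * θ) := by
  have h1 : (k : ℝ) * θ = (k + 1 : ℕ) * θ - θ := by push_cast; ring
  have h2 : ((k + 2 : ℕ) : ℝ) * θ = (k + 1 : ℕ) * θ + θ := by push_cast; ring
  rw [h1, h2, Real.sin_sub, Real.sin_add]
  ring

theorem sin_mul_pi_div_pos {k h : ℕ} (hk : 0 < k) (hkh : k < h) :
    0 < Real.sin (k * (Real.pi / h)) := by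
  have h1 : (0 : ℝ) < h := by exact_mod_cast hk.trans hkh
  have h2 : (0 : ℝ) < k := by exact_mod_cast hk
  have h3 : (k : ℝ) < h := by exact_mod_cast hkh
  apply Real.sin_pos_of_pos_of_lt_pi
  · have := Real.pi_pos; positivity
  · rw [← mul_div_assoc, div_lt_iff₀ h1]
    nlinarith [Real.pi_pos]

section Chain
variable {V : Type*} [NormedAddCommGroup V] [InnerProductSpace ℝ V]

/-- The points `ω, ω - r 0, ω - r 0 - r 1, …`. -/
def chainPoint (r : ℕ → V) (ω : V) (k : ℕ) : V := ω - ∑ j ∈ Finset.range k, r j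

omit [InnerProductSpace ℝ V] in
theorem chainPoint_succ (r : ℕ → V) (ω : V) (k : ℕ) :
    chainPoint r ω (k + 1) = chainPoint r ω k - r k := by
  rw [chainPoint, Finset.sum_range_succ, ← sub_sub, chainPoint]

/-- Consequently the reflection along `r i` exchanges the chain points `i` and `i + 1` and fixes the
others, so the chain is stable under these reflections. -/
theorem inner_chainPoint {r : ℕ → V} {ω : V} {N : ℕ}
    (hr : ∀ i < N, ∀ j < N, ⟪r i, r j⟫_ℝ =
      if i = j then 1 else if i + 1 = j ∨ i = j + 1 then -(1 / 2) else 0)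
    (hω : ∀ i < N, 2 * ⟪r i, ω⟫_ℝ = if i = 0 then 1 else 0) {i k : ℕ} (hi : i < N) (hk : k ≤ N) :
    2 * ⟪r i, chainPoint r ω k⟫_ℝ = (if i = k then 1 else 0) - if i + 1 = k then 1 else 0 := by
  induction k with
  | zero => simp [chainPoint, hω i hi]
  | succ k ih =>
    rw [chainPoint_succ, inner_sub_right, mul_sub, ih (by omega), hr i hi k (by omega)]
    rcases lt_trichotomy i k with h | h | h
    · by_cases h' : i + 1 = k
      · rw [if_neg (by omega), if_pos h', if_neg (by omega), if_pos (Or.inl h'), if_neg (by omega),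
          if_neg (by omega)]; norm_num
      · rw [if_neg (by omega), if_neg h', if_neg (by omega), if_neg (by omega), if_neg (by omega),
          if_neg (by omega)]; norm_num
    · subst h
      simp
      norm_num
    · by_cases h' : i = k + 1
      · rw [if_neg (by omega), if_neg (by omega), if_neg (by omega), if_pos (Or.inr h'), if_pos h',
          if_neg (by omega)]; norm_num
      · rw [if_neg (by omega), if_neg (by omega), if_neg (by omega), if_neg (by omega), if_neg h',
          if_neg (by omega)]; norm_num

end Chain

/-! ### Type A -/

namespace Realization

variable {B W V : Type*} [Group W] {M : CoxeterMatrix B} {cs : CoxeterSystem M W}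
  [NormedAddCommGroup V] [InnerProductSpace ℝ V] {ρ : Realization cs V}
  [FiniteDimensional ℝ V] [Fintype B] [DecidableEq B] [Finite W]

/-- The simple roots along a linear diagram, as a sequence. -/
def rootSeq (ρ : Realization cs V) {n : ℕ} (e : B ≃ Fin n) (k : ℕ) : V :=
  if hk : k < n then ρ.root (e.symm ⟨k, hk⟩) else 0

omit [FiniteDimensional ℝ V] [Fintype B] [DecidableEq B] [Finite W] in
theorem rootSeq_apply {n : ℕ} (e : B ≃ Fin n) (i : B) : ρ.rootSeq e (e i) = ρ.root i := by
  rw [rootSeq, dif_pos (e i).isLt]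
  simp

omit [FiniteDimensional ℝ V] [Fintype B] [DecidableEq B] [Finite W] in
theorem inner_rootSeq {n : ℕ} (e : B ≃ Fin n) {i j : ℕ} (hi : i < n) (hj : j < n) :
    ⟪ρ.rootSeq e i, ρ.rootSeq e j⟫_ℝ = gram M (e.symm ⟨i, hi⟩) (e.symm ⟨j, hj⟩) := by
  rw [rootSeq, rootSeq, dif_pos hi, dif_pos hj, ρ.inner_root]

omit [Fintype B] [DecidableEq B] [Finite W] in
theorem exists_dual_rootSeq {n : ℕ} (e : B ≃ Fin n) (hn : 0 < n)
    (hlin : LinearIndependent ℝ ρ.root) :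
    ∃ ω : V, ω ≠ 0 ∧ ∀ i < n, 2 * ⟪ρ.rootSeq e i, ω⟫_ℝ = if i = 0 then 1 else 0 := by
  obtain ⟨ω, h1, h2⟩ := exists_dual_root hlin (e.symm ⟨0, hn⟩)
  refine ⟨ω, by rintro rfl; simp at h1, fun i hi => ?_⟩
  rw [rootSeq, dif_pos hi]
  by_cases h0 : i = 0
  · subst h0; rw [if_pos rfl, h1]
  · rw [if_neg h0, h2, mul_zero]
    intro h3
    have := congrArg Fin.val (e.symm.injective h3)
    exact h0 this

theorem projectsToPolygon_and_isNoncrossing_iff_of_A {n : ℕ} (hn : 2 ≤ n) (e : B ≃ Fin n)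
    (hM : M.reindex e = CoxeterMatrix.A n) (β : Bipartition M) {o : Set V}
    (ho : ρ.IsSmallestOrbit o) : (o.ncard = coxeterNumber cs β ∧ ρ.ProjectsToPolygon β o) ∧
    ∀ W' : Subgroup W, IsParabolic cs W' →
      (IsNoncrossing cs (bipartiteCoxeterElement cs β) W' ↔ ρ.HullsDisjoint β o W') := by
  have hMab : ∀ a b : Fin n, M (e.symm a) (e.symm b) =
      if (a : ℕ) = b then 1 else if (a : ℕ) + 1 = b ∨ (a : ℕ) = b + 1 then 3 else 2 := by
    intro a b
    have h1 := congrArg (fun N : CoxeterMatrix (Fin n) => N a b) hM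
    simp only [CoxeterMatrix.reindex_apply] at h1
    rw [h1]
    change (if a = b then 1 else if (b : ℕ) + 1 = a ∨ (a : ℕ) + 1 = b then 3 else 2) = _
    simp only [Fin.ext_iff]
    split_ifs <;> omega
  have hG : ∀ a b : Fin n, gram M (e.symm a) (e.symm b) = if (a : ℕ) = b then 1 else
      if (a : ℕ) + 1 = b ∨ (a : ℕ) = b + 1 then -(1 / 2) else 0 := by
    intro a b
    rw [gram_apply, hMab]
    split_ifs <;> simp
  have hconn : DiagramConnected M := by
    refine diagramConnected_of_path e fun i j hij => ?_
    have h1 := hMab (e i) (e j)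
    rw [e.symm_apply_apply, e.symm_apply_apply, if_neg (by omega), if_pos (Or.inl hij)] at h1
    omega
  set θ := Real.pi / (n + 1 : ℕ) with hθ
  -- The sines satisfy the path recurrence and, with `θ = π / (n + 1)`, vanish at both fictitious
  -- end nodes `0` and `n + 1`.
  have hz : IsPerronVector M (fun i => Real.sin (((e i : ℕ) + 1 : ℕ) * θ)) (1 - Real.cos θ) := by
    refine isPerronVector_comp e (z := fun a => Real.sin (((a : ℕ) + 1 : ℕ) * θ))
      (fun a => sin_mul_pi_div_pos (by omega) (by omega)) fun a => ?_
    rw [← sin_path, show Real.sin (((a : ℕ) + 2 : ℕ) * θ) =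
      if (a : ℕ) + 1 < n then Real.sin (((a : ℕ) + 2 : ℕ) * θ) else 0 by
        split_ifs with h1
        · rfl
        · rw [show (a : ℕ) + 2 = n + 1 by omega, hθ, mul_div_cancel₀ _ (by positivity),
            Real.sin_pi],
      ← sum_path a.isLt (s := fun k => Real.sin (k * θ)) (by simp)]
    refine Finset.sum_congr rfl fun b _ => ?_
    rw [hG]
    split_ifs <;> first | omega | (simp; try ring)
  have hμ := one_sub_cos_pi_div_pos (show 0 < n + 1 by omega)
  have hlin := ρ.linearIndependent_root hz hμ
  have hdim : finrank ℝ V = n := by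
    rw [ρ.finrank_eq_card hz hμ, Fintype.card_congr e, Fintype.card_fin]
  have : Nonempty B := ⟨e.symm ⟨0, by omega⟩⟩
  obtain ⟨Φ, hΦ⟩ := ρ.exists_planeCoordinate (show 3 ≤ n + 1 by omega) hz hconn β
  refine projectsToPolygon_and_isNoncrossing_iff hconn (show 0 < n + 1 by omega) hΦ ho ?_
    fun x hx _ W' hW' => hx.isNoncrossing_iff_of_eq_finrank_add_one (by rw [hdim]) (by omega) hW'
  obtain ⟨ω, hω0, hω⟩ := exists_dual_rootSeq e (by omega) hlin
  have hp := fun {i k} => inner_chainPoint (r := ρ.rootSeq e) (ω := ω) (i := i) (k := k)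
    (fun i hi j hj => by rw [inner_rootSeq e hi hj, hG]) hω
  classical
  set p := chainPoint (ρ.rootSeq e) ω with hp'
  obtain ⟨o', h1, h2⟩ := exists_orbit_subset (ρ := ρ)
    (F := ((Finset.range (n + 1)).image p : Finset V)) (y := ω) (by
      intro i a ha
      rw [Finset.mem_coe, Finset.mem_image] at ha ⊢
      obtain ⟨k, hk, rfl⟩ := ha
      rw [Finset.mem_range] at hk
      have hlt := (e i).isLt
      rw [act_simple_apply, ← rootSeq_apply e, hp hlt (by omega)]
      by_cases h1 : (e i : ℕ) = k
      · refine ⟨k + 1, by rw [Finset.mem_range]; omega, ?_⟩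
        rw [if_pos h1, if_neg (by omega), sub_zero, one_smul, h1, hp', chainPoint_succ]
      by_cases h2 : (e i : ℕ) + 1 = k
      · refine ⟨e i, by rw [Finset.mem_range]; omega, ?_⟩
        rw [if_neg h1, if_pos h2, zero_sub, neg_one_smul, ← h2, hp', chainPoint_succ]
        abel
      · refine ⟨k, by rw [Finset.mem_range]; omega, ?_⟩
        rw [if_neg h1, if_neg h2, sub_zero, zero_smul, sub_zero])
    (Finset.mem_coe.2 (Finset.mem_image.2 ⟨0, by simp, by simp [hp', chainPoint]⟩)) hω0
  refine ⟨o', h1, (Set.ncard_le_ncard h2 (Finset.finite_toSet _)).trans ?_⟩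
  rw [Set.ncard_coe_finset]
  exact Finset.card_image_le.trans (by simp)

end Realization
end CoxeterPlane

/-! ### Type B -/

namespace CoxeterPlane
open scoped InnerProductSpace
open Module (finrank)

namespace Realization

variable {B W V : Type*} [Group W] {M : CoxeterMatrix B} {cs : CoxeterSystem M W}
  [NormedAddCommGroup V] [InnerProductSpace ℝ V] {ρ : Realization cs V}

/-- Central symmetry of one spanning cyclic orbit `y` gives `c ^ n = -1` on `V`, hence on any other
cyclic orbit. This transfers the symmetry of the constructed orbit to the given smallest one. -/
theorem IsCyclicOrbit.apply_add_eq_neg {c : W} {n : ℕ} {x y : ℤ → V}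
    (hx : ρ.IsCyclicOrbit c (2 * n) x) (hy : ρ.IsCyclicOrbit c (2 * n) y)
    (hneg : -y 0 ∈ Set.range y) (k : ℤ) : x (k + n) = -x k := by
  obtain ⟨l, hl⟩ := hneg
  have hpos := hx.pos
  have hne : y l ≠ y 0 := by
    intro e
    have h4 : (2 : ℝ) • y 0 = 0 := by
      rw [two_smul]
      nth_rewrite 1 [← e, hl]
      exact neg_add_cancel _
    exact hy.ne_zero (by omega) 0 (by simpa using h4)
  obtain ⟨d, hd, hanti⟩ := hy.exists_antipode hl hne
  have hd : d = n := by push_cast at hd; omega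
  have h1 : Submodule.span ℝ (Set.range y) ≤ LinearMap.eqLocus
      (ρ.act (c ^ (n : ℤ))).toLinearEquiv.toLinearMap (-LinearMap.id) := by
    rw [Submodule.span_le]
    rintro _ ⟨m, rfl⟩
    change ρ.act (c ^ (n : ℤ)) (y m) = -y m
    rw [hy.act_zpow, ← hd, hanti]
  rw [hy.span_eq] at h1
  have h2 : ρ.act (c ^ (n : ℤ)) (x k) = -x k := h1 (Submodule.mem_top (x := x k))
  rw [← h2, hx.act_zpow]

variable [FiniteDimensional ℝ V] [Fintype B] [DecidableEq B] [Finite W]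

theorem projectsToPolygon_and_isNoncrossing_iff_of_B {n : ℕ} (hn : 2 ≤ n) (e : B ≃ Fin n)
    (hM : M.reindex e = CoxeterMatrix.B n) (β : Bipartition M) {o : Set V}
    (ho : ρ.IsSmallestOrbit o) : (o.ncard = coxeterNumber cs β ∧ ρ.ProjectsToPolygon β o) ∧
    ∀ W' : Subgroup W, IsParabolic cs W' →
      (IsNoncrossing cs (bipartiteCoxeterElement cs β) W' ↔ ρ.HullsDisjoint β o W') := by
  obtain ⟨N, rfl⟩ : ∃ N, n = N + 2 := ⟨n - 2, by omega⟩
  have hMab : ∀ a b : Fin (N + 2), M (e.symm a) (e.symm b) =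
      if (a : ℕ) = b then 1 else if (a : ℕ) + 1 = b ∨ (a : ℕ) = b + 1 then
        if (a : ℕ) = N + 1 ∨ (b : ℕ) = N + 1 then 4 else 3 else 2 := by
    intro a b
    have h1 := congrArg (fun N : CoxeterMatrix (Fin (N + 2)) => N a b) hM
    simp only [CoxeterMatrix.reindex_apply] at h1
    rw [h1]
    change (if a = b then 1 else if (a : ℕ) = N + 2 - 1 ∧ (b : ℕ) = N + 2 - 2 ∨
      (b : ℕ) = N + 2 - 1 ∧ (a : ℕ) = N + 2 - 2 then 4 else
        if (b : ℕ) + 1 = a ∨ (a : ℕ) + 1 = b then 3 else 2) = _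
    have := a.isLt
    have := b.isLt
    simp only [Fin.ext_iff]
    split_ifs <;> omega
  have hG : ∀ a b : Fin (N + 2), gram M (e.symm a) (e.symm b) = if (a : ℕ) = b then 1 else
      if (a : ℕ) + 1 = b ∨ (a : ℕ) = b + 1 then
        if (a : ℕ) = N + 1 ∨ (b : ℕ) = N + 1 then -(√2 / 2) else -(1 / 2) else 0 := by
    intro a b
    rw [gram_apply, hMab]
    split_ifs <;> simp
  have h2 : √2 * √2 = 2 := Real.mul_self_sqrt (by norm_num)
  have hconn : DiagramConnected M := by
    refine diagramConnected_of_path e fun i j hij => ?_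
    have h1 := hMab (e i) (e j)
    rw [e.symm_apply_apply, e.symm_apply_apply, if_neg (by omega), if_pos (Or.inl hij)] at h1
    split_ifs at h1 <;> omega
  set θ := Real.pi / (2 * (N + 2) : ℕ) with hθ
  have hθn : ((N + 2 : ℕ) : ℝ) * θ = Real.pi / 2 := by
    rw [hθ]; push_cast; field_simp
  have hsin : Real.sin ((N + 2 : ℕ) * θ) = 1 := by rw [hθn, Real.sin_pi_div_two]
  have hcos : Real.sin ((N + 1 : ℕ) * θ) = Real.cos θ := by
    rw [show ((N + 1 : ℕ) : ℝ) * θ = (N + 2 : ℕ) * θ - θ by push_cast; ring, hθn,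
      Real.sin_pi_div_two_sub]
  -- The sine sequence now ends at its maximum `sin (π / 2) = 1`; scaling this last entry by `√2 /
  -- 2` compensates for the Gram entry `-√2 / 2` of the last edge.
  have hz : IsPerronVector M (fun i => if (e i : ℕ) = N + 1 then √2 / 2 else
      Real.sin (((e i : ℕ) + 1 : ℕ) * θ)) (1 - Real.cos θ) := by
    refine isPerronVector_comp e (z := fun a => if (a : ℕ) = N + 1 then √2 / 2 else
      Real.sin (((a : ℕ) + 1 : ℕ) * θ)) (fun a => ?_) fun a => ?_
    · split_ifs
      · positivity
      · exact sin_mul_pi_div_pos (by omega) (by omega)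
    have ha := a.isLt
    by_cases haN : (a : ℕ) = N + 1
    · rw [Finset.sum_eq_add (a := ⟨N, by omega⟩) (b := ⟨N + 1, by omega⟩)]
      · rw [hG, hG]
        simp [haN]
        rw [← hcos]
        push_cast
        ring
      · simp
      · rintro b - ⟨hb1, hb2⟩
        simp only [ne_eq, Fin.ext_iff] at hb1 hb2
        rw [hG, if_neg (by omega), if_neg (by omega), zero_mul]
      · simp
      · simp
    · rw [if_neg haN, ← sin_path, show Real.sin (((a : ℕ) + 2 : ℕ) * θ) =
        if (a : ℕ) + 1 < N + 2 then Real.sin (((a : ℕ) + 2 : ℕ) * θ) else 0 by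
          rw [if_pos (by omega)],
        ← sum_path a.isLt (s := fun k => Real.sin (k * θ)) (by simp)]
      refine Finset.sum_congr rfl fun b _ => ?_
      have hb := b.isLt
      rw [hG]
      by_cases hb1 : (b : ℕ) = N + 1
      · rw [if_pos hb1, if_neg (by omega), if_neg (show ¬ (b : ℕ) = a by omega),
          if_neg (show ¬ (b : ℕ) + 1 = a by omega)]
        by_cases hba : (b : ℕ) = a + 1
        · rw [if_pos (Or.inl hba.symm), if_pos (Or.inr hb1), if_pos hba, hb1, hsin]
          linear_combination (-1 / 4) * h2
        · rw [if_neg (by omega), if_neg hba]; ring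
      · rw [if_neg hb1]
        split_ifs <;> first | omega | (simp; try ring)
  have hμ := one_sub_cos_pi_div_pos (show 0 < 2 * (N + 2) by omega)
  have hlin := ρ.linearIndependent_root hz hμ
  have hdim : finrank ℝ V = N + 2 := by
    rw [ρ.finrank_eq_card hz hμ, Fintype.card_congr e, Fintype.card_fin]
  have : Nonempty B := ⟨e.symm ⟨0, by omega⟩⟩
  obtain ⟨Φ, hΦ⟩ := ρ.exists_planeCoordinate (show 3 ≤ 2 * (N + 2) by omega) hz hconn β
  obtain ⟨ω, hω0, hω⟩ := exists_dual_rootSeq e (by omega) hlin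
  set r := ρ.rootSeq e with hr
  have hrr : ∀ i < N + 2, ∀ j < N + 2, ⟪r i, r j⟫_ℝ = if i = j then 1 else
      if i + 1 = j ∨ i = j + 1 then if i = N + 1 ∨ j = N + 1 then -(√2 / 2) else -(1 / 2)
      else 0 := fun i hi j hj => by rw [hr, inner_rootSeq e hi hj, hG]
  set p := chainPoint r ω with hp'
  have hp : ∀ i < N + 1, ∀ k ≤ N + 1, 2 * ⟪r i, p k⟫_ℝ =
      (if i = k then 1 else 0) - if i + 1 = k then 1 else 0 := by
    intro i hi k hk
    refine inner_chainPoint (fun i hi j hj => ?_) (fun i hi => hω i (by omega)) hi hk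
    rw [hrr i (by omega) j (by omega)]
    split_ifs <;> first | rfl | omega
  have hlast : ∀ k ≤ N + 1, 2 * ⟪r (N + 1), p k⟫_ℝ = if k = N + 1 then √2 else 0 := by
    intro k
    induction k with
    | zero =>
      intro _
      rw [hp', chainPoint, Finset.range_zero, Finset.sum_empty, sub_zero, hω _ (by omega),
        if_neg (by omega), if_neg (by omega)]
    | succ k ih =>
      intro hk
      rw [hp', chainPoint_succ, inner_sub_right, mul_sub, ← hp', ih (by omega), if_neg (by omega),
        hrr _ (by omega) _ (by omega), if_neg (by omega)]
      by_cases h1 : k = N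
      · rw [if_pos (by omega), if_pos (by omega), if_pos (by omega)]; ring
      · rw [if_neg (by omega), if_neg (by omega)]; ring
  -- The last chain point is a multiple of the last root, so the last simple reflection negates it.
  -- This makes the set of all `±p k` stable under `W`.
  have hpN : p (N + 1) = (√2 / 2) • r (N + 1) := by
    rw [← sub_eq_zero]
    refine ρ.eq_zero_of_inner_root fun i => ?_
    have hi := (e i).isLt
    rw [← rootSeq_apply e, ← hr, inner_sub_right, inner_smul_right, hrr _ hi _ (by omega)]
    by_cases h1 : (e i : ℕ) = N + 1
    · have h3 := hlast (N + 1) le_rfl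
      rw [if_pos rfl] at h3
      rw [if_pos h1, h1]
      linarith
    · have h3 := hp (e i) (by omega) (N + 1) le_rfl
      rw [if_neg h1] at h3 ⊢
      by_cases h4 : (e i : ℕ) + 1 = N + 1
      · rw [if_pos h4] at h3
        rw [if_pos (Or.inl h4), if_pos (Or.inr rfl)]
        linear_combination (1 / 2) * h3 + (1 / 4) * h2
      · rw [if_neg h4] at h3
        rw [if_neg (by omega)]
        linarith
  classical
  set F : Finset V := (Finset.range (N + 2)).image p ∪ (Finset.range (N + 2)).image fun k => -p k
    with hF
  have hmem : ∀ k < N + 2, p k ∈ F ∧ -p k ∈ F := by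
    intro k hk
    rw [hF, Finset.mem_union, Finset.mem_union]
    exact ⟨Or.inl (Finset.mem_image_of_mem _ (Finset.mem_range.2 hk)),
      Or.inr (Finset.mem_image_of_mem (fun k => -p k) (Finset.mem_range.2 hk))⟩
  have hF' : ∀ a ∈ F, ∃ k < N + 2, a = p k ∨ a = -p k := by
    intro a ha
    rw [hF, Finset.mem_union, Finset.mem_image, Finset.mem_image] at ha
    rcases ha with ⟨k, hk, rfl⟩ | ⟨k, hk, rfl⟩
    · exact ⟨k, Finset.mem_range.1 hk, Or.inl rfl⟩
    · exact ⟨k, Finset.mem_range.1 hk, Or.inr rfl⟩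
  have hFcard : F.card ≤ 2 * (N + 2) := by
    refine (Finset.card_union_le _ _).trans ?_
    rw [two_mul]
    exact Nat.add_le_add (Finset.card_image_le.trans (by simp))
      (Finset.card_image_le.trans (by simp))
  have hstep : ∀ i, ∀ k < N + 2, ∃ l < N + 2,
      ρ.act (cs.simple i) (p k) = p l ∨ ρ.act (cs.simple i) (p k) = -p l := by
    intro i k hk
    have hlt := (e i).isLt
    rw [act_simple_apply, ← rootSeq_apply e, ← hr]
    by_cases hi : (e i : ℕ) = N + 1
    · refine ⟨k, hk, ?_⟩
      rw [hi, hlast k (by omega)]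
      by_cases h1 : k = N + 1
      · right
        rw [if_pos h1, h1, hpN]
        module
      · left
        rw [if_neg h1, zero_smul, sub_zero]
    rw [hp (e i) (by omega) k (by omega)]
    by_cases h1 : (e i : ℕ) = k
    · refine ⟨k + 1, by omega, Or.inl ?_⟩
      rw [if_pos h1, if_neg (by omega), sub_zero, one_smul, h1, hp', chainPoint_succ]
    by_cases h2 : (e i : ℕ) + 1 = k
    · refine ⟨e i, by omega, Or.inl ?_⟩
      rw [if_neg h1, if_pos h2, zero_sub, neg_one_smul, ← h2, hp', chainPoint_succ]
      abel
    · refine ⟨k, by omega, Or.inl ?_⟩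
      rw [if_neg h1, if_neg h2, sub_zero, zero_smul, sub_zero]
  obtain ⟨o', ho', hoF⟩ := exists_orbit_subset (ρ := ρ) (F := (F : Set V)) (y := ω) (by
      intro i a ha
      obtain ⟨k, hk, rfl | rfl⟩ := hF' a ha
      · obtain ⟨l, hl, e | e⟩ := hstep i k hk
        · rw [e]; exact (hmem l hl).1
        · rw [e]; exact (hmem l hl).2
      · rw [map_neg]
        obtain ⟨l, hl, e | e⟩ := hstep i k hk
        · rw [e]; exact (hmem l hl).2
        · rw [e, neg_neg]; exact (hmem l hl).1)
    (by have := (hmem 0 (by omega)).1; rwa [hp', chainPoint, Finset.range_zero, Finset.sum_empty,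
          sub_zero] at this) hω0
  have hcard : o'.ncard ≤ 2 * (N + 2) := by
    refine (Set.ncard_le_ncard hoF (Finset.finite_toSet _)).trans ?_
    rwa [Set.ncard_coe_finset]
  obtain ⟨y, hy, hyo, -⟩ := hΦ.exists_cyclicOrbit (show 0 < 2 * (N + 2) by omega) hconn ho' hcard
  -- The orbit has exactly `2 (N + 2)` points and `F` has at most as many, so the orbit fills `F`
  -- and is centrally symmetric.
  have hyF : Set.range y = F := by
    rw [hyo]
    refine Set.eq_of_subset_of_ncard_le hoF ?_ (Finset.finite_toSet _)
    rwa [Set.ncard_coe_finset, ← hyo, hy.ncard_range]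
  have hneg : -y 0 ∈ Set.range y := by
    have h1 : y 0 ∈ (F : Set V) := hyF ▸ ⟨0, rfl⟩
    rw [hyF]
    obtain ⟨k, hk, h3 | h3⟩ := hF' _ h1
    · rw [h3]; exact (hmem k hk).2
    · rw [h3, neg_neg]; exact (hmem k hk).1
  refine projectsToPolygon_and_isNoncrossing_iff hconn (show 0 < 2 * (N + 2) by omega) hΦ ho
    ⟨o', ho', hcard⟩ fun x hx _ W' hW' => ?_
  exact hx.isNoncrossing_iff_of_eq_two_mul_finrank (by rw [hdim])
    (fun k => by rw [hdim]; exact hx.apply_add_eq_neg hy hneg k) hlin hW'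

end Realization
end CoxeterPlane

theorem mainTheorem5 {B W V : Type*} [Fintype B] [DecidableEq B] [Group W] [Finite W]
    [NormedAddCommGroup V] [InnerProductSpace ℝ V] [FiniteDimensional ℝ V]
    (M : CoxeterMatrix B) (hM : CoxeterPlane.IsTypeABI M) (cs : CoxeterSystem M W)
    (ρ : CoxeterPlane.Realization cs V) (β : CoxeterPlane.Bipartition M)
    (o : Set V) (ho : ρ.IsSmallestOrbit o) :
    (o.ncard = CoxeterPlane.coxeterNumber cs β ∧ ρ.ProjectsToPolygon β o) ∧
    ∀ W' : Subgroup W, CoxeterPlane.IsParabolic cs W' →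
      (CoxeterPlane.IsNoncrossing cs (CoxeterPlane.bipartiteCoxeterElement cs β) W' ↔
        ρ.HullsDisjoint β o W') := by
  rcases hM with ⟨n, hn, e, hM⟩ | ⟨n, hn, e, hM⟩ | ⟨k, hk, e, hM⟩
  -- `A_1` is separated off because `h = 2` there.
  · rcases hn.eq_or_lt with rfl | hn
    · exact CoxeterPlane.Realization.projectsToPolygon_and_isNoncrossing_iff_of_unique (e.symm 0)
        (fun j => by rw [e.eq_symm_apply]; exact Subsingleton.elim _ _) β ho
    · exact CoxeterPlane.Realization.projectsToPolygon_and_isNoncrossing_iff_of_A hn e hM β ho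
  · exact CoxeterPlane.Realization.projectsToPolygon_and_isNoncrossing_iff_of_B hn e hM β ho
  · exact CoxeterPlane.Realization.projectsToPolygon_and_isNoncrossing_iff_of_I hk e hM β ho
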